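/- Identify the universal cover $\widetilde{SU}(1,1)$ of $SU(1,1)=\{\begin{pmatrix} z_1&z_2\\ \bar z_2&\bar z_1\end{pmatrix} : |z_1|^2-|z_2|^2=1\}$ with $\mathbb R\times\mathbb C$, with covering map $$\pi(c,w)=\begin{pmatrix}\sqrt{1+|w|^2}\,e^{ic} & w\\ \bar w & \sqrt{1+|w|^2}\,e^{-ic}\end{pmatrix}$$ and identity $\tilde 1=(0,0)$. Let $\widetilde X,\widetilde Y$ be the left-invariant vector fields that lift those generated by $X=\begin{pmatrix}0&-1\\-1&0\end{pmatrix}$ and $Y=\begin{pmatrix}0&i\\-i&0\end{pmatrix}$, let $\widetilde D=\mathrm{span}\{\widetilde X,\widetilde Y\}$, and equip $\widetilde D$ with the lift of the metric $\frac18\mathrm{Kil}$, for which $\widetilde X,\widetilde Y$ are orthonormal. A horizontal curve is an absolutely continuous curve that is almost everywhere tangent to $\widetilde D$; a geodesic is a horizontal curve that is locally length minimizing. Geodesics are counted up to reparametrization, i.e. as curves on $[0,1]$ of constant speed (constant curves are allowed). Two geodesics from $\tilde 1$ to $\tilde g$ are geometrically similar if one is the image of the other under an isometry, that is, a diffeomorphism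 of $\widetilde{SU}(1,1)$ that preserves $\widetilde D$ and the metric on it. For $k\ge1$ let $\chi_k$ be the unique solution of $\tan\chi=\chi$ in $(\pi k,\pi k+\frac{\pi}{2})$. The geodesics from $\tilde 1$ to $\tilde g=(c,w)$ satisfy the following. (a) If $\tilde g=(c,0)$ with $c\ne0$, then there are uncountably many geodesics, and they form a countably infinite number of classes under geometric similarity. (b) If $\tilde g=(0,w)$, then there is exactly one geodesic, and it is contained in the horizontal space $\{c=0\}$. (c) Let $c\neq0$ and $w\ne0$, and consider the integers $k\ge1$ with $$|c|\ \ge\ \sqrt{|w|^2+\chi_k^2+|w|^2\chi_k^2}-\chi_k-\tan^{-1}\left(\frac{\sqrt{|w|^2+\chi_k^2+|w|^2\chi_k^2}-\chi_k}{1+\chi_k\sqrt{|w|^2+\chi_k^2+|w|^2\chi_k^2}}\right).$$ If there is no such $k$, then there is exactly one geodesic. Otherwise there is a largest such $k$; if the inequality is strict for this $k$, then there are exactly $2k+1$ geodesics, and if it is an equality, then there are exactly $2k$. -/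

import Mathlib

open scoped ContDiff

noncomputable section

/-- The universal cover of `SU(1,1)`, with its global coordinates `(c, w)`; its tangent spaces are
identified with `ℝ × ℂ` as well. -/
abbrev CSU : Type := ℝ × ℂ

namespace CSU

/-- The covering map onto `SU(1,1)`, the group of complex matrices `(z₁, z₂; conj z₂, conj z₁)`
with `|z₁|² - |z₂|² = 1`. -/
def cover (g : CSU) : Matrix (Fin 2) (Fin 2) ℂ :=
  !![(√(1 + ‖g.2‖ ^ 2) : ℝ) * Complex.exp (Complex.I * g.1), g.2;
    star g.2, (√(1 + ‖g.2‖ ^ 2) : ℝ) * Complex.exp (-(Complex.I * g.1))]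

/-- The identity element of the group, lying over the identity matrix. -/
def one : CSU := (0, 0)

/-- The element `X` of the Lie algebra `su(1,1)`. -/
def lieX : Matrix (Fin 2) (Fin 2) ℂ := !![0, -1; -1, 0]

/-- The element `Y` of the Lie algebra `su(1,1)`. -/
def lieY : Matrix (Fin 2) (Fin 2) ℂ := !![0, Complex.I; -Complex.I, 0]

/-- The left-invariant vector field lifting `h ↦ h * lieX` through the covering map
(see `hasDerivAt_cover_fieldX`). -/
def fieldX (g : CSU) : CSU :=
  (-(g.2 * Complex.exp (-(Complex.I * g.1))).im / √(1 + ‖g.2‖ ^ 2),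
    -((√(1 + ‖g.2‖ ^ 2) : ℝ) * Complex.exp (Complex.I * g.1)))

/-- The left-invariant vector field lifting `h ↦ h * lieY` through the covering map
(see `hasDerivAt_cover_fieldY`). -/
def fieldY (g : CSU) : CSU :=
  (-(g.2 * Complex.exp (-(Complex.I * g.1))).re / √(1 + ‖g.2‖ ^ 2),
    Complex.I * ((√(1 + ‖g.2‖ ^ 2) : ℝ) * Complex.exp (Complex.I * g.1)))

/-- The horizontal distribution spanned by the two left-invariant fields. -/
def distribution (g : CSU) : Submodule ℝ CSU := Submodule.span ℝ {fieldX g, fieldY g}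

/-- The quadratic form `v ↦ ρ(v, v)` of the lifted bi-invariant metric `ρ = Kil / 8`: the pull-back
of `|dz₂|² - |dz₁|²` under the covering map (see `metric_eq`). Both fields above are of unit
length and orthogonal (see `metric_horizontal`). -/
def metric (g v : CSU) : ℝ :=
  ‖v.2‖ ^ 2 - (star g.2 * v.2).re ^ 2 / (1 + ‖g.2‖ ^ 2) - (1 + ‖g.2‖ ^ 2) * v.1 ^ 2

/-- A curve is horizontal on `[a, b]` if it is absolutely continuous there and almost everywhere
tangent to the distribution. -/
def IsHorizontal (γ : ℝ → CSU) (a b : ℝ) : Prop :=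
  AbsolutelyContinuousOnInterval γ a b ∧
    ∀ᵐ t : ℝ, t ∈ Set.Icc a b → ∃ v ∈ distribution (γ t), HasDerivAt γ v t

/-- The speed of a curve. -/
def speed (γ : ℝ → CSU) (t : ℝ) : ℝ := √(metric (γ t) (deriv γ t))

/-- The length of a horizontal curve on `[a, b]`. -/
def length (γ : ℝ → CSU) (a b : ℝ) : ℝ := ∫ t in a..b, speed γ t

/-- `γ` is a shortest horizontal curve on `[a, b]` between its end points. -/
def IsLengthMinimizing (γ : ℝ → CSU) (a b : ℝ) : Prop :=
  IsHorizontal γ a b ∧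
    ∀ η : ℝ → CSU, IsHorizontal η a b → η a = γ a → η b = γ b → length γ a b ≤ length η a b

/-- A geodesic on `[0, 1]`: a horizontal curve that is locally length minimizing. It is normalized
to have constant speed, which selects one curve from each class up to reparametrization. -/
def IsGeodesic (γ : ℝ → CSU) : Prop :=
  IsHorizontal γ 0 1 ∧
  (∀ t₀ ∈ Set.Icc (0 : ℝ) 1, ∃ ε > 0, ∀ a ∈ Set.Icc (0 : ℝ) 1, ∀ b ∈ Set.Icc (0 : ℝ) 1,
    t₀ - ε < a → a ≤ b → b < t₀ + ε → IsLengthMinimizing γ a b) ∧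
  ∃ r : ℝ, ∀ᵐ t : ℝ, t ∈ Set.Icc (0 : ℝ) 1 → speed γ t = r

/-- The set of geodesics from the identity to `g`, up to reparametrization. -/
def geodesics (g : CSU) : Set (Path one g) := {p | IsGeodesic p.extend}

/-- An isometry of the sub-Riemannian manifold: a diffeomorphism that preserves the distribution
and the metric on it. -/
structure IsIsometry (Φ : CSU ≃ CSU) : Prop where
  contDiff : ContDiff ℝ ∞ Φ
  contDiff_symm : ContDiff ℝ ∞ Φ.symm
  mem_iff : ∀ g v, fderiv ℝ Φ g v ∈ distribution (Φ g) ↔ v ∈ distribution g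
  metric_eq : ∀ g, ∀ v ∈ distribution g, metric (Φ g) (fderiv ℝ Φ g v) = metric g v

theorem IsIsometry.refl : IsIsometry (Equiv.refl CSU) where
  contDiff := contDiff_id
  contDiff_symm := contDiff_id
  mem_iff g v := by
    have : fderiv ℝ (⇑(Equiv.refl CSU)) g = ContinuousLinearMap.id ℝ CSU := fderiv_id
    rw [this]; rfl
  metric_eq g v _ := by
    have : fderiv ℝ (⇑(Equiv.refl CSU)) g = ContinuousLinearMap.id ℝ CSU := fderiv_id
    rw [this]; rfl

theorem IsIsometry.trans {Φ Ψ : CSU ≃ CSU} (hΦ : IsIsometry Φ) (hΨ : IsIsometry Ψ) :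
    IsIsometry (Φ.trans Ψ) := by
  have key : ∀ g v, fderiv ℝ (⇑(Φ.trans Ψ)) g v = fderiv ℝ Ψ (Φ g) (fderiv ℝ Φ g v) := by
    intro g v
    have h := fderiv_comp (𝕜 := ℝ) g (hΨ.contDiff.differentiable (by simp) (Φ g))
      (hΦ.contDiff.differentiable (by simp) g)
    rw [Equiv.coe_trans, h]; rfl
  refine ⟨hΨ.contDiff.comp hΦ.contDiff, hΦ.contDiff_symm.comp hΨ.contDiff_symm, ?_, ?_⟩
  · intro g v
    rw [key]
    exact (hΨ.mem_iff _ _).trans (hΦ.mem_iff _ _)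
  · intro g v hv
    rw [key]
    exact (hΨ.metric_eq _ _ ((hΦ.mem_iff _ _).2 hv)).trans (hΦ.metric_eq _ _ hv)

theorem IsIsometry.symm {Φ : CSU ≃ CSU} (hΦ : IsIsometry Φ) : IsIsometry Φ.symm := by
  have key : ∀ g v, fderiv ℝ Φ (Φ.symm g) (fderiv ℝ Φ.symm g v) = v := by
    intro g v
    have h := fderiv_comp (𝕜 := ℝ) g (hΦ.contDiff.differentiable (by simp) (Φ.symm g))
      (hΦ.contDiff_symm.differentiable (by simp) g)
    have h2 : (⇑Φ ∘ ⇑Φ.symm) = id := by ext1 x; simp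
    rw [h2, fderiv_id] at h
    exact (DFunLike.congr_fun h v).symm
  refine ⟨hΦ.contDiff_symm, hΦ.contDiff, ?_, ?_⟩
  · intro g v
    have h := hΦ.mem_iff (Φ.symm g) (fderiv ℝ Φ.symm g v)
    rw [key, Φ.apply_symm_apply] at h
    exact h.symm
  · intro g v hv
    have h0 := hΦ.mem_iff (Φ.symm g) (fderiv ℝ Φ.symm g v)
    rw [key, Φ.apply_symm_apply] at h0
    have h := hΦ.metric_eq (Φ.symm g) (fderiv ℝ Φ.symm g v) (h0.1 hv)
    rw [key, Φ.apply_symm_apply] at h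
    exact h.symm

/-- Two geodesics from the identity to `g` are geometrically similar if one is the image of the
other under an isometry. -/
def geometricallySimilar (g : CSU) : Setoid (geodesics g) where
  r p q := ∃ Φ : CSU ≃ CSU, IsIsometry Φ ∧ ∀ t, q.1 t = Φ (p.1 t)
  iseqv :=
    { refl := fun _ => ⟨Equiv.refl CSU, IsIsometry.refl, fun _ => rfl⟩
      symm := fun ⟨Φ, h, e⟩ => ⟨Φ.symm, h.symm, fun t => by rw [e t, Φ.symm_apply_apply]⟩
      trans := fun ⟨Φ, h, e⟩ ⟨Ψ, h', e'⟩ =>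
        ⟨Φ.trans Ψ, h.trans h', fun t => by rw [e' t, e t]; rfl⟩ }

/-- For `k ≥ 1`, the number `χ_k`: the unique root of `tan χ = χ` in the interval
`(π k, π k + π / 2)` (see `existsUnique_chi` and `chi_spec`). -/
def chi (k : ℕ) : ℝ :=
  sInf {x : ℝ | x ∈ Set.Ioo (Real.pi * k) (Real.pi * k + Real.pi / 2) ∧ Real.tan x = x}

/-- The threshold for `|c|` that belongs to `χ_k` and `w`. -/
def threshold (k : ℕ) (w : ℂ) : ℝ :=
  √(‖w‖ ^ 2 + chi k ^ 2 + ‖w‖ ^ 2 * chi k ^ 2) - chi k -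
    Real.arctan ((√(‖w‖ ^ 2 + chi k ^ 2 + ‖w‖ ^ 2 * chi k ^ 2) - chi k) /
      (1 + chi k * √(‖w‖ ^ 2 + chi k ^ 2 + ‖w‖ ^ 2 * chi k ^ 2)))

/-! Checks that the definitions above are the intended ones. -/

theorem existsUnique_chi {k : ℕ} (hk : 1 ≤ k) :
    ∃! x : ℝ, x ∈ Set.Ioo (Real.pi * k) (Real.pi * k + Real.pi / 2) ∧ Real.tan x = x := by
  have hpi := Real.pi_pos
  have hk' : (1 : ℝ) ≤ k := by exact_mod_cast hk
  have hpos : 0 < Real.pi * k := by positivity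
  have htan : ∀ x : ℝ, Real.tan (x - Real.pi * k) = Real.tan x := by
    intro x; rw [mul_comm]; exact Real.tan_sub_nat_mul_pi x k
  have hder : ∀ x : ℝ, HasDerivAt (fun y => y - Real.arctan y - Real.pi * k)
      (1 - 1 / (1 + x ^ 2)) x := fun x =>
    ((hasDerivAt_id x).sub (Real.hasDerivAt_arctan x)).sub_const _
  have hcont : Continuous (fun y : ℝ => y - Real.arctan y - Real.pi * k) := by fun_prop
  have hmono : StrictMonoOn (fun y : ℝ => y - Real.arctan y - Real.pi * k) (Set.Ici 0) := by
    apply strictMonoOn_of_deriv_pos (convex_Ici 0) hcont.continuousOn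
    intro x hx
    rw [interior_Ici, Set.mem_Ioi] at hx
    rw [(hder x).deriv, sub_pos, div_lt_one (by positivity)]
    nlinarith
  have hiff : ∀ x ∈ Set.Ioo (Real.pi * k) (Real.pi * k + Real.pi / 2), Real.tan x = x →
      x - Real.arctan x - Real.pi * k = 0 := by
    intro x hx h
    have := Real.arctan_tan (x := x - Real.pi * k) (by linarith [hx.1]) (by linarith [hx.2])
    rw [htan, h] at this
    linarith
  obtain ⟨x, hx, hx0⟩ := intermediate_value_Ioo (a := Real.pi * k) (b := Real.pi * k + Real.pi / 2)
    (by linarith) hcont.continuousOn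
    (show (0 : ℝ) ∈ Set.Ioo _ _ from
      ⟨by have := Real.arctan_pos.2 hpos; linarith,
        by have := Real.arctan_lt_pi_div_two (Real.pi * k + Real.pi / 2); linarith⟩)
  simp only at hx0
  refine ⟨x, ⟨hx, ?_⟩, ?_⟩
  · rw [← htan, show x - Real.pi * k = Real.arctan x by linarith, Real.tan_arctan]
  · rintro y ⟨hy, hyt⟩
    exact hmono.injOn (Set.mem_Ici.2 (by linarith [hy.1])) (Set.mem_Ici.2 (by linarith [hx.1]))
      ((hiff y hy hyt).trans hx0.symm)

theorem chi_spec {k : ℕ} (hk : 1 ≤ k) :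
    chi k ∈ Set.Ioo (Real.pi * k) (Real.pi * k + Real.pi / 2) ∧ Real.tan (chi k) = chi k := by
  obtain ⟨x, hx, hu⟩ := existsUnique_chi hk
  have : {x : ℝ | x ∈ Set.Ioo (Real.pi * k) (Real.pi * k + Real.pi / 2) ∧ Real.tan x = x} = {x} :=
    Set.eq_singleton_iff_unique_mem.2 ⟨hx, hu⟩
  rw [chi, this, csInf_singleton]
  exact hx

/-- The derivative of the upper left entry `z₁` of the covering map along `v`. -/
def dz₁ (g v : CSU) : ℂ :=
  (((star g.2 * v.2).re / √(1 + ‖g.2‖ ^ 2) : ℝ) + Complex.I * (√(1 + ‖g.2‖ ^ 2) * v.1 : ℝ)) *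
    Complex.exp (Complex.I * g.1)

theorem hasDerivAt_cover (g v : CSU) (i j : Fin 2) :
    HasDerivAt (fun t : ℝ => cover (g + t • v) i j)
      (!![dz₁ g v, v.2; star v.2, star (dz₁ g v)] i j) 0 := by
  have hw : HasDerivAt (fun t : ℝ => g.2 + (t : ℂ) * v.2) v.2 0 := by
    simpa using ((Complex.ofRealCLM.hasDerivAt (x := (0 : ℝ))).mul_const v.2).const_add g.2
  have hwc : HasDerivAt (fun t : ℝ => star (g.2 + (t : ℂ) * v.2)) (star v.2) 0 := hw.star
  have hpos : 0 < 1 + ‖g.2‖ ^ 2 := by positivity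
  have hn : HasDerivAt (fun t : ℝ => 1 + ‖g.2 + (t : ℂ) * v.2‖ ^ 2)
      (2 * (star g.2 * v.2).re) 0 := by
    have h := (hw.norm_sq).const_add 1
    have e : (2 * inner ℝ (g.2 + ((0 : ℝ) : ℂ) * v.2) v.2 : ℝ) = 2 * (star g.2 * v.2).re := by
      simp [Complex.inner, mul_comm]
    rw [e] at h
    exact h
  have hs : HasDerivAt (fun t : ℝ => √(1 + ‖g.2 + (t : ℂ) * v.2‖ ^ 2))
      ((star g.2 * v.2).re / √(1 + ‖g.2‖ ^ 2)) 0 := by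
    have h := hn.sqrt (by simpa using hpos.ne')
    convert h using 1
    rw [Complex.ofReal_zero, zero_mul, add_zero, mul_div_mul_left _ _ two_ne_zero]
  have hc : HasDerivAt (fun t : ℝ => Complex.I * ((g.1 + t * v.1 : ℝ) : ℂ))
      (Complex.I * v.1) 0 := by
    have h0 : HasDerivAt (fun t : ℝ => g.1 + t * v.1) v.1 0 := by
      simpa using ((hasDerivAt_id (0 : ℝ)).mul_const v.1).const_add g.1
    exact h0.ofReal_comp.const_mul _
  have hz : HasDerivAt (fun t : ℝ => ((√(1 + ‖g.2 + (t : ℂ) * v.2‖ ^ 2) : ℝ) : ℂ) *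
      Complex.exp (Complex.I * ((g.1 + t * v.1 : ℝ) : ℂ))) (dz₁ g v) 0 := by
    refine (hs.ofReal_comp.fun_mul hc.cexp).congr_deriv ?_
    simp [dz₁]
    ring
  have hzc := hz.star
  fin_cases i <;> fin_cases j
  · simpa [cover] using hz
  · simpa [cover] using hw
  · simpa [cover] using hwc
  · have e : (fun t : ℝ => star (((√(1 + ‖g.2 + (t : ℂ) * v.2‖ ^ 2) : ℝ) : ℂ) *
        Complex.exp (Complex.I * ((g.1 + t * v.1 : ℝ) : ℂ)))) =
        fun t : ℝ => ((√(1 + ‖g.2 + (t : ℂ) * v.2‖ ^ 2) : ℝ) : ℂ) *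
        Complex.exp (-(Complex.I * ((g.1 + t * v.1 : ℝ) : ℂ))) := by
      ext1 t
      rw [star_mul', Complex.star_def, Complex.conj_ofReal, ← Complex.exp_conj, map_mul,
        Complex.conj_I, Complex.conj_ofReal, neg_mul]
    rw [e] at hzc
    simpa [cover] using hzc

theorem metric_eq (g v : CSU) : metric g v = ‖v.2‖ ^ 2 - ‖dz₁ g v‖ ^ 2 := by
  have hpos : 0 < 1 + ‖g.2‖ ^ 2 := by positivity
  have h1 : ‖Complex.exp (Complex.I * g.1)‖ = 1 := by
    rw [mul_comm]; exact Complex.norm_exp_ofReal_mul_I _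
  have h2 : ∀ x y : ℝ, ‖(x : ℂ) + Complex.I * (y : ℂ)‖ ^ 2 = x ^ 2 + y ^ 2 := by
    intro x y
    rw [← Complex.normSq_eq_norm_sq, mul_comm, Complex.normSq_add_mul_I]
  rw [dz₁, norm_mul, h1, mul_one, h2, div_pow, mul_pow, Real.sq_sqrt hpos.le, metric]
  ring

theorem exp_mul_exp_neg (c : ℝ) :
    Complex.exp (Complex.I * c) * Complex.exp (-(Complex.I * c)) = 1 := by
  rw [← Complex.exp_add]; simp

theorem star_exp (c : ℝ) :
    star (Complex.exp (Complex.I * c)) = Complex.exp (-(Complex.I * c)) := by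
  rw [Complex.star_def, ← Complex.exp_conj, map_mul, Complex.conj_I, Complex.conj_ofReal, neg_mul]

theorem snd_horizontal (g : CSU) (a b : ℝ) :
    (a • fieldX g + b • fieldY g).2 = (-a + b * Complex.I) *
      ((√(1 + ‖g.2‖ ^ 2) : ℝ) * Complex.exp (Complex.I * g.1)) := by
  simp only [fieldX, fieldY, Prod.snd_add, Prod.smul_snd, Complex.real_smul]
  ring

theorem dz₁_horizontal (g : CSU) (a b : ℝ) :
    dz₁ g (a • fieldX g + b • fieldY g) = (-a - b * Complex.I) * g.2 := by
  have hn : 0 < √(1 + ‖g.2‖ ^ 2) := by positivity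
  have hE := exp_mul_exp_neg g.1
  have hstar := star_exp g.1
  obtain ⟨u, hu⟩ : ∃ u, u = g.2 * Complex.exp (-(Complex.I * g.1)) := ⟨_, rfl⟩
  have hw : g.2 = u * Complex.exp (Complex.I * g.1) := by
    rw [hu, mul_assoc, mul_comm (Complex.exp (-_)), hE, mul_one]
  have h1 : star g.2 * (a • fieldX g + b • fieldY g).2 =
      (√(1 + ‖g.2‖ ^ 2) : ℝ) * ((-a + b * Complex.I) * star u) := by
    have hsu : star u = star g.2 * Complex.exp (Complex.I * g.1) := by
      rw [hu, star_mul', ← hstar, star_star]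
    rw [snd_horizontal, hsu]
    ring
  have h2 : (a • fieldX g + b • fieldY g).1 = (-a * u.im - b * u.re) / √(1 + ‖g.2‖ ^ 2) := by
    simp only [fieldX, fieldY, Prod.fst_add, Prod.smul_fst, smul_eq_mul, ← hu]
    ring
  have h3 : (star g.2 * (a • fieldX g + b • fieldY g).2).re / √(1 + ‖g.2‖ ^ 2) =
      -a * u.re + b * u.im := by
    rw [h1, Complex.re_ofReal_mul, mul_div_cancel_left₀ _ hn.ne']
    simp
  rw [dz₁, h3, h2, mul_div_cancel₀ _ hn.ne']
  conv_rhs => rw [hw, ← mul_assoc]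
  congr 1
  apply Complex.ext <;> simp
  ring

theorem hasDerivAt_cover_horizontal (g : CSU) (a b : ℝ) (i j : Fin 2) :
    HasDerivAt (fun t : ℝ => cover (g + t • (a • fieldX g + b • fieldY g)) i j)
      ((cover g * (a • lieX + b • lieY)) i j) 0 := by
  convert hasDerivAt_cover g (a • fieldX g + b • fieldY g) i j using 1
  rw [dz₁_horizontal, snd_horizontal]
  have hstar := star_exp g.1
  rw [Complex.star_def] at hstar
  fin_cases i <;> fin_cases j <;>
    simp [cover, lieX, lieY, Matrix.mul_apply, Fin.sum_univ_two, hstar] <;> ring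

theorem hasDerivAt_cover_fieldX (g : CSU) (i j : Fin 2) :
    HasDerivAt (fun t : ℝ => cover (g + t • fieldX g) i j) ((cover g * lieX) i j) 0 := by
  simpa using hasDerivAt_cover_horizontal g 1 0 i j

theorem hasDerivAt_cover_fieldY (g : CSU) (i j : Fin 2) :
    HasDerivAt (fun t : ℝ => cover (g + t • fieldY g) i j) ((cover g * lieY) i j) 0 := by
  simpa using hasDerivAt_cover_horizontal g 0 1 i j

theorem metric_horizontal (g : CSU) (a b : ℝ) :
    metric g (a • fieldX g + b • fieldY g) = a ^ 2 + b ^ 2 := by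
  have hpos : 0 < 1 + ‖g.2‖ ^ 2 := by positivity
  have h1 : ‖Complex.exp (Complex.I * g.1)‖ = 1 := by
    rw [mul_comm]; exact Complex.norm_exp_ofReal_mul_I _
  have h2 : ∀ x y : ℝ, ‖(x : ℂ) + y * Complex.I‖ ^ 2 = x ^ 2 + y ^ 2 := by
    intro x y
    rw [← Complex.normSq_eq_norm_sq, Complex.normSq_add_mul_I]
  have h3 := h2 (-a) b
  have h4 := h2 (-a) (-b)
  push_cast at h3 h4
  rw [neg_mul, ← sub_eq_add_neg] at h4
  rw [metric_eq, dz₁_horizontal, snd_horizontal, norm_mul, norm_mul, norm_mul, h1, mul_one,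
    Complex.norm_real, Real.norm_eq_abs, mul_pow, mul_pow, sq_abs, Real.sq_sqrt hpos.le, h3, h4]
  ring

end CSU

end

/-! A tangent vector is horizontal exactly when `(1 + ‖w‖²) c' = -Im (conj w * w')`, so a horizontal
curve is determined by its starting point and its projection to the `w`-plane. The geodesics from
the identity are the explicit curves `arc b m`. They have control `b * exp (2 i m t)` and projection
`b * exp (i m t) * S σ t`, where `S σ` is the generalized sine and `σ = ‖b‖² - m²`.

The proof uses calibrations instead of a maximum principle. Away from `w = 0`, the function `calib
l`, given by `l * c + radial l ‖w‖`, has a horizontal gradient of length one wherever `l² ‖w‖² ≤ 1 +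
‖w‖²`. A curve of length at most `1 / |l|` from the identity cannot leave this domain. A short `arc
b m` increases `calib (-m / ‖b‖)` by exactly its own length, hence is shortest
(`isLengthMinimizing_arc`). The equality case of the Cauchy–Schwarz inequality is a differential
equation, which makes the arc the only shortest curve of constant speed
(`eq_arc_of_isLengthMinimizing`). An arbitrary geodesic is compared with arcs as soon as two of its
points can be joined by a short arc. The open set `region` of relative positions guarantees this.
Near a time of differentiability the relative position lies in `region`, and a continuation argument
spreads the arc over the whole interval (`exists_arc_of_isGeodesic`, `mem_geodesics_iff`).

It remains to count the pairs `(b, m)` with `arc b m 1 = (c, w)`. A reflection reduces `c ≠ 0` to `c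
< 0`, which forces `m > 0`. If `w ≠ 0`, then `σ` determines `m` and `b`, so it suffices to count the
values of `σ`. For `σ > -π²` the height `|c|` over `w` decreases strictly from infinity to `0`,
which gives one arc (`existsUnique_height`). For `σ = -(x + π n)²` with `0 < x < π` and `n ≥ 1`, the
height is infinite at both ends and its derivative has the sign of `sin x - (x + π n) cos x`. It has
a single minimum, at `x + π n = χ_n`, with value `threshold n w`. Each `n` thus contributes zero,
one or two arcs (`encard_sigmas_inter_Ioc`). The thresholds increase strictly to infinity in `n`, so
the total is `2k + 1`, or `2k` on a threshold. If `w = 0` and `c ≠ 0`, then `√(-σ) = π n` with `n ≥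
1`. The number `n` fixes `m` and `‖b‖` and leaves the phase of `b` free (`arc_eq_axis_iff'`).
Rotations identify the arcs with the same `n`, and isometries preserve the speed `‖b‖`, so the
classes correspond to `n`. If `c = 0`, then `m = 0` or the arc is constant. -/

open Set Filter Topology MeasureTheory

noncomputable section

namespace CSU

/-! ### Horizontal vectors -/

/-- The upper left entry of the covering map. -/
def Z (g : CSU) : ℂ := (√(1 + ‖g.2‖ ^ 2) : ℝ) * Complex.exp (Complex.I * g.1)

theorem one_add_sq_pos (w : ℂ) : 0 < 1 + ‖w‖ ^ 2 := by positivity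

theorem norm_Z (g : CSU) : ‖Z g‖ = √(1 + ‖g.2‖ ^ 2) := by
  rw [Z, norm_mul, mul_comm Complex.I, Complex.norm_exp_ofReal_mul_I, mul_one, Complex.norm_real,
    Real.norm_of_nonneg (Real.sqrt_nonneg _)]

theorem norm_Z_sq (g : CSU) : ‖Z g‖ ^ 2 = 1 + ‖g.2‖ ^ 2 := by
  rw [norm_Z, Real.sq_sqrt (one_add_sq_pos _).le]

theorem norm_Z_pos (g : CSU) : 0 < ‖Z g‖ := by
  rw [norm_Z]; exact Real.sqrt_pos.2 (one_add_sq_pos _)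

theorem Z_ne_zero (g : CSU) : Z g ≠ 0 := norm_pos_iff.1 (norm_Z_pos g)

theorem norm_snd_lt_norm_Z (g : CSU) : ‖g.2‖ < ‖Z g‖ := by
  rw [norm_Z]; exact Real.lt_sqrt_of_sq_lt (by linarith)

theorem Z_one : Z one = 1 := by simp [Z, one]

theorem dz₁_injective_fst {g v v' : CSU} (h2 : v.2 = v'.2) (h : dz₁ g v = dz₁ g v') : v = v' := by
  have hn : (√(1 + ‖g.2‖ ^ 2)) ≠ 0 := (Real.sqrt_pos.2 (one_add_sq_pos _)).ne'
  unfold dz₁ at h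
  rw [h2] at h
  have h3 := mul_right_cancel₀ (Complex.exp_ne_zero _) h
  have h4 := congrArg Complex.im h3
  simp at h4
  refine Prod.ext ?_ h2
  rcases h4 with h4 | h4
  · exact h4
  · exact absurd h4 (by simpa using hn)

/-- A vector is horizontal when it is `h ↦ h * β` for some off-diagonal `β`. -/
theorem mem_distribution_iff_exists {g v : CSU} :
    v ∈ distribution g ↔ ∃ β : ℂ, v.2 = β * Z g ∧ dz₁ g v = star β * g.2 := by
  constructor
  · intro h
    obtain ⟨a, b, rfl⟩ := Submodule.mem_span_pair.1 h
    refine ⟨-a + b * Complex.I, snd_horizontal g a b, ?_⟩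
    rw [dz₁_horizontal]
    simp [sub_eq_add_neg]
  · rintro ⟨β, h1, h2⟩
    refine Submodule.mem_span_pair.2 ⟨-β.re, β.im, ?_⟩
    have hβ : (-((-β.re : ℝ) : ℂ) + (β.im : ℂ) * Complex.I) = β := by
      simp
    have hβ' : (-((-β.re : ℝ) : ℂ) - (β.im : ℂ) * Complex.I) = star β := by
      apply Complex.ext <;> simp
    apply dz₁_injective_fst (g := g)
    · rw [snd_horizontal, h1, hβ]; rfl
    · rw [dz₁_horizontal, h2, hβ']

theorem metric_of_eq {g v : CSU} {β : ℂ} (h1 : v.2 = β * Z g) (h2 : dz₁ g v = star β * g.2) :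
    metric g v = ‖β‖ ^ 2 := by
  rw [metric_eq, h1, h2, norm_mul, norm_mul, norm_star, mul_pow, mul_pow, norm_Z_sq]
  ring

/-- Since `Z = √(1 + ‖w‖²) * exp (i c)`, its logarithmic derivative is that of the modulus plus `i`
times that of `c`. -/
theorem dz₁_div_Z (g v : CSU) :
    dz₁ g v = ((star g.2 * v.2).re / (1 + ‖g.2‖ ^ 2) + Complex.I * v.1) * Z g := by
  have hn : ((√(1 + ‖g.2‖ ^ 2) : ℝ) : ℂ) ≠ 0 := by
    exact_mod_cast (Real.sqrt_pos.2 (one_add_sq_pos _)).ne'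
  have h : ((1 + ‖g.2‖ ^ 2 : ℝ) : ℂ) = ((√(1 + ‖g.2‖ ^ 2) : ℝ) : ℂ) * (√(1 + ‖g.2‖ ^ 2) : ℝ) := by
    rw [← Complex.ofReal_mul, Real.mul_self_sqrt (one_add_sq_pos _).le]
  push_cast at h
  rw [dz₁, Z, h]
  push_cast
  field_simp

/-- The only possible control is `v.2 / Z g`. Dividing the remaining equation by `Z g`, the real
parts agree automatically. The imaginary part is a single real equation, the kernel of a contact
form. -/
theorem mem_distribution_iff {g v : CSU} :
    v ∈ distribution g ↔ (1 + ‖g.2‖ ^ 2) * v.1 = -(star g.2 * v.2).im := by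
  have hpos := one_add_sq_pos g.2
  have hposC : (1 + (‖g.2‖ : ℂ) ^ 2) ≠ 0 := by exact_mod_cast hpos.ne'
  have hz : Z g * star (Z g) = 1 + (‖g.2‖ : ℂ) ^ 2 := by
    rw [Complex.star_def, Complex.mul_conj, Complex.normSq_eq_norm_sq, norm_Z_sq]; push_cast; ring
  have hZ := Z_ne_zero g
  have hZs : star (Z g) ≠ 0 := by simpa using hZ
  have key : dz₁ g v = star (v.2 / Z g) * g.2 ↔
      (1 + ‖g.2‖ ^ 2) * v.1 = -(star g.2 * v.2).im := by
    have e : star (v.2 / Z g) * g.2 = star (star g.2 * v.2) / (1 + (‖g.2‖ : ℂ) ^ 2) * Z g := by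
      rw [← hz, star_div₀, star_mul', star_star]; field_simp
    rw [dz₁_div_Z, e, mul_left_inj' hZ, eq_div_iff hposC]
    rw [Complex.ext_iff]
    have h3 : ((star g.2 * v.2).re / (1 + (‖g.2‖ : ℂ) ^ 2) + Complex.I * v.1) *
        (1 + (‖g.2‖ : ℂ) ^ 2) = (star g.2 * v.2).re +
          Complex.I * (((1 + ‖g.2‖ ^ 2) * v.1 : ℝ) : ℂ) := by
      push_cast; field_simp
    rw [h3]
    simp only [Complex.star_def, Complex.conj_re, Complex.conj_im, Complex.add_re, Complex.add_im,
      Complex.ofReal_re, Complex.ofReal_im, Complex.I_mul_re, Complex.I_mul_im, neg_zero, add_zero,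
      zero_add, true_and]
  rw [mem_distribution_iff_exists, ← key]
  constructor
  · rintro ⟨β, h1, h2⟩
    rw [h1, mul_div_cancel_right₀ _ hZ, h2]
  · intro h
    exact ⟨v.2 / Z g, by rw [div_mul_cancel₀ _ hZ], h⟩

theorem metric_of_mem {g v : CSU} (h : v ∈ distribution g) :
    metric g v = ‖v.2‖ ^ 2 / (1 + ‖g.2‖ ^ 2) := by
  obtain ⟨β, h1, h2⟩ := mem_distribution_iff_exists.1 h
  rw [metric_of_eq h1 h2, h1, norm_mul, mul_pow, norm_Z_sq,
    mul_div_cancel_right₀ _ (one_add_sq_pos _).ne']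

theorem hasDerivAt_Z {γ : ℝ → CSU} {v : CSU} {t : ℝ} (h : HasDerivAt γ v t) :
    HasDerivAt (fun s => Z (γ s)) (dz₁ (γ t) v) t := by
  have hw : HasDerivAt (fun s => (γ s).2) v.2 t := h.snd
  have hc : HasDerivAt (fun s => (γ s).1) v.1 t := h.fst
  have hn := (hw.norm_sq).const_add 1
  have hs := hn.sqrt (one_add_sq_pos _).ne'
  have hE := (hc.ofReal_comp.const_mul Complex.I).cexp
  refine (hs.ofReal_comp.fun_mul hE).congr_deriv ?_
  have e : (inner ℝ (γ t).2 v.2 : ℝ) = (star (γ t).2 * v.2).re := by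
    simp [Complex.inner, mul_comm]
  rw [e, dz₁, mul_div_mul_left _ _ two_ne_zero]
  push_cast
  ring

/-! ### The group structure -/

/-- The group multiplication. -/
def mul (g h : CSU) : CSU :=
  (g.1 + h.1 + Complex.arg (1 + g.2 * star h.2 / (Z g * Z h)), Z g * h.2 + g.2 * star (Z h))

/-- The group inverse. -/
def inv (g : CSU) : CSU := (-g.1, -g.2)

theorem mul_snd (g h : CSU) : (mul g h).2 = Z g * h.2 + g.2 * star (Z h) := rfl

theorem re_pos_of_mul (g h : CSU) : 0 < (1 + g.2 * star h.2 / (Z g * Z h)).re := by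
  have h1 : ‖g.2 * star h.2 / (Z g * Z h)‖ < 1 := by
    rw [norm_div, norm_mul, norm_mul, norm_star, div_lt_one (mul_pos (norm_Z_pos _) (norm_Z_pos _))]
    exact mul_lt_mul'' (norm_snd_lt_norm_Z g) (norm_snd_lt_norm_Z h) (norm_nonneg _) (norm_nonneg _)
  have h2 := Complex.abs_re_le_norm (g.2 * star h.2 / (Z g * Z h))
  have h3 := (abs_lt.1 (h2.trans_lt h1)).1
  rw [Complex.add_re, Complex.one_re]
  linarith

theorem eq_norm_mul_exp_arg (z : ℂ) : z = ‖z‖ * Complex.exp (Complex.I * Complex.arg z) := by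
  rw [mul_comm Complex.I]; exact (Complex.norm_mul_exp_arg_mul_I z).symm

/-- With `mul_snd`, this says that `mul` lifts matrix multiplication. The modulus comes from `|z₁|²
- |z₂|² = 1` for the product. The phase is that of `Z g * Z h` corrected by the argument of the
factor `q`. -/
theorem Z_mul (g h : CSU) : Z (mul g h) = Z g * Z h + g.2 * star h.2 := by
  have hg := Z_ne_zero g
  have hh := Z_ne_zero h
  set q := 1 + g.2 * star h.2 / (Z g * Z h) with hq
  have e1 : Z g * Z h + g.2 * star h.2 = Z g * Z h * q := by rw [hq]; field_simp
  have e2 : ‖Z g * Z h + g.2 * star h.2‖ ^ 2 = 1 + ‖(mul g h).2‖ ^ 2 := by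
    have a1 := norm_Z_sq g
    have a2 := norm_Z_sq h
    rw [mul_snd]
    simp only [← Complex.normSq_eq_norm_sq, Complex.star_def] at *
    rw [Complex.normSq_add, Complex.normSq_add]
    simp only [map_mul, Complex.normSq_conj, Complex.conj_conj]
    rw [show Z g * Z h * ((starRingEnd ℂ) g.2 * h.2) = Z g * h.2 * ((starRingEnd ℂ) g.2 * Z h) by
      ring, a1, a2]
    ring
  have e3 : √(1 + ‖(mul g h).2‖ ^ 2) = ‖Z g‖ * ‖Z h‖ * ‖q‖ := by
    rw [← e2, Real.sqrt_sq (norm_nonneg _), e1, norm_mul, norm_mul]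
  rw [e1, Z, e3, norm_Z, norm_Z]
  have e4 : ((mul g h).1 : ℂ) = g.1 + h.1 + Complex.arg q := by simp [mul, hq]
  conv_rhs => rw [eq_norm_mul_exp_arg q]
  rw [e4, mul_add, mul_add, Complex.exp_add, Complex.exp_add, Z, Z]
  push_cast
  ring

theorem Z_inv (g : CSU) : Z (inv g) = star (Z g) := by
  rw [Z, Z, star_mul', star_exp]
  simp [inv]

/-- The fibres of the covering map are the translates of `c` by multiples of `2π`. -/
theorem ext_of_Z {g h : CSU} (h1 : Z g = Z h) (h2 : g.2 = h.2)
    (h3 : |g.1 - h.1| < 2 * Real.pi) : g = h := by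
  refine Prod.ext ?_ h2
  have hn : ((√(1 + ‖h.2‖ ^ 2) : ℝ) : ℂ) ≠ 0 := by
    exact_mod_cast (Real.sqrt_pos.2 (one_add_sq_pos _)).ne'
  rw [Z, Z, h2] at h1
  have h4 := mul_left_cancel₀ hn h1
  obtain ⟨n, hn⟩ := Complex.exp_eq_exp_iff_exists_int.1 h4
  have h5 : g.1 - h.1 = n * (2 * Real.pi) := by
    have : Complex.I * (g.1 : ℂ) = Complex.I * (h.1 + n * (2 * Real.pi)) := by rw [hn]; ring
    have := mul_left_cancel₀ Complex.I_ne_zero this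
    have h6 : g.1 = h.1 + n * (2 * Real.pi) := by exact_mod_cast this
    linarith
  have hpi := Real.pi_pos
  rw [h5, abs_mul, abs_of_pos (by positivity : 0 < 2 * Real.pi)] at h3
  have h6 : |(n : ℝ)| < 1 := by nlinarith
  have h7 : n = 0 := by
    rw [← Int.cast_abs] at h6
    have : |n| < 1 := by exact_mod_cast h6
    exact Int.abs_lt_one_iff.1 this
  rw [h7] at h5
  simp at h5
  linarith

theorem abs_arg_mul_lt (g h : CSU) :
    |Complex.arg (1 + g.2 * star h.2 / (Z g * Z h))| < Real.pi / 2 :=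
  Complex.abs_arg_lt_pi_div_two_iff.2 (Or.inl (re_pos_of_mul g h))

/-- Below, matrix multiplication is associative. Above, the two values of `c` differ by four
arguments, each of absolute value less than `π / 2`, hence by less than one period. -/
theorem mul_assoc' (g h k : CSU) : mul (mul g h) k = mul g (mul h k) := by
  apply ext_of_Z
  · rw [Z_mul, Z_mul, Z_mul, Z_mul, mul_snd, mul_snd]
    simp only [star_add, star_mul', star_star]
    ring
  · rw [mul_snd, mul_snd, Z_mul, mul_snd, mul_snd, Z_mul]
    simp only [star_add, star_mul', star_star]
    ring
  · have a1 := abs_lt.1 (abs_arg_mul_lt (mul g h) k)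
    have a2 := abs_lt.1 (abs_arg_mul_lt g h)
    have a3 := abs_lt.1 (abs_arg_mul_lt g (mul h k))
    have a4 := abs_lt.1 (abs_arg_mul_lt h k)
    have e : (mul (mul g h) k).1 - (mul g (mul h k)).1 =
        Complex.arg (1 + (mul g h).2 * star k.2 / (Z (mul g h) * Z k)) +
        Complex.arg (1 + g.2 * star h.2 / (Z g * Z h)) -
        Complex.arg (1 + g.2 * star (mul h k).2 / (Z g * Z (mul h k))) -
        Complex.arg (1 + h.2 * star k.2 / (Z h * Z k)) := by
      simp only [mul]; ring
    rw [e, abs_lt]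
    constructor <;> linarith [a1.1, a1.2, a2.1, a2.2, a3.1, a3.2, a4.1, a4.2]

theorem one_mul' (g : CSU) : mul one g = g := by
  simp [mul, Z_one]
  simp [one]

theorem inv_mul_self (g : CSU) : mul (inv g) g = one := by
  have hpos := one_add_sq_pos g.2
  apply ext_of_Z
  · rw [Z_mul, Z_inv, Z_one, mul_comm, Complex.star_def, Complex.mul_conj,
      Complex.normSq_eq_norm_sq, norm_Z_sq]
    simp only [inv, neg_mul, Complex.mul_conj, Complex.normSq_eq_norm_sq]
    push_cast
    ring
  · rw [mul_snd, Z_inv]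
    simp [inv, one]
    ring
  · have h := abs_arg_mul_lt (inv g) g
    have e : (mul (inv g) g).1 - one.1 =
      Complex.arg (1 + (inv g).2 * star g.2 / (Z (inv g) * Z g)) := by
      simp [mul, inv, one]
    rw [e]
    linarith [Real.pi_pos]

theorem inv_inv' (g : CSU) : inv (inv g) = g := by simp [inv]

theorem inv_mul_cancel_left' (g h : CSU) : mul (inv g) (mul g h) = h := by
  rw [← mul_assoc', inv_mul_self, one_mul']

theorem mul_inv_cancel_left' (g h : CSU) : mul g (mul (inv g) h) = h := by
  simpa [inv_inv'] using inv_mul_cancel_left' (inv g) h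

theorem mul_one' (g : CSU) : mul g one = g := by
  have := mul_inv_cancel_left' g one
  simp [mul, Z_one]
  simp [one, Z]

theorem contDiff_Z : ContDiff ℝ 1 Z := by
  have h : ContDiff ℝ 1 (fun g : CSU => √(1 + ‖g.2‖ ^ 2)) :=
    (contDiff_const.add (contDiff_snd.norm_sq ℝ)).sqrt fun g => (one_add_sq_pos g.2).ne'
  have h2 : ContDiff ℝ 1 (fun g : CSU => (g.1 : ℂ)) := Complex.ofRealCLM.contDiff.comp contDiff_fst
  exact (Complex.ofRealCLM.contDiff.comp h).mul (contDiff_const.mul h2).cexp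

theorem contDiff_mul_left (g : CSU) : ContDiff ℝ 1 (mul g) := by
  have hst : ContDiff ℝ 1 (fun z : ℂ => star z) := Complex.conjCLE.contDiff
  have h1 : ContDiff ℝ 1 (fun h : CSU => 1 + g.2 * star h.2 / (Z g * Z h)) := by
    simp only [div_eq_mul_inv]
    exact contDiff_const.add ((contDiff_const.mul (hst.comp contDiff_snd)).mul
      ((contDiff_const.mul contDiff_Z).inv fun h => mul_ne_zero (Z_ne_zero g) (Z_ne_zero h)))
  have h2 : ContDiff ℝ 1 (fun h : CSU => Complex.arg (1 + g.2 * star h.2 / (Z g * Z h))) := by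
    have h3 : ContDiff ℝ 1 (fun h : CSU => Complex.log (1 + g.2 * star h.2 / (Z g * Z h))) := by
      rw [contDiff_iff_contDiffAt]
      intro h
      exact ((Complex.contDiffAt_log (n := 1) (Or.inl (re_pos_of_mul g h))).restrict_scalars ℝ).comp
        h h1.contDiffAt
    have e : (fun h : CSU => Complex.arg (1 + g.2 * star h.2 / (Z g * Z h))) =
        fun h => Complex.imCLM (Complex.log (1 + g.2 * star h.2 / (Z g * Z h))) := by
      funext h; simp [Complex.log_im]
    rw [e]
    exact Complex.imCLM.contDiff.comp h3
  have h4 : ContDiff ℝ 1 (fun h : CSU => Z g * h.2 + g.2 * star (Z h)) :=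
    (contDiff_const.mul contDiff_snd).add (contDiff_const.mul (hst.comp contDiff_Z))
  exact ((contDiff_const.add contDiff_fst).add h2).prodMk h4

/-- Left translations preserve horizontal vectors and their lengths. -/
theorem hasDerivAt_mul_left (g : CSU) {γ : ℝ → CSU} {v : CSU} {t : ℝ} (h : HasDerivAt γ v t)
    (hv : v ∈ distribution (γ t)) :
    ∃ v' ∈ distribution (mul g (γ t)), HasDerivAt (fun s => mul g (γ s)) v' t ∧
      metric (mul g (γ t)) v' = metric (γ t) v := by
  obtain ⟨β, h1, h2⟩ := mem_distribution_iff_exists.1 hv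
  obtain ⟨v', hd⟩ : ∃ v', HasDerivAt (fun s => mul g (γ s)) v' t :=
    ⟨_, ((contDiff_mul_left g).differentiable (by simp) (γ t)).hasFDerivAt.comp_hasDerivAt t h⟩
  have hZ := hasDerivAt_Z h
  have hw : HasDerivAt (fun s => (γ s).2) v.2 t := h.snd
  have hd2 : HasDerivAt (fun s => (mul g (γ s)).2) v'.2 t := hd.snd
  -- The control `β` acts from the right, so translation from the left does not change it.
  have e1 : v'.2 = β * Z (mul g (γ t)) := by
    refine hd2.unique (((hw.const_mul (Z g)).add (hZ.star.const_mul g.2)).congr_deriv ?_)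
    rw [Z_mul, h1, h2, star_mul', star_star]; ring
  have e2 : dz₁ (mul g (γ t)) v' = star β * (mul g (γ t)).2 := by
    have h3 : (fun s => Z (mul g (γ s))) = fun s => Z g * Z (γ s) + g.2 * star (γ s).2 := by
      funext s; exact Z_mul g (γ s)
    have h4 := hasDerivAt_Z hd
    rw [h3] at h4
    refine h4.unique (((hZ.const_mul (Z g)).add (hw.star.const_mul g.2)).congr_deriv ?_)
    rw [mul_snd, h1, h2, star_mul']; ring
  exact ⟨v', mem_distribution_iff_exists.2 ⟨β, e1, e2⟩, hd,
    (metric_of_eq e1 e2).trans (metric_of_eq h1 h2).symm⟩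

end CSU

/-! ### Absolutely continuous curves -/

theorem AbsolutelyContinuousOnInterval.congr' {X : Type*} [PseudoMetricSpace X] {f g : ℝ → X}
    {a b : ℝ} (hf : AbsolutelyContinuousOnInterval f a b) (h : ∀ t ∈ uIcc a b, f t = g t) :
    AbsolutelyContinuousOnInterval g a b := by
  rw [absolutelyContinuousOnInterval_iff] at hf ⊢
  intro ε hε
  obtain ⟨δ, hδ, H⟩ := hf ε hε
  refine ⟨δ, hδ, fun E hE hEδ => ?_⟩
  convert H E hE hEδ using 1
  refine Finset.sum_congr rfl fun i hi => ?_
  rw [h _ (hE.1 i hi).1, h _ (hE.1 i hi).2]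

theorem LipschitzOnWith.comp_absolutelyContinuousOnInterval {X Y : Type*} [PseudoMetricSpace X]
    [PseudoMetricSpace Y] {f : ℝ → X} {Φ : X → Y} {s : Set X} {K : NNReal} {a b : ℝ}
    (hΦ : LipschitzOnWith K Φ s) (hf : AbsolutelyContinuousOnInterval f a b)
    (hs : ∀ t ∈ uIcc a b, f t ∈ s) : AbsolutelyContinuousOnInterval (fun t => Φ (f t)) a b := by
  rw [absolutelyContinuousOnInterval_iff] at hf ⊢
  intro ε hε
  obtain ⟨δ, hδ, H⟩ := hf (ε / (K + 1)) (by positivity)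
  refine ⟨δ, hδ, fun E hE hEδ => ?_⟩
  have h1 := H E hE hEδ
  rw [lt_div_iff₀ (by positivity)] at h1
  refine lt_of_le_of_lt ?_ h1
  rw [Finset.sum_mul]
  refine Finset.sum_le_sum fun i hi => ?_
  refine (hΦ.dist_le_mul _ (hs _ (hE.1 i hi).1) _ (hs _ (hE.1 i hi).2)).trans ?_
  rw [mul_comm]
  gcongr
  simp

/-- The curve stays in a compact ball, on which a `C¹` map is Lipschitz. -/
theorem ContDiff.comp_absolutelyContinuousOnInterval {E F : Type*} [NormedAddCommGroup E]
    [NormedSpace ℝ E] [ProperSpace E] [NormedAddCommGroup F] [NormedSpace ℝ F] {f : ℝ → E}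
    {Φ : E → F} {a b : ℝ} (hΦ : ContDiff ℝ 1 Φ) (hf : AbsolutelyContinuousOnInterval f a b) :
    AbsolutelyContinuousOnInterval (fun t => Φ (f t)) a b := by
  obtain ⟨C, hC⟩ := hf.exists_bound
  obtain ⟨K, hK⟩ := hΦ.contDiffOn.exists_lipschitzOnWith (by decide)
    (convex_closedBall (0 : E) C) (isCompact_closedBall 0 C)
  exact hK.comp_absolutelyContinuousOnInterval hf fun t ht => by simpa using hC t ht

/-- An absolutely continuous function whose derivative is almost everywhere given by a continuous
function is the integral of that function. -/
theorem AbsolutelyContinuousOnInterval.hasDerivAt_of_ae {F : Type*} [NormedAddCommGroup F]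
    [NormedSpace ℝ F] [CompleteSpace F] {f g : ℝ → F} {a b : ℝ}
    (hf : AbsolutelyContinuousOnInterval f a b) (hg : ContinuousOn g (Icc a b))
    (h : ∀ᵐ t, t ∈ Icc a b → HasDerivAt f (g t) t) {t : ℝ} (ht : t ∈ Ioo a b) :
    HasDerivAt f (g t) t := by
  have hab : a ≤ b := (ht.1.trans ht.2).le
  -- A continuous extension to the line has a `C¹` primitive. The difference of `f` and this
  -- primitive is absolutely continuous with derivative zero almost everywhere, hence constant.
  obtain ⟨G, hG, hGg⟩ : ∃ G : ℝ → F, Continuous G ∧ ∀ s ∈ Icc a b, G s = g s :=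
    ⟨IccExtend hab ((Icc a b).domRestrict g), (continuousOn_iff_continuous_domRestrict.1 hg).Icc_extend',
      fun s hs => IccExtend_of_mem hab _ hs⟩
  set P : ℝ → F := fun s => ∫ x in a..s, G x with hP
  have hPd : ∀ s, HasDerivAt P (G s) s := fun s => hG.integral_hasStrictDerivAt a s |>.hasDerivAt
  have hPc : ContDiff ℝ 1 P := by
    rw [contDiff_one_iff_deriv]
    refine ⟨fun s => (hPd s).differentiableAt, ?_⟩
    rw [show deriv P = G from funext fun s => (hPd s).deriv]
    exact hG
  have hPA : AbsolutelyContinuousOnInterval P a b :=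
    hPc.contDiffOn.absolutelyContinuousOnInterval
  obtain ⟨C, hC⟩ := (hf.sub hPA).const_of_ae_hasDerivAt_zero (by
    filter_upwards [h] with s hs hsI
    rw [uIcc_of_le hab] at hsI
    have := (hs hsI).sub (hPd s)
    rwa [hGg s hsI, sub_self] at this)
  rw [uIcc_of_le hab] at hC
  have he : f =ᶠ[𝓝 t] fun s => C + P s := by
    filter_upwards [Icc_mem_nhds ht.1 ht.2] with s hs
    rw [← hC s hs]; simp
  rw [← hGg t ⟨ht.1.le, ht.2.le⟩]
  exact ((hPd t).const_add C).congr_of_eventuallyEq he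

theorem ae_mem_Ioo_of_mem_Icc (a b : ℝ) : ∀ᵐ t : ℝ, t ∈ Icc a b → t ∈ Ioo a b := by
  have h1 : ∀ᵐ t : ℝ, t ≠ a := by simp [ae_iff]
  have h2 : ∀ᵐ t : ℝ, t ≠ b := by simp [ae_iff]
  filter_upwards [h1, h2] with t ha hb ht
  exact ⟨lt_of_le_of_ne ht.1 (Ne.symm ha), lt_of_le_of_ne ht.2 hb⟩

namespace CSU

/-! ### Horizontal curves -/

theorem speed_of_hasDerivAt {γ : ℝ → CSU} {v : CSU} {t : ℝ} (h : HasDerivAt γ v t) :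
    speed γ t = √(metric (γ t) v) := by rw [speed, h.deriv]

theorem speed_nonneg (γ : ℝ → CSU) (t : ℝ) : 0 ≤ speed γ t := Real.sqrt_nonneg _

theorem speed_of_mem {γ : ℝ → CSU} {v : CSU} {t : ℝ} (h : HasDerivAt γ v t)
    (hv : v ∈ distribution (γ t)) : speed γ t = ‖v.2‖ / √(1 + ‖(γ t).2‖ ^ 2) := by
  rw [speed_of_hasDerivAt h, metric_of_mem hv, Real.sqrt_div (sq_nonneg _),
    Real.sqrt_sq (norm_nonneg _)]

theorem speed_congr {γ η : ℝ → CSU} {t : ℝ} (h : γ =ᶠ[𝓝 t] η) : speed γ t = speed η t := by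
  rw [speed, speed, h.deriv_eq, h.eq_of_nhds]

theorem ae_eventuallyEq {γ η : ℝ → CSU} {a b : ℝ} (h : ∀ t ∈ Icc a b, γ t = η t) :
    ∀ᵐ t, t ∈ Icc a b → γ =ᶠ[𝓝 t] η := by
  filter_upwards [ae_mem_Ioo_of_mem_Icc a b] with t ht htI
  filter_upwards [Icc_mem_nhds (ht htI).1 (ht htI).2] with s hs using h s hs

theorem IsHorizontal.congr {γ η : ℝ → CSU} {a b : ℝ} (hab : a ≤ b) (hγ : IsHorizontal γ a b)
    (h : ∀ t ∈ Icc a b, γ t = η t) : IsHorizontal η a b := by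
  refine ⟨hγ.1.congr' (by rwa [uIcc_of_le hab]), ?_⟩
  filter_upwards [hγ.2, ae_eventuallyEq h] with t h1 h2 ht
  obtain ⟨v, hv, hd⟩ := h1 ht
  exact ⟨v, h t ht ▸ hv, hd.congr_of_eventuallyEq (h2 ht).symm⟩

theorem IsHorizontal.mono {γ : ℝ → CSU} {a b c d : ℝ} (hγ : IsHorizontal γ a b) (hac : a ≤ c)
    (hcd : c ≤ d) (hdb : d ≤ b) : IsHorizontal γ c d := by
  refine ⟨hγ.1.mono ?_, ?_⟩
  · rw [uIcc_of_le hcd, uIcc_of_le (hac.trans (hcd.trans hdb))]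
    exact Icc_subset_Icc hac hdb
  · filter_upwards [hγ.2] with t ht h
    exact ht ⟨hac.trans h.1, h.2.trans hdb⟩

theorem length_congr_ae {γ η : ℝ → CSU} {a b : ℝ} (hab : a ≤ b)
    (h : ∀ᵐ t, t ∈ Icc a b → speed γ t = speed η t) : length γ a b = length η a b := by
  apply intervalIntegral.integral_congr_ae
  filter_upwards [h] with t ht htI
  rw [uIoc_of_le hab] at htI
  exact ht ⟨htI.1.le, htI.2⟩

theorem length_congr {γ η : ℝ → CSU} {a b : ℝ} (hab : a ≤ b) (h : ∀ t ∈ Icc a b, γ t = η t) :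
    length γ a b = length η a b := by
  apply length_congr_ae hab
  filter_upwards [ae_eventuallyEq h] with t ht htI using speed_congr (ht htI)

theorem length_of_speed_eq {γ : ℝ → CSU} {a b r : ℝ} (hab : a ≤ b)
    (h : ∀ᵐ t, t ∈ Icc a b → speed γ t = r) : length γ a b = r * (b - a) := by
  have : length γ a b = ∫ _ in a..b, r := by
    apply intervalIntegral.integral_congr_ae
    filter_upwards [h] with t ht htI
    rw [uIoc_of_le hab] at htI
    exact ht ⟨htI.1.le, htI.2⟩
  rw [this, intervalIntegral.integral_const, smul_eq_mul, mul_comm]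

theorem IsHorizontal.ac_fst {γ : ℝ → CSU} {a b : ℝ} (hγ : IsHorizontal γ a b) :
    AbsolutelyContinuousOnInterval (fun t => (γ t).1) a b :=
  contDiff_fst.comp_absolutelyContinuousOnInterval hγ.1

theorem IsHorizontal.ac_snd {γ : ℝ → CSU} {a b : ℝ} (hγ : IsHorizontal γ a b) :
    AbsolutelyContinuousOnInterval (fun t => (γ t).2) a b :=
  contDiff_snd.comp_absolutelyContinuousOnInterval hγ.1

/-- The speed is `‖w'‖ / √(1 + ‖w‖²)`, so it is bounded by the sum of the absolute derivatives of
`Re w` and `Im w`. These are integrable by absolute continuity. -/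
theorem IsHorizontal.intervalIntegrable_speed {γ : ℝ → CSU} {a b : ℝ} (hab : a ≤ b)
    (hγ : IsHorizontal γ a b) : IntervalIntegrable (speed γ) volume a b := by
  have hre : AbsolutelyContinuousOnInterval (fun t => (γ t).2.re) a b :=
    Complex.reCLM.contDiff.comp_absolutelyContinuousOnInterval hγ.ac_snd
  have him : AbsolutelyContinuousOnInterval (fun t => (γ t).2.im) a b :=
    Complex.imCLM.contDiff.comp_absolutelyContinuousOnInterval hγ.ac_snd
  have hsum := hre.intervalIntegrable_deriv.abs.add him.intervalIntegrable_deriv.abs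
  have hn : ContinuousOn (fun t => √(1 + ‖(γ t).2‖ ^ 2)) (Icc a b) := by
    have := hγ.ac_snd.continuousOn
    rw [uIcc_of_le hab] at this
    exact (continuousOn_const.add (this.norm.pow 2)).sqrt
  have hn' : AEMeasurable (fun t => √(1 + ‖(γ t).2‖ ^ 2)) (volume.restrict (uIoc a b)) := by
    rw [uIoc_of_le hab]
    exact (hn.mono Ioc_subset_Icc_self).aemeasurable measurableSet_Ioc
  have hform : ∀ᵐ t ∂(volume.restrict (uIoc a b)), √(deriv (fun t => (γ t).2.re) t ^ 2 +
      deriv (fun t => (γ t).2.im) t ^ 2) / √(1 + ‖(γ t).2‖ ^ 2) = speed γ t := by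
    rw [ae_restrict_iff' measurableSet_uIoc]
    filter_upwards [hγ.2] with t ht htI
    rw [uIoc_of_le hab] at htI
    obtain ⟨v, hv, hd⟩ := ht ⟨htI.1.le, htI.2⟩
    have hw : HasDerivAt (fun s => (γ s).2) v.2 t := hd.snd
    have h1 : HasDerivAt (fun s => (γ s).2.re) v.2.re t :=
      (Complex.reCLM.hasFDerivAt.comp_hasDerivAt t hw)
    have h2 : HasDerivAt (fun s => (γ s).2.im) v.2.im t :=
      (Complex.imCLM.hasFDerivAt.comp_hasDerivAt t hw)
    rw [speed_of_mem hd hv, h1.deriv, h2.deriv, ← Complex.norm_eq_sqrt_sq_add_sq]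
  refine hsum.mono_fun ?_ ?_
  · refine AEMeasurable.aestronglyMeasurable (AEMeasurable.congr ?_ hform)
    exact ((((measurable_deriv _).pow_const 2).add
      ((measurable_deriv _).pow_const 2)).sqrt.aemeasurable).div hn'
  · filter_upwards [hform] with t ht
    rw [← ht, Real.norm_eq_abs, Real.norm_eq_abs, abs_of_nonneg (by positivity)]
    refine (div_le_self (Real.sqrt_nonneg _) ?_).trans ?_
    · rw [Real.one_le_sqrt]; nlinarith [sq_nonneg ‖(γ t).2‖]
    · rw [abs_of_nonneg (by positivity)]
      exact Real.sqrt_le_iff.2 ⟨by positivity, by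
        nlinarith [sq_abs (deriv (fun t => (γ t).2.re) t), sq_abs (deriv (fun t => (γ t).2.im) t),
          abs_nonneg (deriv (fun t => (γ t).2.re) t), abs_nonneg (deriv (fun t => (γ t).2.im) t),
          mul_nonneg (abs_nonneg (deriv (fun t => (γ t).2.re) t))
            (abs_nonneg (deriv (fun t => (γ t).2.im) t))]⟩

theorem length_add {γ : ℝ → CSU} {a b c : ℝ} (hab : a ≤ b) (hbc : b ≤ c)
    (hγ : IsHorizontal γ a c) : length γ a c = length γ a b + length γ b c :=
  (intervalIntegral.integral_add_adjacent_intervals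
    ((hγ.mono le_rfl hab hbc).intervalIntegrable_speed hab)
    ((hγ.mono hab hbc le_rfl).intervalIntegrable_speed hbc)).symm

theorem length_nonneg {γ : ℝ → CSU} {a b : ℝ} (hab : a ≤ b) : 0 ≤ length γ a b :=
  intervalIntegral.integral_nonneg hab fun t _ => speed_nonneg γ t

theorem IsHorizontal.mul_left {γ : ℝ → CSU} {a b : ℝ} (g : CSU) (hγ : IsHorizontal γ a b) :
    IsHorizontal (fun t => mul g (γ t)) a b := by
  refine ⟨(contDiff_mul_left g).comp_absolutelyContinuousOnInterval hγ.1, ?_⟩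
  filter_upwards [hγ.2] with t ht htI
  obtain ⟨v, hv, hd⟩ := ht htI
  obtain ⟨v', hv', hd', -⟩ := hasDerivAt_mul_left g hd hv
  exact ⟨v', hv', hd'⟩

theorem IsHorizontal.speed_mul_left {γ : ℝ → CSU} {a b : ℝ} (g : CSU) (hγ : IsHorizontal γ a b) :
    ∀ᵐ t, t ∈ Icc a b → speed (fun t => mul g (γ t)) t = speed γ t := by
  filter_upwards [hγ.2] with t ht htI
  obtain ⟨v, hv, hd⟩ := ht htI
  obtain ⟨v', hv', hd', e⟩ := hasDerivAt_mul_left g hd hv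
  rw [speed_of_hasDerivAt hd', speed_of_hasDerivAt hd, e]

theorem length_mul_left {γ : ℝ → CSU} {a b : ℝ} (hab : a ≤ b) (g : CSU)
    (hγ : IsHorizontal γ a b) : length (fun t => mul g (γ t)) a b = length γ a b :=
  length_congr_ae hab (hγ.speed_mul_left g)

theorem IsLengthMinimizing.mul_left {γ : ℝ → CSU} {a b : ℝ} (hab : a ≤ b) (g : CSU)
    (hγ : IsLengthMinimizing γ a b) : IsLengthMinimizing (fun t => mul g (γ t)) a b := by
  refine ⟨hγ.1.mul_left g, fun η hη ha hb => ?_⟩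
  have h := hγ.2 _ (hη.mul_left (inv g)) (by rw [ha, inv_mul_cancel_left'])
    (by rw [hb, inv_mul_cancel_left'])
  rwa [length_mul_left hab _ hη, ← length_mul_left hab g hγ.1] at h

theorem IsLengthMinimizing.congr {γ η : ℝ → CSU} {a b : ℝ} (hab : a ≤ b)
    (hγ : IsLengthMinimizing γ a b) (h : ∀ t ∈ Icc a b, γ t = η t) : IsLengthMinimizing η a b := by
  refine ⟨hγ.1.congr hab h, fun ζ hζ ha hb => ?_⟩
  rw [← length_congr hab h]
  exact hγ.2 ζ hζ (by rw [ha, h a ⟨le_rfl, hab⟩]) (by rw [hb, h b ⟨hab, le_rfl⟩])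

end CSU

namespace CSU

/-! ### The generalized sine and cosine -/

/-- The solution of `y'' = σ y`, `y 0 = 0`, `y' 0 = 1`. -/
def S (σ t : ℝ) : ℝ :=
  if 0 < σ then Real.sinh (√σ * t) / √σ else if σ = 0 then t else Real.sin (√(-σ) * t) / √(-σ)

/-- The solution of `y'' = σ y`, `y 0 = 1`, `y' 0 = 0`. -/
def C (σ t : ℝ) : ℝ :=
  if 0 < σ then Real.cosh (√σ * t) else if σ = 0 then 1 else Real.cos (√(-σ) * t)

theorem S_of_pos {σ : ℝ} (h : 0 < σ) (t : ℝ) : S σ t = Real.sinh (√σ * t) / √σ := if_pos h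
theorem C_of_pos {σ : ℝ} (h : 0 < σ) (t : ℝ) : C σ t = Real.cosh (√σ * t) := if_pos h
theorem S_zero_left (t : ℝ) : S 0 t = t := by simp [S]
theorem C_zero_left (t : ℝ) : C 0 t = 1 := by simp [C]
theorem S_of_neg {σ : ℝ} (h : σ < 0) (t : ℝ) : S σ t = Real.sin (√(-σ) * t) / √(-σ) := by
  rw [S, if_neg h.not_gt, if_neg h.ne]
theorem C_of_neg {σ : ℝ} (h : σ < 0) (t : ℝ) : C σ t = Real.cos (√(-σ) * t) := by
  rw [C, if_neg h.not_gt, if_neg h.ne]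

theorem S_zero (σ : ℝ) : S σ 0 = 0 := by simp [S]
theorem C_zero (σ : ℝ) : C σ 0 = 1 := by simp [C]

theorem hasDerivAt_S (σ t : ℝ) : HasDerivAt (S σ) (C σ t) t := by
  rcases lt_trichotomy σ 0 with h | rfl | h
  · have hs : √(-σ) ≠ 0 := (Real.sqrt_pos.2 (by linarith)).ne'
    rw [C_of_neg h, show S σ = fun t => Real.sin (√(-σ) * t) / √(-σ) from funext (S_of_neg h)]
    refine ((((hasDerivAt_id t).const_mul (√(-σ))).sin).div_const _).congr_deriv ?_
    simp; field_simp
  · rw [C_zero_left, show S 0 = id from funext S_zero_left]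
    exact hasDerivAt_id t
  · have hs : √σ ≠ 0 := (Real.sqrt_pos.2 h).ne'
    rw [C_of_pos h, show S σ = fun t => Real.sinh (√σ * t) / √σ from funext (S_of_pos h)]
    refine ((((hasDerivAt_id t).const_mul (√σ)).sinh).div_const _).congr_deriv ?_
    simp; field_simp

theorem hasDerivAt_C (σ t : ℝ) : HasDerivAt (C σ) (σ * S σ t) t := by
  rcases lt_trichotomy σ 0 with h | rfl | h
  · have hs : √(-σ) ≠ 0 := (Real.sqrt_pos.2 (by linarith)).ne'
    have hq : √(-σ) * √(-σ) = -σ := Real.mul_self_sqrt (by linarith)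
    rw [S_of_neg h, show C σ = fun t => Real.cos (√(-σ) * t) from funext (C_of_neg h)]
    refine (((hasDerivAt_id t).const_mul (√(-σ))).cos).congr_deriv ?_
    simp only [id, mul_one]
    field_simp
    linear_combination -Real.sin (√(-σ) * t) * hq
  · rw [show C 0 = fun _ => 1 from funext C_zero_left, zero_mul]
    exact hasDerivAt_const t 1
  · have hs : √σ ≠ 0 := (Real.sqrt_pos.2 h).ne'
    have hq : √σ * √σ = σ := Real.mul_self_sqrt h.le
    rw [S_of_pos h, show C σ = fun t => Real.cosh (√σ * t) from funext (C_of_pos h)]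
    refine (((hasDerivAt_id t).const_mul (√σ)).cosh).congr_deriv ?_
    simp only [id, mul_one]
    field_simp
    linear_combination Real.sinh (√σ * t) * hq

theorem continuous_S (σ : ℝ) : Continuous (S σ) :=
  continuous_iff_continuousAt.2 fun t => (hasDerivAt_S σ t).continuousAt
theorem continuous_C (σ : ℝ) : Continuous (C σ) :=
  continuous_iff_continuousAt.2 fun t => (hasDerivAt_C σ t).continuousAt

theorem C_sq_sub (σ t : ℝ) : C σ t ^ 2 - σ * S σ t ^ 2 = 1 := by
  have hd : ∀ t, HasDerivAt (fun t => C σ t ^ 2 - σ * S σ t ^ 2) 0 t := fun t =>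
    (((hasDerivAt_C σ t).pow 2).sub (((hasDerivAt_S σ t).pow 2).const_mul σ)).congr_deriv (by
      simp; ring)
  have := is_const_of_deriv_eq_zero (fun t => (hd t).differentiableAt) (fun t => (hd t).deriv) t 0
  simpa [C_zero, S_zero] using this

theorem S_add (σ s t : ℝ) : S σ (s + t) = S σ s * C σ t + C σ s * S σ t := by
  rcases lt_trichotomy σ 0 with h | rfl | h
  · simp only [S_of_neg h, C_of_neg h, mul_add, Real.sin_add]; ring
  · simp [S_zero_left, C_zero_left]
  · simp only [S_of_pos h, C_of_pos h, mul_add, Real.sinh_add]; ring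

theorem S_scale {T : ℝ} (hT : 0 < T) (σ t : ℝ) : T * S (T ^ 2 * σ) t = S σ (T * t) := by
  rcases lt_trichotomy σ 0 with h | rfl | h
  · have h' : T ^ 2 * σ < 0 := mul_neg_of_pos_of_neg (by positivity) h
    have hs : √(-σ) ≠ 0 := (Real.sqrt_pos.2 (by linarith)).ne'
    rw [S_of_neg h, S_of_neg h', show -(T ^ 2 * σ) = T ^ 2 * -σ by ring,
      Real.sqrt_mul (by positivity), Real.sqrt_sq hT.le]
    field_simp
  · simp [S_zero_left]
  · have hs : √σ ≠ 0 := (Real.sqrt_pos.2 h).ne'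
    rw [S_of_pos h, S_of_pos (by positivity), Real.sqrt_mul (by positivity), Real.sqrt_sq hT.le]
    field_simp

theorem C_pos {σ t : ℝ} (ht : 0 ≤ t) (h : -σ * t ^ 2 < (Real.pi / 2) ^ 2) : 0 < C σ t := by
  rcases lt_trichotomy σ 0 with hσ | rfl | hσ
  · rw [C_of_neg hσ]
    have h1 : √(-σ) * t < Real.pi / 2 := by
      refine lt_of_pow_lt_pow_left₀ 2 (by positivity) ?_
      rwa [mul_pow, Real.sq_sqrt (by linarith)]
    exact Real.cos_pos_of_mem_Ioo ⟨by linarith [mul_nonneg (Real.sqrt_nonneg (-σ)) ht,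
      Real.pi_pos], h1⟩
  · simp [C_zero_left]
  · rw [C_of_pos hσ]; exact Real.cosh_pos _

theorem S_pos {σ t : ℝ} (ht : 0 < t) (h : -σ * t ^ 2 < Real.pi ^ 2) : 0 < S σ t := by
  rcases lt_trichotomy σ 0 with hσ | rfl | hσ
  · rw [S_of_neg hσ]
    have hs : 0 < √(-σ) := Real.sqrt_pos.2 (by linarith)
    have h1 : √(-σ) * t < Real.pi := by
      refine lt_of_pow_lt_pow_left₀ 2 (by positivity) ?_
      rwa [mul_pow, Real.sq_sqrt (by linarith)]
    exact div_pos (Real.sin_pos_of_pos_of_lt_pi (by positivity) h1) hs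
  · simpa [S_zero_left]
  · rw [S_of_pos hσ]
    have hs : 0 < √σ := Real.sqrt_pos.2 hσ
    exact div_pos (Real.sinh_pos_iff.2 (by positivity)) hs

/-! ### Extremal arcs -/

/-- The extremal arc starting at the identity, whose control is `t ↦ b * exp (2 i m t)`. -/
def arc (b : ℂ) (m t : ℝ) : CSU :=
  (-m * ∫ s in (0 : ℝ)..t, ‖b‖ ^ 2 * S (‖b‖ ^ 2 - m ^ 2) s ^ 2 /
    (1 + ‖b‖ ^ 2 * S (‖b‖ ^ 2 - m ^ 2) s ^ 2),
    b * Complex.exp (Complex.I * (m * t : ℝ)) * S (‖b‖ ^ 2 - m ^ 2) t)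

/-- The velocity of `arc b m`. -/
def arcVel (b : ℂ) (m t : ℝ) : CSU :=
  (-m * (‖b‖ ^ 2 * S (‖b‖ ^ 2 - m ^ 2) t ^ 2 / (1 + ‖b‖ ^ 2 * S (‖b‖ ^ 2 - m ^ 2) t ^ 2)),
    b * Complex.exp (Complex.I * (m * t : ℝ)) *
      (C (‖b‖ ^ 2 - m ^ 2) t + Complex.I * (m * S (‖b‖ ^ 2 - m ^ 2) t : ℝ)))

theorem arc_zero (b : ℂ) (m : ℝ) : arc b m 0 = one := by simp [arc, one, S_zero]

theorem arc_zero_left (m t : ℝ) : arc 0 m t = one := by simp [arc, one]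

theorem norm_exp_I_mul (x : ℝ) : ‖Complex.exp (Complex.I * x)‖ = 1 := by
  rw [mul_comm]; exact Complex.norm_exp_ofReal_mul_I x

theorem norm_arc_snd (b : ℂ) (m t : ℝ) :
    ‖(arc b m t).2‖ = ‖b‖ * |S (‖b‖ ^ 2 - m ^ 2) t| := by
  rw [arc, norm_mul, norm_mul, norm_exp_I_mul, mul_one, Complex.norm_real, Real.norm_eq_abs]

theorem norm_arc_snd_sq (b : ℂ) (m t : ℝ) :
    ‖(arc b m t).2‖ ^ 2 = ‖b‖ ^ 2 * S (‖b‖ ^ 2 - m ^ 2) t ^ 2 := by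
  rw [norm_arc_snd, mul_pow, sq_abs]

theorem one_add_norm_sq_mul_S_sq (b : ℂ) (m t : ℝ) : 1 + ‖b‖ ^ 2 * S (‖b‖ ^ 2 - m ^ 2) t ^ 2 =
    C (‖b‖ ^ 2 - m ^ 2) t ^ 2 + m ^ 2 * S (‖b‖ ^ 2 - m ^ 2) t ^ 2 := by
  linear_combination -C_sq_sub (‖b‖ ^ 2 - m ^ 2) t

theorem hasDerivAt_arc (b : ℂ) (m t : ℝ) : HasDerivAt (arc b m) (arcVel b m t) t := by
  have hc : Continuous fun s => ‖b‖ ^ 2 * S (‖b‖ ^ 2 - m ^ 2) s ^ 2 /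
      (1 + ‖b‖ ^ 2 * S (‖b‖ ^ 2 - m ^ 2) s ^ 2) := by
    have := continuous_S (‖b‖ ^ 2 - m ^ 2)
    exact (by fun_prop : Continuous _).div (by fun_prop) fun s => by positivity
  have h1 := ((hc.integral_hasStrictDerivAt 0 t).hasDerivAt).const_mul (-m)
  have h2 : HasDerivAt (fun t : ℝ => b * Complex.exp (Complex.I * (m * t : ℝ)))
      (b * (Complex.exp (Complex.I * (m * t : ℝ)) * (Complex.I * m))) t := by
    have h3 : HasDerivAt (fun t : ℝ => m * t) m t := by
      simpa using (hasDerivAt_id t).const_mul m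
    exact ((h3.ofReal_comp.const_mul Complex.I).cexp).const_mul b
  have h4 := h2.mul (hasDerivAt_S (‖b‖ ^ 2 - m ^ 2) t).ofReal_comp
  refine (h1.prodMk h4).congr_deriv ?_
  rw [arcVel]
  refine Prod.ext rfl ?_
  simp only
  push_cast
  ring

theorem star_arc_mul (b : ℂ) (m t : ℝ) : star (arc b m t).2 * (arcVel b m t).2 =
    (‖b‖ ^ 2 * S (‖b‖ ^ 2 - m ^ 2) t * C (‖b‖ ^ 2 - m ^ 2) t : ℝ) +
      Complex.I * (m * (‖b‖ ^ 2 * S (‖b‖ ^ 2 - m ^ 2) t ^ 2) : ℝ) := by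
  have h1 : star b * b = (‖b‖ : ℂ) ^ 2 := by
    rw [mul_comm, Complex.star_def, Complex.mul_conj, Complex.normSq_eq_norm_sq]; push_cast; ring
  have h2 := exp_mul_exp_neg (m * t)
  rw [arc, arcVel]
  simp only [star_mul']
  rw [star_exp]
  have h3 : star ((S (‖b‖ ^ 2 - m ^ 2) t : ℝ) : ℂ) = (S (‖b‖ ^ 2 - m ^ 2) t : ℝ) :=
    Complex.conj_ofReal _
  rw [h3]
  generalize S (‖b‖ ^ 2 - m ^ 2) t = s at *
  generalize C (‖b‖ ^ 2 - m ^ 2) t = c at *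
  push_cast at h1 h2 ⊢
  linear_combination (s * (c + Complex.I * (m * s))) * h1 + (star b * b *
    s * (c + Complex.I * (m * s))) * h2

/-- Here `Im (conj w * w') = m ‖b‖² S²`, so horizontality dictates the integral in the first
coordinate of `arc`. -/
theorem arcVel_mem (b : ℂ) (m t : ℝ) : arcVel b m t ∈ distribution (arc b m t) := by
  rw [mem_distribution_iff, star_arc_mul, norm_arc_snd_sq]
  have hpos : 0 < 1 + ‖b‖ ^ 2 * S (‖b‖ ^ 2 - m ^ 2) t ^ 2 := by positivity
  simp only [Complex.add_im, Complex.ofReal_im, Complex.I_mul_im, Complex.ofReal_re, zero_add]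
  rw [arcVel]
  field_simp

theorem speed_arc (b : ℂ) (m t : ℝ) : speed (arc b m) t = ‖b‖ := by
  rw [speed_of_mem (hasDerivAt_arc b m t) (arcVel_mem b m t), norm_arc_snd_sq,
    one_add_norm_sq_mul_S_sq, arcVel, norm_mul, norm_mul, norm_exp_I_mul, mul_one]
  have h : ‖(C (‖b‖ ^ 2 - m ^ 2) t + Complex.I * (m * S (‖b‖ ^ 2 - m ^ 2) t : ℝ) : ℂ)‖ =
      √(C (‖b‖ ^ 2 - m ^ 2) t ^ 2 + m ^ 2 * S (‖b‖ ^ 2 - m ^ 2) t ^ 2) := by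
    rw [Complex.norm_eq_sqrt_sq_add_sq]
    simp [mul_pow]
  rw [h, mul_div_assoc, div_self, mul_one]
  rw [← one_add_norm_sq_mul_S_sq]
  positivity

theorem contDiff_arc (b : ℂ) (m : ℝ) : ContDiff ℝ 1 (arc b m) := by
  rw [contDiff_one_iff_deriv]
  refine ⟨fun t => (hasDerivAt_arc b m t).differentiableAt, ?_⟩
  rw [show deriv (arc b m) = arcVel b m from funext fun t => (hasDerivAt_arc b m t).deriv]
  have h1 := continuous_S (‖b‖ ^ 2 - m ^ 2)
  have h2 := continuous_C (‖b‖ ^ 2 - m ^ 2)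
  refine Continuous.prodMk ?_ ?_
  · exact continuous_const.mul ((by fun_prop : Continuous _).div (by fun_prop) fun s => by positivity)
  · fun_prop

theorem isHorizontal_of_hasDerivAt {γ : ℝ → CSU} {v : ℝ → CSU} (hγ : ContDiff ℝ 1 γ)
    (hd : ∀ t, HasDerivAt γ (v t) t) (hv : ∀ t, v t ∈ distribution (γ t)) (a b : ℝ) :
    IsHorizontal γ a b :=
  ⟨hγ.contDiffOn.absolutelyContinuousOnInterval, .of_forall fun t _ => ⟨v t, hv t, hd t⟩⟩

theorem isHorizontal_arc (b : ℂ) (m s t : ℝ) : IsHorizontal (arc b m) s t :=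
  isHorizontal_of_hasDerivAt (contDiff_arc b m) (hasDerivAt_arc b m) (arcVel_mem b m) s t

/-- Horizontal curves are determined by their projection to the plane. -/
theorem eq_of_snd_eq {γ η : ℝ → CSU} (h0 : γ 0 = η 0) (h : ∀ t, (γ t).2 = (η t).2)
    (hγ : ∀ t, ∃ v ∈ distribution (γ t), HasDerivAt γ v t)
    (hη : ∀ t, ∃ v ∈ distribution (η t), HasDerivAt η v t) (t : ℝ) : γ t = η t := by
  refine Prod.ext ?_ (h t)
  have hd : ∀ t, HasDerivAt (fun t => (γ t).1 - (η t).1) 0 t := by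
    intro t
    obtain ⟨v, hv, hdv⟩ := hγ t
    obtain ⟨u, hu, hdu⟩ := hη t
    have h1 : HasDerivAt (fun s => (γ s).2) v.2 t := hdv.snd
    have h2 : HasDerivAt (fun s => (η s).2) u.2 t := hdu.snd
    have h1' : HasDerivAt (fun s => (γ s).1) v.1 t := hdv.fst
    have h2' : HasDerivAt (fun s => (η s).1) u.1 t := hdu.fst
    rw [show (fun s => (γ s).2) = fun s => (η s).2 from funext h] at h1
    have h3 := h1.unique h2
    have h4 := mem_distribution_iff.1 hv
    have h5 := mem_distribution_iff.1 hu
    rw [h t, h3, ← h5] at h4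
    refine (h1'.sub h2').congr_deriv ?_
    rw [mul_left_cancel₀ (one_add_sq_pos _).ne' h4, sub_self]
  have := is_const_of_deriv_eq_zero (fun t => (hd t).differentiableAt) (fun t => (hd t).deriv) t 0
  simp only [h0, sub_self] at this
  linarith

/-- Both sides equal `1` at time `0` and have the same logarithmic derivative, so their quotient is
constant. This gives the phase of the arc modulo `2π` without evaluating the integral that defines
`c`. -/
theorem Z_arc (b : ℂ) (m t : ℝ) : Z (arc b m t) = Complex.exp (-(Complex.I * (m * t : ℝ))) *
    (C (‖b‖ ^ 2 - m ^ 2) t + Complex.I * (m * S (‖b‖ ^ 2 - m ^ 2) t : ℝ)) := by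
  set σ := ‖b‖ ^ 2 - m ^ 2 with hσ
  set Y : ℝ → ℂ := fun t => Complex.exp (-(Complex.I * (m * t : ℝ))) *
    (C σ t + Complex.I * (m * S σ t : ℝ)) with hY
  have hYd : ∀ t, HasDerivAt Y ((‖b‖ ^ 2 * S σ t : ℝ) *
      Complex.exp (-(Complex.I * (m * t : ℝ)))) t := by
    intro t
    have h3 : HasDerivAt (fun t : ℝ => m * t) m t := by
      simpa using (hasDerivAt_id t).const_mul m
    have h4 := ((h3.ofReal_comp.const_mul Complex.I).fun_neg).cexp
    have h5 := (hasDerivAt_C σ t).ofReal_comp.fun_add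
      ((((hasDerivAt_S σ t).const_mul m).ofReal_comp).const_mul Complex.I)
    refine (h4.mul h5).congr_deriv ?_
    rw [hσ]
    push_cast
    linear_combination (-(Complex.exp (-(Complex.I * (m * t)))) * m ^ 2 * S (‖b‖ ^ 2 - m ^ 2) t) *
      Complex.I_sq
  have hq : ∀ t, HasDerivAt (fun t => Y t / Z (arc b m t)) 0 t := by
    intro t
    refine ((hYd t).div (hasDerivAt_Z (hasDerivAt_arc b m t)) (Z_ne_zero _)).congr_deriv ?_
    rw [div_eq_zero_iff]
    left
    have hD : ((1 + ‖(arc b m t).2‖ ^ 2 : ℝ) : ℂ) = C σ t ^ 2 + m ^ 2 * S σ t ^ 2 := by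
      rw [norm_arc_snd_sq, one_add_norm_sq_mul_S_sq]; push_cast; rfl
    have hD0 : (C σ t : ℂ) ^ 2 + m ^ 2 * S σ t ^ 2 ≠ 0 := by
      rw [← hD]; exact_mod_cast (one_add_sq_pos _).ne'
    have hv : ((arcVel b m t).1 : ℂ) =
        -m * (‖b‖ ^ 2 * S σ t ^ 2 / (C σ t ^ 2 + m ^ 2 * S σ t ^ 2)) := by
      rw [arcVel, one_add_norm_sq_mul_S_sq]; push_cast; rfl
    push_cast at hD
    rw [dz₁_div_Z, star_arc_mul, hD, hv]
    simp only [hY, Complex.add_re, Complex.ofReal_re, Complex.I_mul_re, Complex.ofReal_im,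
      neg_zero, add_zero]
    rw [← hσ]
    generalize Z (arc b m t) = z
    generalize hE : Complex.exp (-(Complex.I * (m * t : ℝ))) = e
    obtain ⟨D, hDd⟩ : ∃ D : ℂ, D = C σ t ^ 2 + m ^ 2 * S σ t ^ 2 := ⟨_, rfl⟩
    rw [← hDd] at hD0 ⊢
    push_cast
    field_simp
    rw [hDd]
    linear_combination (‖b‖ ^ 2 * S σ t * e * z * m ^ 2 * S σ t ^ 2 : ℂ) * Complex.I_sq
  have h0 := is_const_of_deriv_eq_zero (fun t => (hq t).differentiableAt) (fun t => (hq t).deriv) t 0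
  have h1 : Y 0 / Z (arc b m 0) = 1 := by simp [hY, arc_zero, Z_one, C_zero, S_zero]
  simp only [h1] at h0
  exact ((div_eq_one_iff_eq (Z_ne_zero _)).1 h0).symm


/-- Restarting the control `b * exp (2 i m t)` at time `s` multiplies its initial value by `exp (2 i
m s)`. Both sides are horizontal, so it is enough to compare their projections. -/
theorem arc_add (b : ℂ) (m s t : ℝ) : arc b m (s + t) =
    mul (arc b m s) (arc (b * Complex.exp (Complex.I * (2 * (m * s) : ℝ))) m t) := by
  have hn : ‖b * Complex.exp (Complex.I * (2 * (m * s) : ℝ))‖ = ‖b‖ := by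
    rw [norm_mul, norm_exp_I_mul, mul_one]
  refine eq_of_snd_eq (γ := fun t => arc b m (s + t)) (η := fun t => mul (arc b m s)
    (arc (b * Complex.exp (Complex.I * (2 * (m * s) : ℝ))) m t)) ?_ ?_ ?_ ?_ t
  · simp [arc_zero, mul_one']
  · intro t
    simp only [mul_snd, Z_arc, hn]
    simp only [arc, hn, star_mul', S_add, star_add]
    rw [show star (Complex.exp (-(Complex.I * (m * t : ℝ)))) = Complex.exp (Complex.I * (m * t : ℝ))
      by rw [← star_exp, star_star]]
    have h1 : Complex.exp (Complex.I * (m * (s + t) : ℝ)) = Complex.exp (Complex.I * (m * s : ℝ)) *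
        Complex.exp (Complex.I * (m * t : ℝ)) := by rw [← Complex.exp_add]; push_cast; ring_nf
    have h2 : Complex.exp (Complex.I * (2 * (m * s) : ℝ)) = Complex.exp (Complex.I * (m * s : ℝ)) *
        Complex.exp (Complex.I * (m * s : ℝ)) := by rw [← Complex.exp_add]; push_cast; ring_nf
    have h3 := exp_mul_exp_neg (m * s)
    simp only [Complex.star_def, Complex.conj_I, Complex.conj_ofReal]
    rw [h1, h2]
    generalize Complex.exp (Complex.I * (m * s : ℝ)) = e at *
    generalize Complex.exp (Complex.I * (m * t : ℝ)) = f at *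
    generalize Complex.exp (-(Complex.I * (m * s : ℝ))) = e' at *
    push_cast
    linear_combination (-b * e * f * S (‖b‖ ^ 2 - m ^ 2) t *
      (C (‖b‖ ^ 2 - m ^ 2) s + Complex.I * (m * S (‖b‖ ^ 2 - m ^ 2) s))) * h3
  · intro t
    exact ⟨_, arcVel_mem b m (s + t), (hasDerivAt_arc b m (s + t)).comp_const_add s t⟩
  · intro t
    obtain ⟨v, hv, hd, -⟩ := hasDerivAt_mul_left (arc b m s)
      (hasDerivAt_arc (b * Complex.exp (Complex.I * (2 * (m * s) : ℝ))) m t) (arcVel_mem _ m t)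
    exact ⟨v, hv, hd⟩

theorem arc_scale {T : ℝ} (hT : 0 < T) (b : ℂ) (m t : ℝ) :
    arc (T * b) (T * m) t = arc b m (T * t) := by
  refine eq_of_snd_eq (γ := arc (T * b) (T * m)) (η := fun t => arc b m (T * t)) ?_ ?_ ?_ ?_ t
  · simp [arc_zero]
  · intro t
    have h1 : ‖(T : ℂ) * b‖ ^ 2 - (T * m) ^ 2 = T ^ 2 * (‖b‖ ^ 2 - m ^ 2) := by
      rw [norm_mul, Complex.norm_real, Real.norm_of_nonneg hT.le]; ring
    simp only [arc, h1, ← S_scale hT]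
    rw [show T * m * t = m * (T * t) by ring]
    push_cast
    ring
  · exact fun t => ⟨_, arcVel_mem _ _ t, hasDerivAt_arc _ _ t⟩
  · intro t
    have h2 : HasDerivAt (fun t : ℝ => T * t) T t := by simpa using (hasDerivAt_id t).const_mul T
    exact ⟨_, Submodule.smul_mem _ T (arcVel_mem b m (T * t)),
      (hasDerivAt_arc b m (T * t)).scomp t h2⟩

/-- The reflection `(c, w) ↦ (-c, conj w)` permutes the arcs. It lets the sign of `c` be chosen
freely. -/
theorem arc_conj (b : ℂ) (m t : ℝ) :
    arc (star b) (-m) t = (-(arc b m t).1, star (arc b m t).2) := by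
  refine Prod.ext ?_ ?_
  · simp [arc]
  · simp only [arc, norm_star, neg_sq, star_mul', star_exp]
    congr 2
    · congr 1; push_cast; ring_nf
    · exact (Complex.conj_ofReal _).symm

theorem arc_rotate {u : ℂ} (hu : ‖u‖ = 1) (b : ℂ) (m t : ℝ) :
    arc (u * b) m t = ((arc b m t).1, u * (arc b m t).2) := by
  simp [arc, hu, mul_assoc]

end CSU

namespace CSU

/-! ### Calibrations -/

/-- The derivative of `radial l`. -/
def radialDeriv (l r : ℝ) : ℝ := √(1 + (1 - l ^ 2) * r ^ 2) / (1 + r ^ 2)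

/-- The radial part of the calibrating function. -/
def radial (l r : ℝ) : ℝ := ∫ s in (0 : ℝ)..r, radialDeriv l s

/-- A function whose horizontal gradient has unit length where `l ^ 2 * ‖w‖ ^ 2 ≤ 1 + ‖w‖ ^ 2`. -/
def calib (l : ℝ) (g : CSU) : ℝ := l * g.1 + radial l ‖g.2‖

theorem continuous_radialDeriv (l : ℝ) : Continuous (radialDeriv l) :=
  (by fun_prop : Continuous _).div (by fun_prop) fun r => by positivity

theorem hasDerivAt_radial (l r : ℝ) : HasDerivAt (radial l) (radialDeriv l r) r :=
  ((continuous_radialDeriv l).integral_hasStrictDerivAt 0 r).hasDerivAt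

theorem radialDeriv_nonneg (l r : ℝ) : 0 ≤ radialDeriv l r := by unfold radialDeriv; positivity

theorem radialDeriv_le_one (l r : ℝ) : radialDeriv l r ≤ 1 := by
  rw [radialDeriv, div_le_one (by positivity), Real.sqrt_le_iff]
  exact ⟨by positivity, by nlinarith [mul_nonneg (sq_nonneg l) (sq_nonneg r), sq_nonneg r]⟩

theorem lipschitzWith_radial (l : ℝ) : LipschitzWith 1 (radial l) := by
  refine lipschitzWith_of_nnnorm_deriv_le (fun r => (hasDerivAt_radial l r).differentiableAt) ?_
  intro r
  rw [(hasDerivAt_radial l r).deriv, ← NNReal.coe_le_coe, coe_nnnorm,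
    Real.norm_of_nonneg (radialDeriv_nonneg l r)]
  exact radialDeriv_le_one l r

theorem radial_zero (l : ℝ) : radial l 0 = 0 := by simp [radial]

theorem radial_nonneg (l : ℝ) {r : ℝ} (hr : 0 ≤ r) : 0 ≤ radial l r :=
  intervalIntegral.integral_nonneg hr fun s _ => radialDeriv_nonneg l s

theorem calib_one (l : ℝ) : calib l one = 0 := by simp [calib, one, radial_zero]

theorem mul_le_radial {l r k : ℝ} (hr : 0 ≤ r) (h : ∀ s ∈ Icc 0 r, k ≤ radialDeriv l s) :
    k * r ≤ radial l r := by
  have := intervalIntegral.integral_mono_on (μ := volume) hr (intervalIntegrable_const (c := k))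
    ((continuous_radialDeriv l).intervalIntegrable 0 r) h
  rw [intervalIntegral.integral_const, smul_eq_mul, sub_zero, mul_comm] at this
  exact this

theorem hasDerivAt_norm_of_ne {f : ℝ → ℂ} {f' : ℂ} {t : ℝ} (h : HasDerivAt f f' t)
    (h0 : f t ≠ 0) : HasDerivAt (fun s => ‖f s‖) ((star (f t) * f').re / ‖f t‖) t := by
  have h1 := h.norm_sq.sqrt (by positivity)
  simp only [Real.sqrt_sq (norm_nonneg _)] at h1
  refine h1.congr_deriv ?_
  have e : (inner ℝ (f t) f' : ℝ) = (star (f t) * f').re := by simp [Complex.inner, mul_comm]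
  rw [e, mul_div_mul_left _ _ two_ne_zero]

/-- The norm is not differentiable at `w = 0`. However, horizontality gives `c' = 0` there and the
radial part has a minimum, so a derivative along the curve, if it exists, is zero. -/
theorem hasDerivAt_calib_of_eq_zero {γ : ℝ → CSU} {v : CSU} {t l f' : ℝ} (h : HasDerivAt γ v t)
    (hv : v ∈ distribution (γ t)) (h0 : (γ t).2 = 0)
    (hf : HasDerivAt (fun s => calib l (γ s)) f' t) : f' = 0 := by
  have hc : HasDerivAt (fun s => (γ s).1) v.1 t := h.fst
  have hv1 : v.1 = 0 := by
    have := mem_distribution_iff.1 hv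
    rw [h0] at this
    simpa using this
  have h1 : HasDerivAt (fun s => radial l ‖(γ s).2‖) (f' - l * v.1) t := by
    refine (hf.sub (hc.const_mul l)).congr_of_eventuallyEq (.of_forall fun s => ?_)
    simp [calib]
  have h2 : IsLocalMin (fun s => radial l ‖(γ s).2‖) t := by
    refine .of_forall fun s => ?_
    simp only [h0, norm_zero, radial_zero]
    exact radial_nonneg l (norm_nonneg _)
  have := h2.hasDerivAt_eq_zero h1
  rw [hv1, mul_zero, sub_zero] at this
  exact this

theorem hasDerivAt_calib {γ : ℝ → CSU} {v : CSU} {t l : ℝ} (h : HasDerivAt γ v t)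
    (hv : v ∈ distribution (γ t)) (h0 : (γ t).2 ≠ 0) :
    HasDerivAt (fun s => calib l (γ s)) ((-(l * ‖(γ t).2‖) * ((star (γ t).2 * v.2).im / ‖(γ t).2‖) +
      √(1 + (1 - l ^ 2) * ‖(γ t).2‖ ^ 2) * ((star (γ t).2 * v.2).re / ‖(γ t).2‖)) /
        (1 + ‖(γ t).2‖ ^ 2)) t := by
  have hw : HasDerivAt (fun s => (γ s).2) v.2 t := h.snd
  have hc : HasDerivAt (fun s => (γ s).1) v.1 t := h.fst
  have h1 := (hc.const_mul l).add
    ((hasDerivAt_radial l _).comp t (hasDerivAt_norm_of_ne hw h0))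
  refine h1.congr_deriv ?_
  have h2 := mem_distribution_iff.1 hv
  have hpos := one_add_sq_pos (γ t).2
  have hr : ‖(γ t).2‖ ≠ 0 := norm_ne_zero_iff.2 h0
  have h3 : v.1 = -(star (γ t).2 * v.2).im / (1 + ‖(γ t).2‖ ^ 2) := by
    rw [eq_div_iff hpos.ne', mul_comm, h2]
  rw [h3, radialDeriv]
  field_simp

theorem sq_add_sq_star_mul_div (w v : ℂ) (hw : w ≠ 0) :
    ((star w * v).re / ‖w‖) ^ 2 + ((star w * v).im / ‖w‖) ^ 2 = ‖v‖ ^ 2 := by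
  have h : (star w * v).re ^ 2 + (star w * v).im ^ 2 = (‖w‖ * ‖v‖) ^ 2 := by
    rw [← norm_star w, ← norm_mul, ← Complex.normSq_eq_norm_sq, Complex.normSq_apply]
    ring
  have hr : ‖w‖ ≠ 0 := norm_ne_zero_iff.2 hw
  rw [div_pow, div_pow, ← add_div, h, mul_pow, mul_div_cancel_left₀ _ (by positivity)]

theorem deriv_calib_le {γ : ℝ → CSU} {v : CSU} {t l f' : ℝ} (h : HasDerivAt γ v t)
    (hv : v ∈ distribution (γ t)) (hl : l ^ 2 * ‖(γ t).2‖ ^ 2 ≤ 1 + ‖(γ t).2‖ ^ 2)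
    (hf : HasDerivAt (fun s => calib l (γ s)) f' t) : f' ≤ speed γ t := by
  by_cases h0 : (γ t).2 = 0
  · rw [hasDerivAt_calib_of_eq_zero h hv h0 hf]; exact speed_nonneg γ t
  rw [hf.unique (hasDerivAt_calib h hv h0), speed_of_mem h hv]
  have h1 := sq_add_sq_star_mul_div _ v.2 h0
  set P := (star (γ t).2 * v.2).re / ‖(γ t).2‖
  set Q := (star (γ t).2 * v.2).im / ‖(γ t).2‖
  set r := ‖(γ t).2‖
  have hA : √(1 + (1 - l ^ 2) * r ^ 2) ^ 2 = 1 + (1 - l ^ 2) * r ^ 2 := Real.sq_sqrt (by linarith)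
  set A := √(1 + (1 - l ^ 2) * r ^ 2)
  have hpos : 0 < 1 + r ^ 2 := by positivity
  have hN : √(1 + r ^ 2) ^ 2 = 1 + r ^ 2 := Real.sq_sqrt hpos.le
  have hN0 : 0 < √(1 + r ^ 2) := Real.sqrt_pos.2 hpos
  set N := √(1 + r ^ 2)
  rw [← hN, div_le_div_iff₀ (by positivity) hN0]
  -- Cauchy–Schwarz for `(A, -l r)` and `(P, Q)`, of lengths `N` and `‖v.2‖`. The defect is `(A Q +
  -- l r P)²`.
  have h2 : -(l * r) * Q + A * P ≤ ‖v.2‖ * N := by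
    refine le_of_sq_le_sq ?_ (by positivity)
    nlinarith [sq_nonneg (A * Q + l * r * P)]
  nlinarith

/-- The equality case of the Cauchy–Schwarz inequality in `deriv_calib_le`: the radial and angular
parts of the velocity are proportional to `(A, -l r)`. -/
theorem eq_of_deriv_calib_eq {γ : ℝ → CSU} {v : CSU} {t l : ℝ} (h : HasDerivAt γ v t)
    (hv : v ∈ distribution (γ t)) (hl : l ^ 2 * ‖(γ t).2‖ ^ 2 ≤ 1 + ‖(γ t).2‖ ^ 2)
    (h0 : (γ t).2 ≠ 0) (hf : HasDerivAt (fun s => calib l (γ s)) (speed γ t) t) :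
    v.2 = (γ t).2 * (speed γ t * (√(1 + (1 - l ^ 2) * ‖(γ t).2‖ ^ 2) / ‖(γ t).2‖ : ℝ) -
      Complex.I * (l * speed γ t : ℝ)) := by
  have h2 := hf.unique (hasDerivAt_calib h hv h0)
  have h1 := sq_add_sq_star_mul_div _ v.2 h0
  have h3 := speed_of_mem h hv
  have hr : 0 < ‖(γ t).2‖ := norm_pos_iff.2 h0
  have hvw : v.2 = (γ t).2 * ((((star (γ t).2 * v.2).re / ‖(γ t).2‖ : ℝ) +
      ((star (γ t).2 * v.2).im / ‖(γ t).2‖ : ℝ) * Complex.I) / (‖(γ t).2‖ : ℝ)) := by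
    have e1 : (((star (γ t).2 * v.2).re / ‖(γ t).2‖ : ℝ) : ℂ) +
      ((star (γ t).2 * v.2).im / ‖(γ t).2‖ : ℝ) * Complex.I = star (γ t).2 * v.2 / ‖(γ t).2‖ := by
      push_cast
      rw [div_mul_eq_mul_div, ← add_div, Complex.re_add_im]
    have e2 : (γ t).2 * star (γ t).2 = (‖(γ t).2‖ : ℂ) ^ 2 := by
      rw [Complex.star_def, Complex.mul_conj, Complex.normSq_eq_norm_sq]; push_cast; ring
    have hrC : (‖(γ t).2‖ : ℂ) ≠ 0 := by exact_mod_cast hr.ne'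
    rw [e1]
    field_simp
    linear_combination -v.2 * e2
  have hs0 := speed_nonneg γ t
  set s := speed γ t
  set P := (star (γ t).2 * v.2).re / ‖(γ t).2‖
  set Q := (star (γ t).2 * v.2).im / ‖(γ t).2‖
  set r := ‖(γ t).2‖
  have hA : √(1 + (1 - l ^ 2) * r ^ 2) ^ 2 = 1 + (1 - l ^ 2) * r ^ 2 := Real.sq_sqrt (by linarith)
  set A := √(1 + (1 - l ^ 2) * r ^ 2)
  have hpos : 0 < 1 + r ^ 2 := by positivity
  have hN : √(1 + r ^ 2) ^ 2 = 1 + r ^ 2 := Real.sq_sqrt hpos.le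
  have hN0 : 0 < √(1 + r ^ 2) := Real.sqrt_pos.2 hpos
  have h4 : ‖v.2‖ ^ 2 = s ^ 2 * (1 + r ^ 2) := by
    rw [h3, div_pow, hN]; field_simp
  rw [eq_div_iff hpos.ne'] at h2
  have h5 : (A * Q + l * r * P) ^ 2 = 0 := by
    have : (A * Q + l * r * P) ^ 2 + (-(l * r) * Q + A * P) ^ 2 = (A ^ 2 + l ^ 2 * r ^ 2) *
      (P ^ 2 + Q ^ 2) := by ring
    rw [← h2, h1, hA, h4] at this
    linarith
  have h6 : A * Q + l * r * P = 0 := by simpa using h5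
  have hP : P = A * s := by
    have : (1 + r ^ 2) * P = (1 + r ^ 2) * (A * s) := by
      linear_combination (-A) * h2 + l * r * h6 - P * hA
    exact mul_left_cancel₀ hpos.ne' this
  have hQ : Q = -(l * r * s) := by
    have : (1 + r ^ 2) * Q = (1 + r ^ 2) * -(l * r * s) := by
      linear_combination (l * r) * h2 + A * h6 - Q * hA
    exact mul_left_cancel₀ hpos.ne' this
  have hrC : (r : ℂ) ≠ 0 := by exact_mod_cast hr.ne'
  rw [hvw, hP, hQ]
  congr 1
  push_cast
  field_simp
  ring

/-- The norm and `radial l` are Lipschitz, which suffices although the norm is not smooth at `w =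
0`. -/
theorem IsHorizontal.ac_calib {γ : ℝ → CSU} {a b : ℝ} (hγ : IsHorizontal γ a b) (l : ℝ) :
    AbsolutelyContinuousOnInterval (fun t => calib l (γ t)) a b := by
  have h1 : AbsolutelyContinuousOnInterval (fun t => ‖(γ t).2‖) a b :=
    (lipschitzWith_one_norm.lipschitzOnWith (s := univ)).comp_absolutelyContinuousOnInterval
      hγ.ac_snd fun _ _ => mem_univ _
  have h2 : AbsolutelyContinuousOnInterval (fun t => radial l ‖(γ t).2‖) a b :=
    ((lipschitzWith_radial l).lipschitzOnWith (s := univ)).comp_absolutelyContinuousOnInterval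
      h1 fun _ _ => mem_univ _
  exact (hγ.ac_fst.const_mul l).fun_add h2

/-- The calibration inequality: the pointwise bound `deriv_calib_le` integrated along the curve. -/
theorem calib_sub_le_length {γ : ℝ → CSU} {a b l : ℝ} (hab : a ≤ b) (hγ : IsHorizontal γ a b)
    (hl : ∀ t ∈ Icc a b, l ^ 2 * ‖(γ t).2‖ ^ 2 ≤ 1 + ‖(γ t).2‖ ^ 2) :
    calib l (γ b) - calib l (γ a) ≤ length γ a b := by
  have hf := hγ.ac_calib l
  rw [← hf.integral_deriv_eq_sub, length]
  refine intervalIntegral.integral_mono_ae_restrict hab hf.intervalIntegrable_deriv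
    (hγ.intervalIntegrable_speed hab) ?_
  rw [Filter.EventuallyLE, ae_restrict_iff' measurableSet_Icc]
  filter_upwards [hγ.2, hf.ae_differentiableAt] with t h1 h2 ht
  obtain ⟨v, hv, hd⟩ := h1 ht
  rw [uIcc_of_le hab] at h2
  exact deriv_calib_le hd hv (hl t ht) (h2 ht).hasDerivAt

/-- A horizontal curve does not leave a disc before its length exceeds the radius. -/
theorem norm_div_le_length {γ : ℝ → CSU} {a b : ℝ} (hγ : IsHorizontal γ a b)
    (ha : γ a = one) {t : ℝ} (ht : t ∈ Icc a b) :
    ‖(γ t).2‖ / √(1 + ‖(γ t).2‖ ^ 2) ≤ length γ a b := by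
  -- For `l = 0` the domain condition is void. The integrand `1 / √(1 + s²)` of `radial 0` decreases
  -- on `[0, r]`, so its value at `r` times `r` is a lower bound for the integral.
  have h1 := calib_sub_le_length (l := 0) ht.1 (hγ.mono le_rfl ht.1 ht.2) (by
    intro s _; simp; positivity)
  rw [ha, calib_one, sub_zero] at h1
  have h2 : 1 / √(1 + ‖(γ t).2‖ ^ 2) * ‖(γ t).2‖ ≤ radial 0 ‖(γ t).2‖ := by
    refine mul_le_radial (norm_nonneg _) fun s hs => ?_
    have e : radialDeriv 0 s = 1 / √(1 + s ^ 2) := by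
      have hN : √(1 + s ^ 2) ^ 2 = 1 + s ^ 2 := Real.sq_sqrt (by positivity)
      have hN0 : 0 < √(1 + s ^ 2) := Real.sqrt_pos.2 (by positivity)
      rw [radialDeriv]
      simp only [ne_eq, OfNat.ofNat_ne_zero, not_false_eq_true, zero_pow, sub_zero, one_mul]
      rw [div_eq_div_iff (by positivity) hN0.ne']
      linarith
    rw [e]
    have := hs.1
    have := hs.2
    gcongr
  have h3 := length_add ht.1 ht.2 hγ
  have h4 := length_nonneg (γ := γ) ht.2
  simp only [calib, zero_mul, zero_add] at h1
  rw [one_div, inv_mul_eq_div] at h2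
  linarith

theorem sq_mul_le_of_length {γ : ℝ → CSU} {a b l : ℝ} (hγ : IsHorizontal γ a b)
    (ha : γ a = one) {t k : ℝ} (ht : t ∈ Icc a b) (hk : |l| * length γ a b ≤ k) :
    l ^ 2 * ‖(γ t).2‖ ^ 2 ≤ k ^ 2 * (1 + ‖(γ t).2‖ ^ 2) := by
  have h1 := norm_div_le_length hγ ha ht
  have h2 : |l| * (‖(γ t).2‖ / √(1 + ‖(γ t).2‖ ^ 2)) ≤ k :=
    (mul_le_mul_of_nonneg_left h1 (abs_nonneg l)).trans hk
  have h3 := pow_le_pow_left₀ (by positivity) h2 2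
  rw [mul_pow, sq_abs, div_pow, Real.sq_sqrt (one_add_sq_pos _).le, ← mul_div_assoc,
    div_le_iff₀ (one_add_sq_pos _)] at h3
  exact h3

/-- By `norm_div_le_length`, a curve of length at most `1 / |l|` cannot leave the domain where the
gradient of `calib l` has length at most one. -/
theorem calib_le_length {γ : ℝ → CSU} {a b l : ℝ} (hab : a ≤ b) (hγ : IsHorizontal γ a b)
    (ha : γ a = one) (hl : |l| * length γ a b ≤ 1) : calib l (γ b) ≤ length γ a b := by
  have := calib_sub_le_length (l := l) hab hγ fun t ht => by
    simpa using sq_mul_le_of_length hγ ha ht hl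
  rwa [ha, calib_one, sub_zero] at this

/-! ### Short extremal arcs are minimizing -/

/-- For `σ = R² - m² < 0` this says `√(-σ) t ≤ 1 < π / 2`, which keeps the generalized sine and
cosine positive on short arcs. -/
theorem sq_sub_mul_sq_le {R m T t : ℝ} (ht0 : 0 ≤ t) (htT : t ≤ T) (h : |m| * T ≤ 1) :
    -(R ^ 2 - m ^ 2) * t ^ 2 ≤ 1 := by
  have h1 : |m| * t ≤ 1 := (mul_le_mul_of_nonneg_left htT (abs_nonneg m)).trans h
  have h2 := pow_le_pow_left₀ (by positivity) h1 2
  rw [mul_pow, sq_abs] at h2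
  nlinarith [mul_nonneg (sq_nonneg R) (sq_nonneg t)]

theorem one_lt_pi_div_two_sq : (1 : ℝ) < (Real.pi / 2) ^ 2 := by
  nlinarith [Real.pi_gt_three]

theorem C_pos_of_le {R m T t : ℝ} (ht0 : 0 ≤ t) (htT : t ≤ T) (h : |m| * T ≤ 1) :
    0 < C (R ^ 2 - m ^ 2) t :=
  C_pos ht0 ((sq_sub_mul_sq_le ht0 htT h).trans_lt one_lt_pi_div_two_sq)

theorem S_pos_of_le {R m T t : ℝ} (ht0 : 0 < t) (htT : t ≤ T) (h : |m| * T ≤ 1) :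
    0 < S (R ^ 2 - m ^ 2) t :=
  S_pos ht0 ((sq_sub_mul_sq_le ht0.le htT h).trans_lt (by nlinarith [Real.pi_gt_three]))

theorem S_nonneg_of_le {R m T t : ℝ} (ht0 : 0 ≤ t) (htT : t ≤ T) (h : |m| * T ≤ 1) :
    0 ≤ S (R ^ 2 - m ^ 2) t := by
  rcases ht0.eq_or_lt with rfl | h0
  · rw [S_zero]
  · exact (S_pos_of_le h0 htT h).le

/-- For `l = -m / ‖b‖` the square root in `radialDeriv` equals `C σ t` along the arc, by `C² - σ S²
= 1` and the positivity of `C`. Hence `calib l` grows at the constant rate `‖b‖`. -/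
theorem calib_arc {b : ℂ} (hb : b ≠ 0) {m T : ℝ} (hT : 0 ≤ T) (h : |m| * T ≤ 1) :
    calib (-m / ‖b‖) (arc b m T) = ‖b‖ * T := by
  set R := ‖b‖ with hR
  have hRpos : 0 < R := norm_pos_iff.2 hb
  set σ := R ^ 2 - m ^ 2 with hσ
  set G : ℝ → ℝ := fun t => -m / R * (arc b m t).1 + radial (-m / R) (R * S σ t) - R * t with hG
  have hd : ∀ t ∈ Icc 0 T, HasDerivAt G 0 t := by
    intro t ht
    have h1 : HasDerivAt (fun s => (arc b m s).1) (arcVel b m t).1 t := (hasDerivAt_arc b m t).fst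
    have h2 := (hasDerivAt_radial (-m / R) (R * S σ t)).comp t
      ((hasDerivAt_S σ t).const_mul R)
    refine (((h1.const_mul (-m / R)).add h2).sub ((hasDerivAt_id t).const_mul R)).congr_deriv ?_
    have hC := C_pos_of_le (R := R) ht.1 ht.2 h
    rw [← hσ] at hC
    have e1 : 1 + (1 - (-m / R) ^ 2) * (R * S σ t) ^ 2 = C σ t ^ 2 := by
      have := C_sq_sub σ t
      rw [hσ] at this ⊢
      field_simp
      linear_combination -this
    rw [radialDeriv, e1, Real.sqrt_sq hC.le, arcVel]
    simp only
    rw [← hR, ← hσ]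
    have hpos : 0 < 1 + R ^ 2 * S σ t ^ 2 := by positivity
    have := C_sq_sub σ t
    rw [hσ] at this ⊢
    field_simp
    linear_combination R * this
  have h0 := constant_of_has_deriv_right_zero (a := 0) (b := T) (f := G)
    (fun t ht => (hd t ht).continuousAt.continuousWithinAt)
    (fun t ht => (hd t ⟨ht.1, ht.2.le⟩).hasDerivWithinAt) T ⟨hT, le_rfl⟩
  have hS := S_nonneg_of_le (R := R) hT le_rfl h
  rw [← hσ] at hS
  have h1 : G 0 = 0 := by simp [hG, arc_zero, one, S_zero, radial_zero]
  rw [h1] at h0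
  rw [calib, norm_arc_snd, ← hR, ← hσ, abs_of_nonneg hS]
  simp only [hG] at h0
  linarith

theorem isHorizontal_arc_sub (b : ℂ) (m a s t : ℝ) :
    IsHorizontal (fun x => arc b m (x - a)) s t :=
  isHorizontal_of_hasDerivAt ((contDiff_arc b m).comp (contDiff_id.sub contDiff_const))
    (fun x => (hasDerivAt_arc b m (x - a)).comp_sub_const x a) (fun x => arcVel_mem b m (x - a)) s t

theorem speed_arc_sub (b : ℂ) (m a t : ℝ) : speed (fun x => arc b m (x - a)) t = ‖b‖ := by
  rw [speed_of_hasDerivAt ((hasDerivAt_arc b m (t - a)).comp_sub_const t a),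
    ← speed_of_hasDerivAt (hasDerivAt_arc b m (t - a)), speed_arc]

theorem length_arc_sub (b : ℂ) (m a : ℝ) {s t : ℝ} (hst : s ≤ t) :
    length (fun x => arc b m (x - a)) s t = ‖b‖ * (t - s) :=
  length_of_speed_eq hst (.of_forall fun x _ => speed_arc_sub b m a x)

theorem isLengthMinimizing_arc {b : ℂ} {m s t : ℝ} (hst : s ≤ t) (h : |m| * (t - s) ≤ 1) :
    IsLengthMinimizing (fun x => arc b m (x - s)) s t := by
  refine ⟨isHorizontal_arc_sub b m s s t, fun η hη h1 h2 => ?_⟩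
  rw [length_arc_sub b m s hst]
  rcases eq_or_ne b 0 with rfl | hb
  · simpa using length_nonneg hst
  have hR : 0 < ‖b‖ := norm_pos_iff.2 hb
  -- Only a strictly shorter competitor has to be excluded, and such a curve is short enough for
  -- `calib_le_length`.
  by_contra! hlt
  have h3 := calib_le_length (l := -m / ‖b‖) hst hη (by simpa [arc_zero] using h1) (by
    rw [abs_div, abs_neg, abs_of_pos hR, div_mul_eq_mul_div, div_le_one hR]
    calc |m| * length η s t ≤ |m| * (‖b‖ * (t - s)) := by gcongr
      _ = (|m| * (t - s)) * ‖b‖ := by ring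
      _ ≤ 1 * ‖b‖ := by gcongr
      _ = ‖b‖ := one_mul _)
  have h2' : η t = arc b m (t - s) := h2
  rw [h2', calib_arc hb (by linarith) h] at h3
  linarith

end CSU

/-! ### Uniqueness of short minimizers -/

namespace CSU

/-- Short extremal arcs are the only shortest curves between their end points. -/
theorem eq_arc_of_isLengthMinimizing {η : ℝ → CSU} {a b : ℝ} (hab : a < b)
    (hη : IsLengthMinimizing η a b) (ha : η a = one) {r : ℝ}
    (hr : ∀ᵐ t, t ∈ Icc a b → speed η t = r) {β : ℂ} {m : ℝ} (hβ : β ≠ 0)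
    (hm : |m| * (b - a) < 1) (hb : η b = arc β m (b - a)) :
    ∀ t ∈ Icc a b, η t = arc β m (t - a) := by
  have hT : 0 < b - a := sub_pos.2 hab
  set R := ‖β‖ with hRdef
  have hR : 0 < R := norm_pos_iff.2 hβ
  have hlen : length η a b ≤ R * (b - a) := by
    have := hη.2 _ (isHorizontal_arc_sub β m a a b) (by simp [ha, arc_zero]) (by simp [hb])
    rwa [length_arc_sub β m a hab.le] at this
  set l := -m / R with hl
  have hk : |l| * length η a b ≤ |m| * (b - a) := by
    rw [hl, abs_div, abs_neg, abs_of_pos hR, div_mul_eq_mul_div, div_le_iff₀ hR]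
    calc |m| * length η a b ≤ |m| * (R * (b - a)) := by gcongr
      _ = (|m| * (b - a)) * R := by ring
  -- The strict bound on `|m| * (b - a)` keeps the curve in the interior of the domain of the
  -- calibration, so the square root `A` below is positive and differentiable along it.
  have hdom : ∀ t ∈ Icc a b, l ^ 2 * ‖(η t).2‖ ^ 2 < 1 + ‖(η t).2‖ ^ 2 := by
    intro t ht
    refine (sq_mul_le_of_length hη.1 ha ht hk).trans_lt ?_
    have h1 : (|m| * (b - a)) ^ 2 < 1 := by
      have : 0 ≤ |m| * (b - a) := by positivity
      nlinarith
    nlinarith [one_add_sq_pos (η t).2]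
  have hend : calib l (η b) = R * (b - a) := by rw [hb, hl]; exact calib_arc hβ hT.le hm.le
  have hsub : ∀ s t, a ≤ s → s ≤ t → t ≤ b → calib l (η t) - calib l (η s) ≤ r * (t - s) := by
    intro s t has hst htb
    refine (calib_sub_le_length hst (hη.1.mono has hst htb) fun x hx =>
      (hdom x ⟨has.trans hx.1, hx.2.trans htb⟩).le).trans_eq (length_of_speed_eq hst ?_)
    filter_upwards [hr] with x hx hxI using hx ⟨has.trans hxI.1, hxI.2.trans htb⟩
  have hstart : calib l (η a) = 0 := by rw [ha, calib_one]
  have hrR : r = R := by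
    have h1 := length_of_speed_eq hab.le hr
    have h2 := hsub a b le_rfl hab.le le_rfl
    rw [hend, hstart, sub_zero] at h2
    rw [h1] at hlen
    exact le_antisymm (le_of_mul_le_mul_right hlen hT) (le_of_mul_le_mul_right h2 hT)
  rw [hrR] at hsub hr
  -- The calibration inequality is an equality over the whole interval, hence over `[a, t]` and `[t,
  -- b]` separately.
  have hcal : ∀ t ∈ Icc a b, calib l (η t) = R * (t - a) := by
    intro t ht
    have h1 := hsub a t le_rfl ht.1 ht.2
    have h2 := hsub t b ht.1 ht.2 le_rfl
    rw [hstart] at h1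
    rw [hend] at h2
    linarith
  set A : ℝ → ℝ := fun x => √(1 + (1 - l ^ 2) * x ^ 2) with hA
  -- The curve meets `w = 0` only in a null set of times, since the derivative of `calib l` would
  -- vanish there instead of being `R`. Elsewhere the equality case fixes the velocity.
  have hae : ∀ᵐ t, t ∈ Icc a b → (η t).2 ≠ 0 ∧ ∃ v ∈ distribution (η t), HasDerivAt η v t ∧
      v.2 = (η t).2 * (R * (A ‖(η t).2‖ / ‖(η t).2‖ : ℝ) - Complex.I * (l * R : ℝ)) := by
    filter_upwards [hη.1.2, hr, ae_mem_Ioo_of_mem_Icc a b] with t h1 h2 h3 ht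
    obtain ⟨v, hv, hd⟩ := h1 ht
    have hf : HasDerivAt (fun s => calib l (η s)) R t := by
      have h4 : HasDerivAt (fun s => R * (s - a)) R t := by
        simpa using ((hasDerivAt_id t).sub_const a).const_mul R
      refine h4.congr_of_eventuallyEq ?_
      filter_upwards [Icc_mem_nhds (h3 ht).1 (h3 ht).2] with s hs using hcal s hs
    have h0 : (η t).2 ≠ 0 := fun h0 => hR.ne' (hasDerivAt_calib_of_eq_zero hd hv h0 hf)
    refine ⟨h0, v, hv, hd, ?_⟩
    have h5 := eq_of_deriv_calib_eq hd hv (hdom t ht).le h0 (by rw [h2 ht]; exact hf)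
    rwa [h2 ht] at h5
  -- the radial coordinate
  have hwc : ContinuousOn (fun t => (η t).2) (Icc a b) := by
    have := hη.1.ac_snd.continuousOn
    rwa [uIcc_of_le hab.le] at this
  have hAc : Continuous A := by fun_prop
  have hρac : AbsolutelyContinuousOnInterval (fun t => ‖(η t).2‖) a b :=
    (lipschitzWith_one_norm.lipschitzOnWith (s := univ)).comp_absolutelyContinuousOnInterval
      hη.1.ac_snd fun _ _ => mem_univ _
  have hρ : ∀ t ∈ Ioo a b, HasDerivAt (fun t => ‖(η t).2‖) (R * A ‖(η t).2‖) t := by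
    intro t ht
    refine hρac.hasDerivAt_of_ae (g := fun t => R * A ‖(η t).2‖) ?_ ?_ ht
    · exact continuousOn_const.mul (hAc.comp_continuousOn hwc.norm)
    · filter_upwards [hae] with s hs hsI
      obtain ⟨h0, v, hv, hd, h1⟩ := hs hsI
      have hd2 : HasDerivAt (fun t => (η t).2) v.2 s := hd.snd
      refine (hasDerivAt_norm_of_ne hd2 h0).congr_deriv ?_
      have e2 : star (η s).2 * (η s).2 = ((‖(η s).2‖ ^ 2 : ℝ) : ℂ) := by
        rw [mul_comm, Complex.star_def, Complex.mul_conj, Complex.normSq_eq_norm_sq]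
      have hr0 : ‖(η s).2‖ ≠ 0 := norm_ne_zero_iff.2 h0
      rw [h1, ← mul_assoc, e2, Complex.re_ofReal_mul]
      simp only [Complex.sub_re, Complex.re_ofReal_mul, Complex.ofReal_re, Complex.I_mul_re,
        Complex.ofReal_im, neg_zero, sub_zero]
      field_simp
  set σ := R ^ 2 - m ^ 2 with hσ
  have hσl : R ^ 2 * (1 - l ^ 2) = σ := by rw [hl, hσ]; field_simp
  -- The pair of `ρ = ‖w‖` and `R A(ρ)` solves the linear system `y' = z`, `z' = σ y`. It is
  -- identified through its Wronskians with `S σ` and `C σ`, which are the constants in `hD1` and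
  -- `hD2`.
  have hAd : ∀ t ∈ Ioo a b, HasDerivAt (fun t => R * A ‖(η t).2‖) (σ * ‖(η t).2‖) t := by
    intro t ht
    have hpos : 0 < 1 + (1 - l ^ 2) * ‖(η t).2‖ ^ 2 := by linarith [hdom t ⟨ht.1.le, ht.2.le⟩]
    have h1 := (((((hρ t ht).pow 2).const_mul (1 - l ^ 2)).const_add 1).sqrt hpos.ne').const_mul R
    refine h1.congr_deriv ?_
    have hA0 : 0 < A ‖(η t).2‖ := Real.sqrt_pos.2 hpos
    rw [← hσl]
    change R * (_ / (2 * A ‖(η t).2‖)) = _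
    field_simp
    push_cast
    ring
  have hAcont : ContinuousOn (fun t => R * A ‖(η t).2‖) (Icc a b) :=
    continuousOn_const.mul (hAc.comp_continuousOn hwc.norm)
  have hSd : ∀ t, HasDerivAt (fun t => S σ (t - a)) (C σ (t - a)) t := fun t =>
    (hasDerivAt_S σ (t - a)).comp_sub_const t a
  have hCd : ∀ t, HasDerivAt (fun t => C σ (t - a)) (σ * S σ (t - a)) t := fun t =>
    (hasDerivAt_C σ (t - a)).comp_sub_const t a
  have hSc : Continuous fun t => S σ (t - a) := continuous_iff_continuousAt.2 fun t => (hSd t).continuousAt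
  have hCc : Continuous fun t => C σ (t - a) := continuous_iff_continuousAt.2 fun t => (hCd t).continuousAt
  have const_of : ∀ f : ℝ → ℝ, ContinuousOn f (Icc a b) → (∀ t ∈ Ioo a b, HasDerivAt f 0 t) →
      ∀ t ∈ Icc a b, f t = f a := by
    intro f hf hd t ht
    rcases ht.1.eq_or_lt with rfl | hat
    · rfl
    obtain ⟨c, hc, h⟩ := exists_hasDerivAt_eq_slope f (fun _ => 0) hat
      (hf.mono (Icc_subset_Icc_right ht.2)) fun x hx => hd x ⟨hx.1, hx.2.trans_le ht.2⟩
    rw [eq_comm, div_eq_zero_iff] at h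
    rcases h with h | h
    · linarith
    · linarith
  have hη0 : (η a).2 = 0 := by rw [ha]; rfl
  have hD1 : ∀ t ∈ Icc a b, ‖(η t).2‖ * C σ (t - a) - R * A ‖(η t).2‖ * S σ (t - a) = 0 := by
    intro t ht
    rw [const_of (fun t => ‖(η t).2‖ * C σ (t - a) - R * A ‖(η t).2‖ * S σ (t - a)) ?_ ?_ t ht]
    · simp [hη0, S_zero]
    · exact (hwc.norm.mul hCc.continuousOn).sub (hAcont.mul hSc.continuousOn)
    · intro s hs
      refine (((hρ s hs).mul (hCd s)).sub ((hAd s hs).mul (hSd s))).congr_deriv ?_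
      ring
  have hD2 : ∀ t ∈ Icc a b, R * A ‖(η t).2‖ * C σ (t - a) - σ * ‖(η t).2‖ * S σ (t - a) = R := by
    intro t ht
    rw [const_of (fun t => R * A ‖(η t).2‖ * C σ (t - a) - σ * ‖(η t).2‖ * S σ (t - a)) ?_ ?_ t ht]
    · simp [hη0, S_zero, C_zero, hA]
    · exact (hAcont.mul hCc.continuousOn).sub
        ((continuousOn_const.mul hwc.norm).mul hSc.continuousOn)
    · intro s hs
      refine (((hAd s hs).mul (hCd s)).sub (((hρ s hs).const_mul σ).mul (hSd s))).congr_deriv ?_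
      ring
  have hρS : ∀ t ∈ Icc a b, ‖(η t).2‖ = R * S σ (t - a) := by
    intro t ht
    linear_combination (-‖(η t).2‖) * C_sq_sub σ (t - a) + C σ (t - a) * hD1 t ht +
      S σ (t - a) * hD2 t ht
  have hρA : ∀ t ∈ Icc a b, A ‖(η t).2‖ = C σ (t - a) := by
    intro t ht
    have : R * A ‖(η t).2‖ = R * C σ (t - a) := by
      linear_combination (-(R * A ‖(η t).2‖)) * C_sq_sub σ (t - a) + C σ (t - a) * hD2 t ht +
        σ * S σ (t - a) * hD1 t ht
    exact mul_left_cancel₀ hR.ne' this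
  have hSpos : ∀ t ∈ Ioc a b, 0 < S σ (t - a) := fun t ht =>
    S_pos_of_le (R := R) (sub_pos.2 ht.1) (sub_le_sub_right ht.2 a) hm.le
  -- the direction
  have hwd : ∀ t ∈ Ioo a b, HasDerivAt (fun t => (η t).2)
      ((η t).2 * ((C σ (t - a) / S σ (t - a) : ℝ) + Complex.I * m)) t := by
    intro t ht
    -- The quotient `C / S` has a pole at the initial time, so the almost everywhere equation is
    -- upgraded only on `[c, b]` with `c > a`.
    obtain ⟨c, hac, hct⟩ := exists_between ht.1
    have hcb : c ≤ b := (hct.trans ht.2).le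
    refine AbsolutelyContinuousOnInterval.hasDerivAt_of_ae (a := c) (b := b)
      (f := fun t => (η t).2)
      (g := fun t => (η t).2 * ((C σ (t - a) / S σ (t - a) : ℝ) + Complex.I * m))
      (hη.1.mono hac.le hcb le_rfl).ac_snd ?_ ?_ ⟨hct, ht.2⟩
    · refine (hwc.mono (Icc_subset_Icc_left hac.le)).mul (ContinuousOn.add ?_ continuousOn_const)
      refine Complex.continuous_ofReal.comp_continuousOn ?_
      exact hCc.continuousOn.div hSc.continuousOn fun s hs => (hSpos s ⟨hac.trans_le hs.1, hs.2⟩).ne'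
    · filter_upwards [hae] with s hs hsI
      have hsI' : s ∈ Icc a b := ⟨hac.le.trans hsI.1, hsI.2⟩
      obtain ⟨h0, v, hv, hd, h1⟩ := hs hsI'
      have hd2 : HasDerivAt (fun s => (η s).2) v.2 s := hd.snd
      refine hd2.congr_deriv ?_
      have hS0 := (hSpos s ⟨hac.trans_le hsI.1, hsI.2⟩).ne'
      rw [h1, hρA s hsI', hρS s hsI', hl]
      congr 1
      have hRC : (R : ℂ) ≠ 0 := by exact_mod_cast hR.ne'
      have hSC : (S σ (s - a) : ℂ) ≠ 0 := by exact_mod_cast hS0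
      push_cast
      field_simp
      ring
  have hqd : ∀ t ∈ Ioo a b, HasDerivAt (fun t => (η t).2 *
      Complex.exp (-(Complex.I * (m * (t - a) : ℝ))) / (S σ (t - a) : ℂ)) 0 t := by
    intro t ht
    have hSC : (S σ (t - a) : ℂ) ≠ 0 := by exact_mod_cast (hSpos t ⟨ht.1, ht.2.le⟩).ne'
    have h3 : HasDerivAt (fun t : ℝ => m * (t - a)) m t := by
      simpa using ((hasDerivAt_id t).sub_const a).const_mul m
    have h4 := ((h3.ofReal_comp.const_mul Complex.I).fun_neg).cexp
    refine (((hwd t ht).mul h4).div (hSd t).ofReal_comp hSC).congr_deriv ?_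
    rw [div_eq_zero_iff]
    left
    push_cast
    field_simp
    simp only [Pi.mul_apply]
    ring
  -- This quotient is constant, and its value is read off at the end time `b`, where the curve meets
  -- the given arc.
  have hq : ∀ t ∈ Ioc a b, (η t).2 * Complex.exp (-(Complex.I * (m * (t - a) : ℝ))) /
      (S σ (t - a) : ℂ) = β := by
    intro t ht
    have hcont : ContinuousOn (fun t => (η t).2 *
        Complex.exp (-(Complex.I * (m * (t - a) : ℝ))) / (S σ (t - a) : ℂ)) (Icc t b) := by
      refine ((hwc.mono (Icc_subset_Icc_left ht.1.le)).mul (by fun_prop)).div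
        (Complex.continuous_ofReal.comp_continuousOn hSc.continuousOn) fun s hs => ?_
      exact_mod_cast (hSpos s ⟨ht.1.trans_le hs.1, hs.2⟩).ne'
    have h1 : ∀ s ∈ Icc t b, (η s).2 * Complex.exp (-(Complex.I * (m * (s - a) : ℝ))) /
        (S σ (s - a) : ℂ) = (η t).2 * Complex.exp (-(Complex.I * (m * (t - a) : ℝ))) /
        (S σ (t - a) : ℂ) :=
      constant_of_has_deriv_right_zero hcont fun s hs =>
        (hqd s ⟨ht.1.trans_le hs.1, hs.2⟩).hasDerivWithinAt
    rw [← h1 b ⟨ht.2, le_rfl⟩, hb, arc]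
    simp only
    rw [← hRdef, ← hσ]
    have hSC : (S σ (b - a) : ℂ) ≠ 0 := by exact_mod_cast (hSpos b ⟨hab, le_rfl⟩).ne'
    have hE := exp_mul_exp_neg (m * (b - a))
    field_simp
    linear_combination hE
  have hsnd : ∀ t ∈ Icc a b, (η t).2 = (arc β m (t - a)).2 := by
    intro t ht
    rcases ht.1.eq_or_lt with rfl | hat
    · rw [sub_self, arc_zero, ha]
    · have hSC : (S σ (t - a) : ℂ) ≠ 0 := by exact_mod_cast (hSpos t ⟨hat, ht.2⟩).ne'
      have hE := exp_mul_exp_neg (m * (t - a))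
      rw [arc]
      simp only
      rw [← hRdef, ← hσ, ← hq t ⟨hat, ht.2⟩]
      field_simp
      linear_combination (-(η t).2) * hE
  intro t ht
  refine Prod.ext ?_ (hsnd t ht)
  obtain ⟨c, hc⟩ := (hη.1.ac_fst.sub (isHorizontal_arc_sub β m a a b).ac_fst).const_of_ae_hasDerivAt_zero (by
    filter_upwards [hη.1.2, ae_mem_Ioo_of_mem_Icc a b] with s h1 h2 hs
    rw [uIcc_of_le hab.le] at hs
    obtain ⟨v, hv, hd⟩ := h1 hs
    have h3 : HasDerivAt (fun s => (η s).2) v.2 s := hd.snd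
    have h4 : HasDerivAt (fun s => (η s).1) v.1 s := hd.fst
    have hd' := (hasDerivAt_arc β m (s - a)).comp_sub_const s a
    have h5 : HasDerivAt (fun s => (arc β m (s - a)).2) (arcVel β m (s - a)).2 s := hd'.snd
    have h6 : HasDerivAt (fun s => (arc β m (s - a)).1) (arcVel β m (s - a)).1 s := hd'.fst
    have h7 : v.2 = (arcVel β m (s - a)).2 := by
      refine h3.unique (h5.congr_of_eventuallyEq ?_)
      filter_upwards [Icc_mem_nhds (h2 hs).1 (h2 hs).2] with x hx using hsnd x hx
    have h8 := mem_distribution_iff.1 hv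
    have h9 := mem_distribution_iff.1 (arcVel_mem β m (s - a))
    rw [hsnd s hs, h7, ← h9] at h8
    refine (h4.sub h6).congr_deriv ?_
    rw [mul_left_cancel₀ (one_add_sq_pos _).ne' h8, sub_self])
  rw [uIcc_of_le hab.le] at hc
  have h1 := hc t ht
  have h2 := hc a ⟨le_rfl, hab.le⟩
  simp only [Pi.sub_apply, sub_self, arc_zero, ha] at h1 h2
  linarith

end CSU

namespace CSU

/-! ### End points of extremal arcs -/

theorem continuous_S_one : Continuous fun σ => S σ 1 := by
  have h1 : Continuous (dslope Real.sinh 0) := by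
    rw [← continuousOn_univ, continuousOn_dslope univ_mem]
    exact ⟨Real.continuous_sinh.continuousOn, Real.differentiable_sinh 0⟩
  have h2 : (fun σ => S σ 1) = fun σ => if 0 ≤ σ then dslope Real.sinh 0 (√σ) else
      Real.sinc (√(-σ)) := by
    funext σ
    rcases lt_trichotomy σ 0 with h | rfl | h
    · have hs : √(-σ) ≠ 0 := (Real.sqrt_pos.2 (by linarith)).ne'
      rw [if_neg h.not_ge, S_of_neg h, mul_one, Real.sinc_of_ne_zero hs]
    · simp [S_zero_left]
    · have hs : √σ ≠ 0 := (Real.sqrt_pos.2 h).ne'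
      rw [if_pos h.le, S_of_pos h, mul_one, dslope_of_ne _ hs, slope_def_field]
      simp
  rw [h2]
  refine Continuous.if_le (h1.comp Real.continuous_sqrt)
    (Real.continuous_sinc.comp (Real.continuous_sqrt.comp continuous_neg)) continuous_const
    continuous_id ?_
  rintro σ rfl
  simp

theorem continuous_C_one : Continuous fun σ => C σ 1 := by
  have h2 : (fun σ => C σ 1) = fun σ => if 0 ≤ σ then Real.cosh (√σ) else Real.cos (√(-σ)) := by
    funext σ
    rcases lt_trichotomy σ 0 with h | rfl | h
    · rw [if_neg h.not_ge, C_of_neg h, mul_one]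
    · simp [C_zero_left]
    · rw [if_pos h.le, C_of_pos h, mul_one]
  rw [h2]
  refine Continuous.if_le (Real.continuous_cosh.comp Real.continuous_sqrt)
    (Real.continuous_cos.comp (Real.continuous_sqrt.comp continuous_neg)) continuous_const
    continuous_id ?_
  rintro σ rfl
  simp

/-- The continuous argument of `C + i m S` along an arc. -/
def arcArg (b : ℂ) (m t : ℝ) : ℝ := (arc b m t).1 + m * t

theorem arcArg_zero (b : ℂ) (m : ℝ) : arcArg b m 0 = 0 := by simp [arcArg, arc_zero, one]

theorem hasDerivAt_arcArg (b : ℂ) (m t : ℝ) :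
    HasDerivAt (arcArg b m) (m / (1 + ‖(arc b m t).2‖ ^ 2)) t := by
  have h1 : HasDerivAt (fun s => (arc b m s).1) (arcVel b m t).1 t := (hasDerivAt_arc b m t).fst
  refine (h1.add ((hasDerivAt_id t).const_mul m)).congr_deriv ?_
  rw [arcVel, norm_arc_snd_sq]
  have : 0 < 1 + ‖b‖ ^ 2 * S (‖b‖ ^ 2 - m ^ 2) t ^ 2 := by positivity
  field_simp
  ring

theorem continuous_arcArg (b : ℂ) (m : ℝ) : Continuous (arcArg b m) :=
  continuous_iff_continuousAt.2 fun t => (hasDerivAt_arcArg b m t).continuousAt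

theorem exp_arcArg (b : ℂ) (m t : ℝ) :
    (√(1 + ‖(arc b m t).2‖ ^ 2) : ℝ) * Complex.exp (Complex.I * arcArg b m t) =
      C (‖b‖ ^ 2 - m ^ 2) t + Complex.I * (m * S (‖b‖ ^ 2 - m ^ 2) t : ℝ) := by
  have h := Z_arc b m t
  rw [Z] at h
  have h1 : Complex.exp (Complex.I * arcArg b m t) =
      Complex.exp (Complex.I * (arc b m t).1) * Complex.exp (Complex.I * (m * t : ℝ)) := by
    rw [← Complex.exp_add, arcArg]; push_cast; ring_nf
  rw [h1, ← mul_assoc, h]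
  linear_combination (C (‖b‖ ^ 2 - m ^ 2) t + Complex.I * (m * S (‖b‖ ^ 2 - m ^ 2) t : ℝ)) *
    exp_mul_exp_neg (m * t)

theorem cos_arcArg (b : ℂ) (m t : ℝ) :
    √(1 + ‖(arc b m t).2‖ ^ 2) * Real.cos (arcArg b m t) = C (‖b‖ ^ 2 - m ^ 2) t := by
  have h := congrArg Complex.re (exp_arcArg b m t)
  rw [Complex.re_ofReal_mul, mul_comm Complex.I, Complex.exp_ofReal_mul_I_re] at h
  simpa using h

theorem sin_arcArg (b : ℂ) (m t : ℝ) :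
    √(1 + ‖(arc b m t).2‖ ^ 2) * Real.sin (arcArg b m t) = m * S (‖b‖ ^ 2 - m ^ 2) t := by
  have h := congrArg Complex.im (exp_arcArg b m t)
  rw [Complex.im_ofReal_mul, mul_comm Complex.I, Complex.exp_ofReal_mul_I_im] at h
  simpa using h

theorem sqrt_one_add_pos (w : ℂ) : 0 < √(1 + ‖w‖ ^ 2) := Real.sqrt_pos.2 (one_add_sq_pos w)

theorem arcArg_nonneg {b : ℂ} {m t : ℝ} (hm : 0 ≤ m) (ht : 0 ≤ t) : 0 ≤ arcArg b m t := by
  rw [← arcArg_zero b m]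
  refine monotone_of_deriv_nonneg (fun t => (hasDerivAt_arcArg b m t).differentiableAt)
    (fun t => ?_) ht
  rw [(hasDerivAt_arcArg b m t).deriv]
  positivity

/-- At a time where the argument equals `π` its sine vanishes. That sine is a positive multiple of
`m * S`, which is positive before the first positive zero of `S` when `m > 0`. -/
theorem arcArg_le_pi {b : ℂ} {m t : ℝ} (hm : 0 ≤ m) (ht : 0 ≤ t)
    (hσ : -(‖b‖ ^ 2 - m ^ 2) * t ^ 2 < Real.pi ^ 2) : arcArg b m t ≤ Real.pi := by
  rcases hm.eq_or_lt with rfl | hm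
  · simp [arcArg, arc, Real.pi_pos.le]
  by_contra! h
  obtain ⟨s, hs, hsπ⟩ := intermediate_value_Icc ht (continuous_arcArg b m).continuousOn
    (show Real.pi ∈ Icc (arcArg b m 0) (arcArg b m t) by
      rw [arcArg_zero]; exact ⟨Real.pi_pos.le, h.le⟩)
  have h1 := sin_arcArg b m s
  rw [hsπ, Real.sin_pi, mul_zero] at h1
  have hs0 : 0 < s := by
    rcases hs.1.eq_or_lt with rfl | h0
    · rw [arcArg_zero] at hsπ; exact absurd hsπ Real.pi_pos.ne
    · exact h0
  have hS : 0 < S (‖b‖ ^ 2 - m ^ 2) s := by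
    refine S_pos hs0 ?_
    rcases le_or_gt 0 (‖b‖ ^ 2 - m ^ 2) with h2 | h2
    · nlinarith [Real.pi_pos, mul_nonneg h2 (sq_nonneg s), sq_pos_of_pos Real.pi_pos]
    · refine lt_of_le_of_lt ?_ hσ
      have := hs.2
      have : 0 ≤ -(‖b‖ ^ 2 - m ^ 2) := by linarith
      gcongr
  have := mul_pos hm hS
  linarith

/-- The first coordinate of the end point of an arc of less than a full turn. -/
theorem arc_fst_eq_arccos {b : ℂ} {m : ℝ} (hm : 0 ≤ m) (hσ : -(‖b‖ ^ 2 - m ^ 2) < Real.pi ^ 2) :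
    (arc b m 1).1 = Real.arccos (C (‖b‖ ^ 2 - m ^ 2) 1 / √(1 + ‖(arc b m 1).2‖ ^ 2)) - m := by
  have h1 := arcArg_nonneg (b := b) hm zero_le_one
  have h2 := arcArg_le_pi (b := b) hm zero_le_one (by simpa using hσ)
  rw [← cos_arcArg, mul_div_cancel_left₀ _ (sqrt_one_add_pos _).ne', Real.arccos_cos h1 h2, arcArg]
  ring

/-- The control of the arc with parameters `σ`, `m` that ends over `w`. -/
def control (σ m : ℝ) (w : ℂ) : ℂ := w / (Complex.exp (Complex.I * m) * S σ 1)

theorem norm_control {σ m : ℝ} {w : ℂ} : ‖control σ m w‖ = ‖w‖ / |S σ 1| := by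
  rw [control, norm_div, norm_mul, norm_exp_I_mul, one_mul, Complex.norm_real, Real.norm_eq_abs]

/-- The square of the rotation parameter of an arc, in terms of `σ` and of the end point. -/
theorem arc_control_snd {σ m : ℝ} {w : ℂ} (hS : S σ 1 ≠ 0)
    (hm : m ^ 2 = ‖w‖ ^ 2 / S σ 1 ^ 2 - σ) :
    ‖control σ m w‖ ^ 2 - m ^ 2 = σ ∧ (arc (control σ m w) m 1).2 = w := by
  have h1 : ‖control σ m w‖ ^ 2 - m ^ 2 = σ := by
    rw [norm_control, div_pow, sq_abs, hm]; ring
  refine ⟨h1, ?_⟩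
  rw [arc]
  simp only
  rw [h1, control, mul_one]
  have hSC : (S σ 1 : ℂ) ≠ 0 := by exact_mod_cast hS
  have := Complex.exp_ne_zero (Complex.I * m)
  field_simp

/-- The height `|c|` of the end point over `w`, `‖w‖ = r`, of an arc of less than a full turn. -/
def height (r σ : ℝ) : ℝ := √(r ^ 2 / S σ 1 ^ 2 - σ) - Real.arccos (C σ 1 / √(1 + r ^ 2))

theorem S_one_pos {σ : ℝ} (h : -Real.pi ^ 2 < σ) : 0 < S σ 1 := S_pos one_pos (by linarith)

theorem continuousOn_height (r : ℝ) : ContinuousOn (height r) (Ioi (-Real.pi ^ 2)) := by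
  have h1 := continuous_S_one
  have h2 := continuous_C_one
  refine ContinuousOn.sub (ContinuousOn.sqrt (ContinuousOn.sub (ContinuousOn.div continuousOn_const
    (h1.pow 2).continuousOn fun σ hσ => ?_) continuousOn_id)) ?_
  · have := S_one_pos hσ
    positivity
  · exact (Real.continuous_arccos.comp (h2.div_const _)).continuousOn

theorem arc_control_eq {σ : ℝ} {w : ℂ} (hσ : -Real.pi ^ 2 < σ)
    (hm : 0 ≤ ‖w‖ ^ 2 / S σ 1 ^ 2 - σ) :
    arc (control σ (√(‖w‖ ^ 2 / S σ 1 ^ 2 - σ)) w) (√(‖w‖ ^ 2 / S σ 1 ^ 2 - σ)) 1 =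
      (-height ‖w‖ σ, w) := by
  obtain ⟨h1, h2⟩ := arc_control_snd (S_one_pos hσ).ne' (Real.sq_sqrt hm)
  refine Prod.ext ?_ h2
  rw [arc_fst_eq_arccos (Real.sqrt_nonneg _) (by rw [h1]; linarith), h1, h2, height]
  ring

theorem S_arsinh_sq {r : ℝ} (hr : 0 < r) : S (Real.arsinh r ^ 2) 1 = r / Real.arsinh r := by
  have h := Real.arsinh_pos_iff.2 hr
  rw [S_of_pos (by positivity), Real.sqrt_sq h.le, mul_one, Real.sinh_arsinh]

/-- The value `σ = arsinh² r` corresponds to `m = 0`, the straight segment in the horizontal plane.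
-/
theorem sq_div_S_arsinh_sq {r : ℝ} (hr : 0 < r) :
    r ^ 2 / S (Real.arsinh r ^ 2) 1 ^ 2 - Real.arsinh r ^ 2 = 0 := by
  have h := Real.arsinh_pos_iff.2 hr
  rw [S_arsinh_sq hr]; field_simp; ring

theorem height_arsinh_sq {r : ℝ} (hr : 0 < r) : height r (Real.arsinh r ^ 2) = 0 := by
  have h := Real.arsinh_pos_iff.2 hr
  rw [height, sq_div_S_arsinh_sq hr, C_of_pos (by positivity), Real.sqrt_sq h.le, mul_one,
    Real.cosh_arsinh, div_self (Real.sqrt_pos.2 (by positivity)).ne']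
  simp

theorem one_le_S_one {σ : ℝ} (h : 0 ≤ σ) : 1 ≤ S σ 1 := by
  rcases h.eq_or_lt with rfl | h
  · simp [S_zero_left]
  · have hs := Real.sqrt_pos.2 h
    rw [S_of_pos h, mul_one, one_le_div hs]
    exact (Real.self_lt_sinh_iff.2 hs).le

/-- The parameter `m ^ 2` is nonnegative up to the parameter of the straight segment. -/
theorem sq_div_sub_pos {r σ : ℝ} (hr : 0 < r) (hσ : -Real.pi ^ 2 < σ)
    (h : σ < Real.arsinh r ^ 2) : 0 < r ^ 2 / S σ 1 ^ 2 - σ := by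
  have hS := S_one_pos hσ
  rcases le_or_gt σ 0 with h0 | h0
  · have : 0 < r ^ 2 / S σ 1 ^ 2 := by positivity
    linarith
  · have hs := Real.sqrt_pos.2 h0
    have h1 : √σ < Real.arsinh r := (Real.sqrt_lt' (Real.arsinh_pos_iff.2 hr)).2 h
    have h2 : Real.sinh √σ < r := by
      have := Real.sinh_lt_sinh.2 h1
      rwa [Real.sinh_arsinh] at this
    have h3 := Real.sinh_pos_iff.2 hs
    rw [S_of_pos h0, mul_one, div_pow, Real.sq_sqrt h0.le, sub_pos, div_div_eq_mul_div,
      lt_div_iff₀ (by positivity), mul_comm]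
    gcongr

/-! ### A neighbourhood of short extremal arcs -/

/-- A set of end points of short extremal arcs. -/
def region : Set CSU := {g | ‖g.2‖ < 1 / 2 ∧ |g.1| < height ‖g.2‖ (-(Real.pi / 4) ^ 2)}

theorem S_neg_sq {x : ℝ} (hx : 0 < x) : S (-x ^ 2) 1 = Real.sin x / x := by
  rw [S_of_neg (by nlinarith [sq_pos_of_pos hx]), neg_neg, Real.sqrt_sq hx.le, mul_one]

theorem C_neg_sq {x : ℝ} (hx : 0 < x) : C (-x ^ 2) 1 = Real.cos x := by
  rw [C_of_neg (by nlinarith [sq_pos_of_pos hx]), neg_neg, Real.sqrt_sq hx.le, mul_one]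

/-- The angle `π / 4` has equal sine and cosine, which gives a form that is visibly continuous in
`r`. It vanishes at `r = 0`, so `region` contains no point with `w = 0`. -/
theorem height_pi_div_four (r : ℝ) : height r (-(Real.pi / 4) ^ 2) =
    Real.pi / 4 * √(1 + 2 * r ^ 2) - Real.arctan (√(1 + 2 * r ^ 2)) := by
  have hpi := Real.pi_pos
  have h2 : √2 ^ 2 = (2 : ℝ) := Real.sq_sqrt (by norm_num)
  have hr : 0 < 1 + r ^ 2 := by positivity
  rw [height, S_neg_sq (by positivity), C_neg_sq (by positivity), Real.sin_pi_div_four,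
    Real.cos_pi_div_four]
  congr 1
  · have e : r ^ 2 / (√2 / 2 / (Real.pi / 4)) ^ 2 - -(Real.pi / 4) ^ 2 =
        (Real.pi / 4) ^ 2 * (1 + 2 * r ^ 2) := by
      have : (√2 / 2 / (Real.pi / 4)) ^ 2 = 8 / Real.pi ^ 2 := by
        rw [div_pow, div_pow, h2]; field_simp; norm_num
      rw [this]; field_simp; ring
    rw [e, Real.sqrt_mul (by positivity), Real.sqrt_sq (by positivity)]
  · have hN : √(1 + r ^ 2) ^ 2 = 1 + r ^ 2 := Real.sq_sqrt hr.le
    have hN0 : 0 < √(1 + r ^ 2) := Real.sqrt_pos.2 hr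
    rw [Real.arccos_eq_arctan (by positivity)]
    congr 1
    rw [div_eq_iff (by positivity)]
    have e : 1 - (√2 / 2 / √(1 + r ^ 2)) ^ 2 = (1 + 2 * r ^ 2) * (√2 / 2 / √(1 + r ^ 2)) ^ 2 := by
      rw [div_pow, div_pow, h2, hN]; field_simp; ring
    rw [e, Real.sqrt_mul (by positivity), Real.sqrt_sq (by positivity)]

theorem isOpen_region : IsOpen region := by
  simp only [region, height_pi_div_four]
  have h : Continuous fun g : CSU => √(1 + 2 * ‖g.2‖ ^ 2) := by fun_prop
  exact (isOpen_lt (f := fun g : CSU => ‖g.2‖) (by fun_prop) continuous_const).inter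
    (isOpen_lt (f := fun g : CSU => |g.1|) (by fun_prop)
      ((continuous_const.mul h).sub (Real.continuous_arctan.comp h)))

/-- The right side is the tangent line at `s = 1`; beyond this point the derivative of `arctan` is
at most `1 / 2`. -/
theorem arctan_le_half {s : ℝ} (hs : 1 ≤ s) : Real.arctan s ≤ Real.pi / 4 + (s - 1) / 2 := by
  have hd : ∀ x : ℝ, HasDerivAt (fun x => x / 2 - Real.arctan x) (1 / 2 - 1 / (1 + x ^ 2)) x :=
    fun x => ((hasDerivAt_id x).div_const 2).sub (Real.hasDerivAt_arctan x)
  have h := monotoneOn_of_deriv_nonneg (convex_Ici (1 : ℝ))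
    (f := fun x => x / 2 - Real.arctan x)
    (fun x _ => (hd x).continuousAt.continuousWithinAt)
    (fun x _ => (hd x).differentiableAt.differentiableWithinAt) (fun x hx => by
      rw [interior_Ici, mem_Ioi] at hx
      rw [(hd x).deriv, sub_nonneg]
      exact one_div_le_one_div_of_le (by norm_num) (by nlinarith))
    (self_mem_Ici) (mem_Ici.2 hs) hs
  simp only [Real.arctan_one] at h
  linarith

/-- With `s = √(1 + 2 r²)` the bounding height is at least `(π / 4 - 1 / 2) (s - 1)`, and `s - 1 ≥ 8
r² / 9`. As `π > 3`, this is at least `2 r² / 9`, which exceeds `r² / 5`. -/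
theorem mem_region_of_le {g : CSU} (h0 : g.2 ≠ 0) (h1 : ‖g.2‖ < 1 / 2)
    (h2 : |g.1| ≤ ‖g.2‖ ^ 2 / 5) : g ∈ region := by
  refine ⟨h1, h2.trans_lt ?_⟩
  have hr : 0 < ‖g.2‖ := norm_pos_iff.2 h0
  rw [height_pi_div_four]
  set r := ‖g.2‖
  have hs : √(1 + 2 * r ^ 2) ^ 2 = 1 + 2 * r ^ 2 := Real.sq_sqrt (by positivity)
  have hs1 : 1 ≤ √(1 + 2 * r ^ 2) := Real.one_le_sqrt.2 (by nlinarith)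
  have hs2 : √(1 + 2 * r ^ 2) ≤ 1.25 := Real.sqrt_le_iff.2 ⟨by norm_num, by nlinarith⟩
  have h3 := arctan_le_half hs1
  set s := √(1 + 2 * r ^ 2)
  have hpi := Real.pi_gt_three
  have h4 : 8 * r ^ 2 / 9 ≤ s - 1 := by nlinarith
  nlinarith [mul_nonneg (by linarith : 0 ≤ Real.pi - 3) (by linarith : 0 ≤ s - 1),
    sq_pos_of_pos hr]

/-- The height is continuous in `σ`, vanishes at the straight segment and exceeds `|c|` at `σ = -(π
/ 4)²`, so an intermediate `σ` reaches `g`. The lower bound on `σ` keeps `m` small. -/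
theorem exists_arc_of_mem_region {g : CSU} (hg : g ∈ region) :
    ∃ (b : ℂ) (m : ℝ), b ≠ 0 ∧ |m| < 1 ∧ arc b m 1 = g := by
  obtain ⟨h1, h2⟩ := hg
  have hpi := Real.pi_gt_three
  have hpi' := Real.pi_lt_d2
  have h0 : g.2 ≠ 0 := by
    intro h0
    rw [h0, height_pi_div_four] at h2
    simp at h2
    linarith [abs_nonneg g.1]
  have hr : 0 < ‖g.2‖ := norm_pos_iff.2 h0
  have key : ∀ w : ℂ, ‖w‖ = ‖g.2‖ → ∃ (b : ℂ) (m : ℝ), b ≠ 0 ∧ |m| < 1 ∧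
      arc b m 1 = (-|g.1|, w) := by
    intro w hw
    have hle : -(Real.pi / 4) ^ 2 ≤ Real.arsinh ‖w‖ ^ 2 := by
      nlinarith [sq_nonneg (Real.arsinh ‖w‖), sq_nonneg (Real.pi / 4)]
    have hlow : -Real.pi ^ 2 < -(Real.pi / 4) ^ 2 := by nlinarith
    rw [← hw] at h1 h2 hr
    obtain ⟨σ, hσ, hσh⟩ := intermediate_value_Icc' hle
      ((continuousOn_height ‖w‖).mono fun x hx => hlow.trans_le hx.1)
      (show |g.1| ∈ Icc (height ‖w‖ (Real.arsinh ‖w‖ ^ 2)) (height ‖w‖ (-(Real.pi / 4) ^ 2)) by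
        rw [height_arsinh_sq hr]
        exact ⟨abs_nonneg _, h2.le⟩)
    have hσ' := hlow.trans_le hσ.1
    have hS := S_one_pos hσ'
    have hS2 : (84 / 100 : ℝ) ≤ S σ 1 := by
      rcases le_or_gt 0 σ with h3 | h3
      · linarith [one_le_S_one h3]
      · obtain ⟨x, hx, rfl⟩ : ∃ x : ℝ, 0 < x ∧ σ = -x ^ 2 :=
          ⟨√(-σ), Real.sqrt_pos.2 (by linarith), by rw [Real.sq_sqrt (by linarith)]; ring⟩
        have hx1 : x ≤ Real.pi / 4 := by
          refine le_of_sq_le_sq ?_ (by positivity)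
          linarith [hσ.1]
        have hx2 : x ≤ 79 / 100 := by linarith
        have h4 := Real.sin_gt_sub_cube hx
        rw [S_neg_sq hx, le_div_iff₀ hx]
        nlinarith [mul_pos hx hx, mul_pos hx (mul_pos hx hx)]
    have hm0 : 0 ≤ ‖w‖ ^ 2 / S σ 1 ^ 2 - σ := by
      rcases hσ.2.eq_or_lt with h3 | h3
      · rw [h3, sq_div_S_arsinh_sq hr]
      · exact (sq_div_sub_pos hr hσ' h3).le
    -- From `‖w‖ < 1 / 2` and `S σ 1 ≥ 0.84` the quotient is at most `0.36`, and `-σ ≤ (π / 4)² <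
    -- 0.63`.
    have hm1 : ‖w‖ ^ 2 / S σ 1 ^ 2 - σ < 1 := by
      have h3 : ‖w‖ ^ 2 / S σ 1 ^ 2 ≤ 36 / 100 := by
        rw [div_le_iff₀ (by positivity)]
        nlinarith
      have : -σ ≤ 63 / 100 := by nlinarith [hσ.1]
      linarith
    refine ⟨_, √(‖w‖ ^ 2 / S σ 1 ^ 2 - σ), ?_, ?_, (arc_control_eq hσ' hm0).trans (by rw [hσh])⟩
    · rw [control]
      refine div_ne_zero (norm_pos_iff.1 hr) (mul_ne_zero (Complex.exp_ne_zero _) ?_)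
      exact_mod_cast hS.ne'
    · rw [abs_of_nonneg (Real.sqrt_nonneg _), Real.sqrt_lt' one_pos]
      linarith
  rcases le_total g.1 0 with hc | hc
  · obtain ⟨b, m, hb, hm, h⟩ := key g.2 rfl
    refine ⟨b, m, hb, hm, h.trans ?_⟩
    rw [abs_of_nonpos hc, neg_neg]
  · obtain ⟨b, m, hb, hm, h⟩ := key (star g.2) (norm_star _)
    refine ⟨star b, -m, star_ne_zero.2 hb, by rwa [abs_neg], ?_⟩
    rw [arc_conj, h, abs_of_nonneg hc, neg_neg, star_star]

end CSU

namespace CSU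

/-! ### Geodesics are extremal arcs -/

theorem mul_inv_self (g : CSU) : mul g (inv g) = one := by
  simpa [inv_inv'] using inv_mul_self (inv g)

theorem mul_right_cancel' {g h k : CSU} (e : mul g k = mul h k) : g = h := by
  have := congrArg (fun x => mul x (inv k)) e
  simpa [mul_assoc', mul_inv_self, mul_one'] using this

theorem continuous_mul : Continuous fun p : CSU × CSU => mul p.1 p.2 := by
  have hZ := contDiff_Z.continuous
  have h1 : Continuous fun p : CSU × CSU => 1 + p.1.2 * star p.2.2 / (Z p.1 * Z p.2) :=
    continuous_const.add ((by fun_prop : Continuous fun p : CSU × CSU => p.1.2 * star p.2.2).div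
      ((hZ.comp continuous_fst).mul (hZ.comp continuous_snd))
      fun p => mul_ne_zero (Z_ne_zero _) (Z_ne_zero _))
  have h2 : Continuous fun p : CSU × CSU =>
      Complex.arg (1 + p.1.2 * star p.2.2 / (Z p.1 * Z p.2)) :=
    continuous_iff_continuousAt.2 fun p => ContinuousAt.comp (x := p) (g := Complex.arg)
      (f := fun p : CSU × CSU => 1 + p.1.2 * star p.2.2 / (Z p.1 * Z p.2))
      (Complex.continuousAt_arg (Or.inl (re_pos_of_mul p.1 p.2))) h1.continuousAt
  have h3 : Continuous fun p : CSU × CSU => Z p.1 * p.2.2 + p.1.2 * star (Z p.2) :=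
    ((hZ.comp continuous_fst).mul (by fun_prop)).add
      ((by fun_prop : Continuous fun p : CSU × CSU => p.1.2).mul (hZ.comp continuous_snd).star)
  exact (((by fun_prop : Continuous fun p : CSU × CSU => p.1.1 + p.2.1)).add h2).prodMk h3

theorem continuous_inv : Continuous inv := by unfold inv; fun_prop

theorem continuous_arc (b : ℂ) (m : ℝ) : Continuous (arc b m) := (contDiff_arc b m).continuous

/-- The control of a translated arc. -/
theorem hasDerivAt_mul_arc_snd (g : CSU) (b : ℂ) (m t : ℝ) :
    HasDerivAt (fun s => (mul g (arc b m s)).2)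
      (b * Complex.exp (Complex.I * (2 * m * t : ℝ)) * Z (mul g (arc b m t))) t := by
  have hd := hasDerivAt_arc b m t
  have hw : HasDerivAt (fun s => (arc b m s).2) (arcVel b m t).2 t := hd.snd
  have hZ := hasDerivAt_Z hd
  have e1 : (arcVel b m t).2 = b * Complex.exp (Complex.I * (2 * m * t : ℝ)) * Z (arc b m t) := by
    rw [arcVel, Z_arc]
    have h2 : Complex.exp (Complex.I * (2 * m * t : ℝ)) = Complex.exp (Complex.I * (m * t : ℝ)) *
        Complex.exp (Complex.I * (m * t : ℝ)) := by rw [← Complex.exp_add]; push_cast; ring_nf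
    rw [h2]
    linear_combination (-(b * Complex.exp (Complex.I * (m * t : ℝ)) *
      (C (‖b‖ ^ 2 - m ^ 2) t + Complex.I * (m * S (‖b‖ ^ 2 - m ^ 2) t : ℝ)))) *
      exp_mul_exp_neg (m * t)
  obtain ⟨β, h1, h2⟩ := mem_distribution_iff_exists.1 (arcVel_mem b m t)
  have e2 : β = b * Complex.exp (Complex.I * (2 * m * t : ℝ)) :=
    mul_right_cancel₀ (Z_ne_zero _) (h1.symm.trans e1)
  rw [← e2]
  refine ((hw.const_mul (Z g)).add (hZ.star.const_mul g.2)).congr_deriv ?_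
  rw [Z_mul, h1, h2, star_mul', star_star]; ring

/-- The velocity determines the control `b * exp (2 i m x)`. Its logarithmic derivative gives `m`,
then its value gives `b`, and cancellation in the group gives `g`. -/
theorem mul_arc_injective {g g' : CSU} {b b' : ℂ} {m m' s t : ℝ} (hst : s < t) (hb : b ≠ 0)
    (h : ∀ x ∈ Ioo s t, mul g (arc b m x) = mul g' (arc b' m' x)) : g = g' ∧ b = b' ∧ m = m' := by
  have h1 : ∀ x ∈ Ioo s t, b * Complex.exp (Complex.I * (2 * m * x : ℝ)) =
      b' * Complex.exp (Complex.I * (2 * m' * x : ℝ)) := by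
    intro x hx
    have h2 := (hasDerivAt_mul_arc_snd g b m x).unique
      ((hasDerivAt_mul_arc_snd g' b' m' x).congr_of_eventuallyEq (by
        filter_upwards [Ioo_mem_nhds hx.1 hx.2] with y hy
        rw [h y hy]))
    rw [h x hx] at h2
    exact mul_right_cancel₀ (Z_ne_zero _) h2
  have hd : ∀ (b : ℂ) (m x : ℝ), HasDerivAt
      (fun x : ℝ => b * Complex.exp (Complex.I * (2 * m * x : ℝ)))
      (b * Complex.exp (Complex.I * (2 * m * x : ℝ)) * (2 * Complex.I * m)) x := by
    intro b m x
    have h3 : HasDerivAt (fun t : ℝ => 2 * m * t) (2 * m) x := by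
      simpa using (hasDerivAt_id x).const_mul (2 * m)
    refine (((h3.ofReal_comp.const_mul Complex.I).cexp).const_mul b).congr_deriv ?_
    push_cast; ring
  obtain ⟨x, hx⟩ := nonempty_Ioo.2 hst
  have h4 := (hd b m x).unique ((hd b' m' x).congr_of_eventuallyEq (by
    filter_upwards [Ioo_mem_nhds hx.1 hx.2] with y hy using h1 y hy))
  rw [← h1 x hx] at h4
  have h5 := mul_left_cancel₀ (mul_ne_zero hb (Complex.exp_ne_zero _)) h4
  have h6 : (m : ℂ) = m' := mul_left_cancel₀ (by simp) h5
  have hm : m = m' := by exact_mod_cast h6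
  subst hm
  have hbb : b = b' := mul_right_cancel₀ (Complex.exp_ne_zero _) (h1 x hx)
  subst hbb
  exact ⟨mul_right_cancel' (h x hx), rfl, rfl⟩

/-- A shortest curve of constant speed is an extremal arc if its end points are in good relative
position. -/
theorem exists_arc_of_isLengthMinimizing {γ : ℝ → CSU} {a b r : ℝ} (hab : a < b)
    (hγ : IsLengthMinimizing γ a b) (hr : ∀ᵐ t, t ∈ Icc a b → speed γ t = r)
    (h : mul (inv (γ a)) (γ b) ∈ region) :
    ∃ (g : CSU) (β : ℂ) (m : ℝ), β ≠ 0 ∧ ∀ t ∈ Icc a b, γ t = mul g (arc β m t) := by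
  obtain ⟨β, m, hβ, hm, he⟩ := exists_arc_of_mem_region h
  have hT : 0 < b - a := sub_pos.2 hab
  have h1 := eq_arc_of_isLengthMinimizing hab (hγ.mul_left hab.le (inv (γ a)))
    (inv_mul_self _) (r := r) (by
      filter_upwards [hr, hγ.1.speed_mul_left (inv (γ a))] with t h2 h3 ht
      rw [h3 ht, h2 ht])
    (β := β / (b - a : ℝ)) (m := m / (b - a))
    (div_ne_zero hβ (by exact_mod_cast hT.ne'))
    (by rwa [abs_div, abs_of_pos hT, div_mul_cancel₀ _ hT.ne'])
    (by
      have := arc_scale hT (β / (b - a : ℝ)) (m / (b - a)) 1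
      rw [mul_div_cancel₀ _ (by exact_mod_cast hT.ne'), mul_div_cancel₀ _ hT.ne', mul_one] at this
      rw [← this, he])
  set β₁ := β / (b - a : ℝ)
  set m₁ := m / (b - a)
  -- The arc obtained starts at time `a`. Shifting by `-a` through `arc_add` expresses it in the
  -- common time parameter, so arcs on overlapping intervals can be compared by `mul_arc_injective`.
  refine ⟨mul (γ a) (arc β₁ m₁ (-a)), β₁ * Complex.exp (Complex.I * (2 * (m₁ * -a) : ℝ)), m₁,
    mul_ne_zero (div_ne_zero hβ (by exact_mod_cast hT.ne')) (Complex.exp_ne_zero _), ?_⟩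
  intro t ht
  rw [mul_assoc', ← arc_add, neg_add_eq_sub, ← h1 t ht, mul_inv_cancel_left']

/-- On a short arc `S` increases, so the integrand defining `c` is at most `‖w‖²` at the end point.
Hence `|c| ≤ |m| h ‖w‖² ≤ ‖w‖² / 5`. -/
theorem arc_mem_region {b : ℂ} (hb : b ≠ 0) {m h : ℝ} (h0 : 0 < h) (hm : |m| * h ≤ 1 / 5)
    (hS : ‖b‖ * S (‖b‖ ^ 2 - m ^ 2) h < 1 / 2) : arc b m h ∈ region := by
  have hR : 0 < ‖b‖ := norm_pos_iff.2 hb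
  have hm1 : |m| * h ≤ 1 := by linarith
  have hSp := S_pos_of_le (R := ‖b‖) h0 le_rfl hm1
  have hmono : MonotoneOn (S (‖b‖ ^ 2 - m ^ 2)) (Icc 0 h) := by
    refine monotoneOn_of_deriv_nonneg (convex_Icc _ _) (continuous_S _).continuousOn
      (fun x _ => (hasDerivAt_S _ x).differentiableAt.differentiableWithinAt) fun x hx => ?_
    rw [interior_Icc] at hx
    rw [(hasDerivAt_S _ x).deriv]
    exact (C_pos_of_le hx.1.le hx.2.le hm1).le
  have hn : ‖(arc b m h).2‖ = ‖b‖ * S (‖b‖ ^ 2 - m ^ 2) h := by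
    rw [norm_arc_snd, abs_of_pos hSp]
  have hpos : 0 < ‖b‖ * S (‖b‖ ^ 2 - m ^ 2) h := by positivity
  refine mem_region_of_le (norm_pos_iff.1 (hn ▸ hpos)) (hn ▸ hS) ?_
  have h2 := intervalIntegral.norm_integral_le_of_norm_le_const (a := 0) (b := h)
    (f := fun s => ‖b‖ ^ 2 * S (‖b‖ ^ 2 - m ^ 2) s ^ 2 / (1 + ‖b‖ ^ 2 * S (‖b‖ ^ 2 - m ^ 2) s ^ 2))
    (C := ‖(arc b m h).2‖ ^ 2) (by
      intro s hs
      rw [uIoc_of_le h0.le] at hs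
      have h3 := hmono ⟨hs.1.le, hs.2⟩ ⟨h0.le, le_rfl⟩ hs.2
      have h4 := S_pos_of_le (R := ‖b‖) hs.1 hs.2 hm1
      rw [Real.norm_of_nonneg (by positivity), hn]
      refine (div_le_self (by positivity)
        (by nlinarith [sq_nonneg (‖b‖ * S (‖b‖ ^ 2 - m ^ 2) s)])).trans ?_
      rw [mul_pow]
      gcongr)
  rw [sub_zero, abs_of_pos h0, Real.norm_eq_abs] at h2
  have h5 : (arc b m h).1 = -m * ∫ s in (0 : ℝ)..h, ‖b‖ ^ 2 * S (‖b‖ ^ 2 - m ^ 2) s ^ 2 /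
    (1 + ‖b‖ ^ 2 * S (‖b‖ ^ 2 - m ^ 2) s ^ 2) := rfl
  rw [h5, abs_mul, abs_neg]
  calc _ ≤ |m| * (‖(arc b m h).2‖ ^ 2 * h) := by gcongr
    _ = |m| * h * ‖(arc b m h).2‖ ^ 2 := by ring
    _ ≤ 1 / 5 * ‖(arc b m h).2‖ ^ 2 := by gcongr
    _ = _ := by ring

theorem eventually_arc_mem_region {b : ℂ} (hb : b ≠ 0) (m : ℝ) :
    ∀ᶠ h in 𝓝[>] (0 : ℝ), ∀ β : ℂ, ‖β‖ = ‖b‖ → arc β m h ∈ region := by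
  have h1 : ∀ᶠ h in 𝓝 (0 : ℝ), |m| * h < 1 / 5 :=
    (by fun_prop : Continuous fun h : ℝ => |m| * h).continuousAt.eventually_lt_const (by simp)
  have h2 : ∀ᶠ h in 𝓝 (0 : ℝ), ‖b‖ * S (‖b‖ ^ 2 - m ^ 2) h < 1 / 2 :=
    (continuous_const.mul (continuous_S (‖b‖ ^ 2 - m ^ 2))).continuousAt.eventually_lt_const
      (by simp [S_zero])
  filter_upwards [self_mem_nhdsWithin, h1.filter_mono nhdsWithin_le_nhds,
    h2.filter_mono nhdsWithin_le_nhds] with h h0 h1 h2 β hβ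
  rw [← hβ] at h2
  exact arc_mem_region (norm_pos_iff.1 (hβ ▸ norm_pos_iff.2 hb)) h0 h1.le h2

/-- The height of a curve of nearly maximal extension is small. -/
theorem abs_fst_le_of_length {η : ℝ → CSU} {a b : ℝ} (hab : a ≤ b) (hη : IsHorizontal η a b)
    (ha : η a = one) {L : ℝ} (hL : 0 < L) (hlen : length η a b = L)
    (h1 : 999 / 1000 * L ≤ ‖(η b).2‖) (h2 : ‖(η b).2‖ ≤ 1 / 20) :
    |(η b).1| ≤ ‖(η b).2‖ ^ 2 / 5 := by
  -- With this `l` the radial slope is at least `0.99` on `[0, ‖w‖]`. Hence the radial part consumes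
  -- at least `0.99 * 0.999 * L` of the length and leaves at most `0.011 * L` for `l * c`.
  have key : ∀ l : ℝ, |l| * L = 1 / 10 → l * (η b).1 ≤ 11 / 1000 * L := by
    intro l hl
    have h3 := calib_le_length hab hη ha (l := l) (by rw [hlen, hl]; norm_num)
    have h4 := sq_mul_le_of_length hη ha (l := l) (k := 1 / 10) ⟨hab, le_rfl⟩ (by rw [hlen, hl])
    have h5 : 99 / 100 * ‖(η b).2‖ ≤ radial l ‖(η b).2‖ := by
      refine mul_le_radial (norm_nonneg _) fun s hs => ?_
      set r := ‖(η b).2‖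
      have hs2 : s ^ 2 ≤ r ^ 2 := by nlinarith [hs.1, hs.2]
      have hr2 : r ^ 2 ≤ 1 / 400 := by nlinarith [norm_nonneg (η b).2]
      have h6 : l ^ 2 * s ^ 2 ≤ 1 / 100 * (1 + r ^ 2) := by
        nlinarith [mul_le_mul_of_nonneg_left hs2 (sq_nonneg l)]
      rw [radialDeriv, le_div_iff₀ (by positivity)]
      refine Real.le_sqrt_of_sq_le ?_
      have h7 : (1 + s ^ 2) ^ 2 ≤ (1 + 1 / 400) * (1 + s ^ 2) := by
        nlinarith [sq_nonneg s]
      nlinarith [sq_nonneg s]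
    rw [calib, hlen] at h3
    linarith
  have h3 : |(η b).1| ≤ 11 / 100 * L ^ 2 := by
    have k1 := key (1 / (10 * L)) (by rw [abs_of_pos (by positivity)]; field_simp)
    have k2 := key (-(1 / (10 * L))) (by rw [abs_neg, abs_of_pos (by positivity)]; field_simp)
    rw [← le_div_iff₀' (by positivity)] at k1
    have e : 11 / 1000 * L / (1 / (10 * L)) = 11 / 100 * L ^ 2 := by field_simp; norm_num
    rw [e] at k1
    have k3 : 1 / (10 * L) * -(η b).1 ≤ 11 / 1000 * L := by linarith
    rw [← le_div_iff₀' (by positivity), e] at k3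
    exact abs_le.2 ⟨by linarith, k1⟩
  have h4 : 998 / 1000 * L ^ 2 ≤ ‖(η b).2‖ ^ 2 := by nlinarith
  nlinarith [sq_nonneg L]

/-- After translation to the identity, the displacement in the plane after time `x - s` is
asymptotic to the length `r (x - s)`. A curve that is nearly as extended as it is long has small
height, by `abs_fst_le_of_length`. -/
theorem eventually_mem_region_of_hasDerivAt {γ : ℝ → CSU} {v : CSU} {s t r : ℝ} (hst : s < t)
    (hγ : IsHorizontal γ s t) (hr0 : 0 < r) (hr : ∀ᵐ x, x ∈ Icc s t → speed γ x = r)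
    (hd : HasDerivAt γ v s) (hv : v ∈ distribution (γ s)) (hs : speed γ s = r) :
    ∀ᶠ x in 𝓝[>] s, mul (inv (γ s)) (γ x) ∈ region := by
  obtain ⟨u, hu, hdu, hmu⟩ := hasDerivAt_mul_left (inv (γ s)) hd hv
  set η : ℝ → CSU := fun x => mul (inv (γ s)) (γ x) with hη
  have hηs : η s = one := inv_mul_self _
  have hu2 : ‖u.2‖ = r := by
    have h1 := speed_of_mem hdu hu
    rw [hηs] at h1
    have h2 : speed η s = r := by
      rw [← hs, speed_of_hasDerivAt hdu, speed_of_hasDerivAt hd]; congr 1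
    rw [h2] at h1
    simpa [one] using h1.symm
  have hw : HasDerivAt (fun x => (η x).2) u.2 s := hdu.snd
  have hw0 : (η s).2 = 0 := by rw [hηs]; rfl
  have e1 : ∀ᶠ x in 𝓝[>] s, 999 / 1000 * r < ‖slope (fun x => (η x).2) s x‖ := by
    have h1 := (hasDerivAt_iff_tendsto_slope.1 hw).norm.mono_left
      (nhdsWithin_mono s (fun x hx => ne_of_gt hx : Ioi s ⊆ {s}ᶜ))
    exact h1.eventually_const_lt (by rw [hu2]; linarith)
  have e2 : ∀ᶠ x in 𝓝[>] s, ‖(η x).2‖ < 1 / 20 := by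
    refine (hw.continuousAt.norm.eventually_lt_const ?_).filter_mono nhdsWithin_le_nhds
    simp [hw0]
  have e3 : ∀ᶠ x in 𝓝[>] s, x < t := (eventually_lt_nhds hst).filter_mono nhdsWithin_le_nhds
  filter_upwards [e1, e2, e3, self_mem_nhdsWithin] with x h1 h2 h3 h4
  have hsx : 0 < x - s := sub_pos.2 h4
  have hηx : IsHorizontal η s x := (hγ.mono le_rfl (le_of_lt h4) h3.le).mul_left _
  have hlen : length η s x = r * (x - s) := by
    refine length_of_speed_eq (le_of_lt h4) ?_
    filter_upwards [hr, hγ.speed_mul_left (inv (γ s))] with y h5 h6 hy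
    have hy' : y ∈ Icc s t := ⟨hy.1, hy.2.trans h3.le⟩
    rw [h6 hy', h5 hy']
  have h5 : 999 / 1000 * (r * (x - s)) < ‖(η x).2‖ := by
    rw [slope_def_module, norm_smul, hw0, sub_zero, norm_inv, Real.norm_of_nonneg hsx.le,
      inv_mul_eq_div, lt_div_iff₀ hsx] at h1
    linarith
  have hL : 0 < r * (x - s) := by positivity
  have h6 := abs_fst_le_of_length (le_of_lt h4) hηx hηs hL hlen h5.le h2.le
  exact mem_region_of_le (norm_pos_iff.1 (by nlinarith)) (h2.trans (by norm_num)) h6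

/-- Continuation, first to the right and then to the left: `K` is closed, so it contains the
interval up to the infimum of the bad times, and extension past this point contradicts the choice of
the infimum. -/
theorem Icc_subset_of_extend {K : Set ℝ} (hK : IsClosed K) {s t : ℝ} (hs : 0 ≤ s) (hst : s < t)
    (ht : t ≤ 1) (h0 : Icc s t ⊆ K)
    (hext : ∀ p q : ℝ, 0 ≤ p → p < q → q ≤ 1 → Icc p q ⊆ K → ∀ x ∈ Icc p q,
      ∃ h > 0, Icc (x - h) (x + h) ∩ Icc 0 1 ⊆ K) : Icc 0 1 ⊆ K := by
  have hright : Icc s 1 ⊆ K := by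
    by_contra hc
    obtain ⟨y, hy, hyK⟩ := not_subset.1 hc
    set U := Icc s 1 \ K with hU
    have hbd : BddBelow U := ⟨s, fun x hx => hx.1.1⟩
    have hne : U.Nonempty := ⟨y, hy, hyK⟩
    have hlow : ∀ x ∈ Ico s (sInf U), x ∈ K := by
      intro x hx
      by_contra hxK
      have hxy : x < y := hx.2.trans_le (csInf_le hbd ⟨hy, hyK⟩)
      exact absurd (csInf_le hbd ⟨⟨hx.1, hxy.le.trans hy.2⟩, hxK⟩) (not_le.2 hx.2)
    have htτ : t ≤ sInf U := le_csInf hne fun x hx => by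
      by_contra! h
      exact hx.2 (h0 ⟨hx.1.1, h.le⟩)
    have hsτ : s < sInf U := hst.trans_le htτ
    have hτ1 : sInf U ≤ 1 := (csInf_le hbd ⟨hy, hyK⟩).trans hy.2
    have hcl : Icc s (sInf U) ⊆ K := by
      rw [← closure_Ico hsτ.ne]
      exact closure_minimal hlow hK
    obtain ⟨h, hh, hhK⟩ := hext s (sInf U) hs hsτ hτ1 hcl (sInf U) ⟨hsτ.le, le_rfl⟩
    obtain ⟨u, hu, hlt⟩ := exists_lt_of_csInf_lt hne (lt_add_of_pos_right (sInf U) hh)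
    exact hu.2 (hhK ⟨⟨by linarith [csInf_le hbd hu], hlt.le⟩, hs.trans hu.1.1, hu.1.2⟩)
  by_contra hc
  obtain ⟨y, hy, hyK⟩ := not_subset.1 hc
  set U := Icc 0 1 \ K with hU
  have hbd : BddAbove U := ⟨1, fun x hx => hx.1.2⟩
  have hne : U.Nonempty := ⟨y, hy, hyK⟩
  have hup : ∀ x ∈ Ioc (sSup U) 1, x ∈ K := by
    intro x hx
    by_contra hxK
    have hxy : y < x := (le_csSup hbd ⟨hy, hyK⟩).trans_lt hx.1
    exact absurd (le_csSup hbd ⟨⟨hy.1.trans hxy.le, hx.2⟩, hxK⟩) (not_le.2 hx.1)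
  have htτ : sSup U ≤ s := csSup_le hne fun x hx => by
    by_contra! h
    exact hx.2 (hright ⟨h.le, hx.1.2⟩)
  have hsτ : sSup U < 1 := htτ.trans_lt (hst.trans_le ht)
  have hτ0 : 0 ≤ sSup U := hy.1.trans (le_csSup hbd ⟨hy, hyK⟩)
  have hcl : Icc (sSup U) 1 ⊆ K := by
    rw [← closure_Ioc hsτ.ne]
    exact closure_minimal hup hK
  obtain ⟨h, hh, hhK⟩ := hext (sSup U) 1 hτ0 hsτ le_rfl hcl (sSup U) ⟨le_rfl, hsτ.le⟩
  obtain ⟨u, hu, hlt⟩ := exists_lt_of_lt_csSup hne (sub_lt_self (sSup U) hh)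
  exact hu.2 (hhK ⟨⟨hlt.le, by linarith [le_csSup hbd hu]⟩, hu.1⟩)

/-- Locally shortest curves of constant speed remain on extremal arcs. -/
theorem exists_extend_arc {γ : ℝ → CSU} (hc : Continuous γ) {r ε x p q : ℝ}
    (hr : ∀ᵐ t, t ∈ Icc (0 : ℝ) 1 → speed γ t = r) (hε : 0 < ε)
    (hmin : ∀ a ∈ Icc (0 : ℝ) 1, ∀ b ∈ Icc (0 : ℝ) 1, x - ε < a → a ≤ b → b < x + ε →
      IsLengthMinimizing γ a b) {g : CSU} {β : ℂ} (hβ : β ≠ 0) {m : ℝ} (hp : 0 ≤ p) (hpq : p < q)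
    (hq : q ≤ 1) (h : ∀ t ∈ Icc p q, γ t = mul g (arc β m t)) (hx : x ∈ Icc p q) :
    ∃ h > 0, Icc (x - h) (x + h) ∩ Icc 0 1 ⊆ {t | γ t = mul g (arc β m t)} := by
  obtain ⟨δ, hδ, hδε, hδpq, hδr⟩ : ∃ δ > 0, δ < ε / 2 ∧ δ < q - p ∧
      ∀ β' : ℂ, ‖β'‖ = ‖β‖ → arc β' m δ ∈ region := by
    have h1 : ∀ᶠ d in 𝓝[>] (0 : ℝ), d < ε / 2 :=
      (eventually_lt_nhds (by linarith)).filter_mono nhdsWithin_le_nhds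
    have h2 : ∀ᶠ d in 𝓝[>] (0 : ℝ), d < q - p :=
      (eventually_lt_nhds (by linarith)).filter_mono nhdsWithin_le_nhds
    obtain ⟨d, h⟩ := (h1.and (h2.and ((eventually_arc_mem_region hβ m).and
      (self_mem_nhdsWithin : Ioi (0:ℝ) ∈ 𝓝[>] (0:ℝ))))).exists
    exact ⟨d, h.2.2.2, h.1, h.2.1, h.2.2.1⟩
  -- A window of length `δ` inside `[p, q]` that contains `x`. Near the right end it is pushed back
  -- to end at `q`.
  obtain ⟨a₀, ha₀, ha₀x, hxb₀, hb₀⟩ : ∃ a₀, p ≤ a₀ ∧ a₀ ≤ x ∧ x ≤ a₀ + δ ∧ a₀ + δ ≤ q := by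
    rcases le_total (x + δ) q with h1 | h1
    · exact ⟨x, hx.1, le_rfl, by linarith, h1⟩
    · exact ⟨q - δ, by linarith, by linarith, by linarith [hx.2], by linarith⟩
  have hreg : mul (inv (γ a₀)) (γ (a₀ + δ)) ∈ region := by
    rw [h a₀ ⟨ha₀, by linarith⟩, h (a₀ + δ) ⟨by linarith, hb₀⟩, arc_add, ← mul_assoc' g,
      inv_mul_cancel_left']
    exact hδr _ (by rw [norm_mul, norm_exp_I_mul, mul_one])
  -- As `region` is open, the window may be enlarged by `d` on both sides. Truncation to `[0, 1]`
  -- covers the end points.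
  have hopen : ∀ᶠ d in 𝓝[>] (0 : ℝ),
      mul (inv (γ (max 0 (a₀ - d)))) (γ (min 1 (a₀ + δ + d))) ∈ region := by
    have hcont : Continuous fun d : ℝ =>
        mul (inv (γ (max 0 (a₀ - d)))) (γ (min 1 (a₀ + δ + d))) :=
      continuous_mul.comp ((continuous_inv.comp (hc.comp (by fun_prop))).prodMk
        (hc.comp (by fun_prop)))
    refine (hcont.continuousAt.eventually_mem (isOpen_region.mem_nhds ?_)).filter_mono
      nhdsWithin_le_nhds
    rw [sub_zero, add_zero, max_eq_right (hp.trans ha₀), min_eq_right (hb₀.trans hq)]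
    exact hreg
  have hsmall : ∀ᶠ d in 𝓝[>] (0 : ℝ), d < ε / 2 :=
    (eventually_lt_nhds (by linarith)).filter_mono nhdsWithin_le_nhds
  obtain ⟨d, hd1, hd2, hd0⟩ := (hopen.and (hsmall.and
    (self_mem_nhdsWithin : Ioi (0:ℝ) ∈ 𝓝[>] (0:ℝ)))).exists
  set a := max 0 (a₀ - d) with ha
  set b := min 1 (a₀ + δ + d) with hb
  have haa₀ : a ≤ a₀ := max_le (hp.trans ha₀) (by linarith)
  have hbb₀ : a₀ + δ ≤ b := le_min (hb₀.trans hq) (by linarith)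
  have ha0 : 0 ≤ a := le_max_left _ _
  have hb1 : b ≤ 1 := min_le_left _ _
  have ha' : a₀ - d ≤ a := le_max_right _ _
  have hb' : b ≤ a₀ + δ + d := min_le_right _ _
  have hab : a < b := by linarith
  have hmin' := hmin a ⟨ha0, by linarith⟩ b ⟨by linarith, hb1⟩ (by linarith) hab.le (by linarith)
  obtain ⟨g', β', m', -, h'⟩ := exists_arc_of_isLengthMinimizing hab hmin' (r := r) (by
    filter_upwards [hr] with t ht htI using ht ⟨ha0.trans htI.1, htI.2.trans hb1⟩) hd1
  -- The arc on the enlarged window agrees with the old one on the original window, so it has the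
  -- same parameters.
  obtain ⟨rfl, rfl, rfl⟩ := mul_arc_injective (s := a₀) (t := a₀ + δ) (by linarith) hβ
    (g := g) (g' := g') (b' := β') (m := m) (m' := m') fun y hy => by
      rw [← h y ⟨by linarith [hy.1], by linarith [hy.2]⟩,
        h' y ⟨by linarith [hy.1], by linarith [hy.2]⟩]
  refine ⟨d, hd0, fun y hy => h' y ⟨?_, ?_⟩⟩
  · exact max_le hy.2.1 (by linarith [hy.1.1])
  · exact le_min hy.2.2 (by linarith [hy.1.2])

/-- A curve of speed zero is constant, hence a degenerate arc. Otherwise the curve is an arc just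
after a time of horizontal differentiability, and continuation extends this arc to `[0, 1]`. -/
theorem exists_arc_of_isGeodesic {γ : ℝ → CSU} (hc : Continuous γ) (h0 : γ 0 = one)
    (hγ : IsGeodesic γ) : ∃ (b : ℂ) (m : ℝ), ∀ t ∈ Icc (0 : ℝ) 1, γ t = arc b m t := by
  obtain ⟨hhor, hloc, r, hr⟩ := hγ
  rcases le_or_gt r 0 with hr0 | hr0
  · refine ⟨0, 0, fun t ht => ?_⟩
    obtain ⟨c, hcst⟩ := hhor.1.const_of_ae_hasDerivAt_zero (by
      filter_upwards [hr, hhor.2] with s h1 h2 hs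
      rw [uIcc_of_le zero_le_one] at hs
      obtain ⟨v, hv, hd⟩ := h2 hs
      have h3 := speed_of_mem hd hv
      rw [h1 hs] at h3
      have h4 : 0 ≤ ‖v.2‖ / √(1 + ‖(γ s).2‖ ^ 2) := by positivity
      have h5 : ‖v.2‖ / √(1 + ‖(γ s).2‖ ^ 2) = 0 := by linarith
      have h6 : v.2 = 0 := by
        rcases div_eq_zero_iff.1 h5 with h | h
        · exact norm_eq_zero.1 h
        · exact absurd h (sqrt_one_add_pos _).ne'
      have h7 := mem_distribution_iff.1 hv
      rw [h6, mul_zero, Complex.zero_im, neg_zero] at h7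
      have h8 : v = 0 := Prod.ext (by simpa [(one_add_sq_pos (γ s).2).ne'] using h7) h6
      rwa [h8] at hd)
    rw [uIcc_of_le zero_le_one] at hcst
    rw [hcst t ht, ← hcst 0 ⟨le_rfl, zero_le_one⟩, h0, arc_zero_left]
  have hae := (hr.and (hhor.2.and (ae_mem_Ioo_of_mem_Icc 0 1)))
  obtain ⟨s, hsI, hs1, ⟨v, hv, hd⟩, hs01⟩ : ∃ s, s ∈ Icc (0 : ℝ) 1 ∧ speed γ s = r ∧
      (∃ v ∈ distribution (γ s), HasDerivAt γ v s) ∧ s ∈ Ioo (0 : ℝ) 1 := by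
    by_contra! hcon
    have : ∀ᵐ s : ℝ, s ∉ Icc (0 : ℝ) 1 := by
      filter_upwards [hae] with s hs hsI
      exact hcon s hsI (hs.1 hsI) (hs.2.1 hsI) (hs.2.2 hsI)
    have h1 : volume (Icc (0 : ℝ) 1) = 0 := by
      rw [← compl_mem_ae_iff]; exact this
    simp at h1
  obtain ⟨ε, hε, hmin⟩ := hloc s hsI
  obtain ⟨t, ht1, ht2, ht3, ht4⟩ := ((eventually_mem_region_of_hasDerivAt hs01.2
    (hhor.mono hs01.1.le hs01.2.le le_rfl) hr0 (by
      filter_upwards [hr] with x hx hxI using hx ⟨hs01.1.le.trans hxI.1, hxI.2⟩) hd hv hs1).and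
    (((eventually_lt_nhds hs01.2).filter_mono nhdsWithin_le_nhds).and
      (((eventually_lt_nhds (lt_add_of_pos_right s hε)).filter_mono nhdsWithin_le_nhds).and
        (self_mem_nhdsWithin : Ioi s ∈ 𝓝[>] s)))).exists
  have htI : t ∈ Icc (0 : ℝ) 1 := ⟨(hsI.1.trans ht4.le), ht2.le⟩
  obtain ⟨g, β, m, hβ, harc⟩ := exists_arc_of_isLengthMinimizing ht4
    (hmin s hsI t htI (by linarith) ht4.le ht3) (r := r) (by
      filter_upwards [hr] with x hx hxI using hx ⟨hsI.1.trans hxI.1, hxI.2.trans htI.2⟩) ht1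
  have hK : IsClosed {t | γ t = mul g (arc β m t)} :=
    isClosed_eq hc ((contDiff_mul_left g).continuous.comp (continuous_arc β m))
  have hall : Icc (0 : ℝ) 1 ⊆ {t | γ t = mul g (arc β m t)} := by
    refine Icc_subset_of_extend hK hsI.1 ht4 htI.2 harc ?_
    intro p q hp hpq hq hsub x hx
    obtain ⟨ε', hε', hmin'⟩ := hloc x ⟨hp.trans hx.1, hx.2.trans hq⟩
    exact exists_extend_arc hc hr hε' hmin' hβ hp hpq hq hsub hx
  have hg : g = one := by
    have := hall (show (0 : ℝ) ∈ Icc (0 : ℝ) 1 from ⟨le_rfl, zero_le_one⟩)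
    simpa [h0, arc_zero, mul_one'] using this.symm
  exact ⟨β, m, fun t ht => by rw [← one_mul' (arc β m t), ← hg]; exact hall ht⟩

theorem isGeodesic_of_eq_arc {γ : ℝ → CSU} {b : ℂ} {m : ℝ}
    (h : ∀ t ∈ Icc (0 : ℝ) 1, γ t = arc b m t) : IsGeodesic γ := by
  refine ⟨(isHorizontal_arc b m 0 1).congr zero_le_one fun t ht => (h t ht).symm, ?_, ‖b‖, ?_⟩
  · intro t₀ _
    -- Intervals within this radius of `t₀` have length less than `1 / (|m| + 1)`, short enough for
    -- `isLengthMinimizing_arc`.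
    refine ⟨1 / (2 * (|m| + 1)), by positivity, fun a ha c hc h1 hac h2 => ?_⟩
    have hlen : |m| * (c - a) ≤ 1 := by
      have h3 : c - a ≤ 1 / (|m| + 1) := by
        have : 1 / (2 * (|m| + 1)) + 1 / (2 * (|m| + 1)) = 1 / (|m| + 1) := by field_simp; norm_num
        linarith
      calc |m| * (c - a) ≤ |m| * (1 / (|m| + 1)) := by gcongr
        _ ≤ 1 := by rw [mul_one_div, div_le_one (by positivity)]; linarith
    refine ((isLengthMinimizing_arc (b := b * Complex.exp (Complex.I * (2 * (m * a) : ℝ))) hac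
      hlen).mul_left hac (arc b m a)).congr hac fun t ht => ?_
    rw [← arc_add, add_sub_cancel, h t ⟨ha.1.trans ht.1, ht.2.trans hc.2⟩]
  · filter_upwards [ae_eventuallyEq h] with t ht htI
    rw [speed_congr (ht htI), speed_arc]

/-- The extremal arc with given parameters, as a path. -/
def arcPath (b : ℂ) (m : ℝ) (g : CSU) (h : arc b m 1 = g) : Path one g where
  toFun t := arc b m t
  continuous_toFun := (continuous_arc b m).comp continuous_subtype_val
  source' := arc_zero b m
  target' := h

theorem mem_geodesics_iff {g : CSU} {p : Path one g} :
    p ∈ geodesics g ↔ ∃ (b : ℂ) (m : ℝ) (h : arc b m 1 = g), p = arcPath b m g h := by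
  constructor
  · intro hp
    obtain ⟨b, m, h⟩ := exists_arc_of_isGeodesic p.continuous_extend (by simp) hp
    have h1 : arc b m 1 = g := by rw [← h 1 ⟨zero_le_one, le_rfl⟩, Path.extend_one]
    refine ⟨b, m, h1, ?_⟩
    ext1
    funext t
    have := h t t.2
    rwa [Path.extend_apply p t.2] at this
  · rintro ⟨b, m, h, rfl⟩
    exact isGeodesic_of_eq_arc (b := b) (m := m) fun t ht => Path.extend_apply _ ht

theorem arcPath_injective {g : CSU} {b b' : ℂ} {m m' : ℝ} (hb : b ≠ 0) {h : arc b m 1 = g}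
    {h' : arc b' m' 1 = g} (e : arcPath b m g h = arcPath b' m' g h') : b = b' ∧ m = m' := by
  refine (mul_arc_injective (g := one) (g' := one) zero_lt_one hb fun x hx => ?_).2
  have := congrArg (fun p : Path one g => p ⟨x, hx.1.le, hx.2.le⟩) e
  rw [one_mul', one_mul']
  exact this

end CSU

namespace CSU

/-! ### The height of the end point as a function of the rotation angle -/

/-- The height `|c|` of the end point of an arc that turns by the angle `N + x`, where `N` is a
multiple of `π`, over a point at distance `r` from the origin. -/
def turnHeight (N r x : ℝ) : ℝ :=
  (x + N) * √(1 + r ^ 2 / Real.sin x ^ 2) - N - Real.arccos (Real.cos x / √(1 + r ^ 2))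

/-- The sign is that of `sin x - (x + N) cos x`. For `N = π k` its zeros satisfy `tan (x + N) = x +
N`, which is where the numbers `χ_k` enter. -/
theorem hasDerivAt_turnHeight {N r x : ℝ} (hr : 0 < r) (hx : x ∈ Ioo 0 Real.pi) :
    HasDerivAt (turnHeight N r) (r ^ 2 * (Real.sin x - (x + N) * Real.cos x) /
      (√(1 + r ^ 2 / Real.sin x ^ 2) * Real.sin x ^ 3)) x := by
  have hs : 0 < Real.sin x := Real.sin_pos_of_mem_Ioo hx
  have hq2 : 0 < 1 + r ^ 2 / Real.sin x ^ 2 := by positivity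
  have hq0 : 0 < √(1 + r ^ 2 / Real.sin x ^ 2) := Real.sqrt_pos.2 hq2
  have hqq : √(1 + r ^ 2 / Real.sin x ^ 2) ^ 2 = 1 + r ^ 2 / Real.sin x ^ 2 := Real.sq_sqrt hq2.le
  have hn2 : 0 < 1 + r ^ 2 := by positivity
  have hn0 : 0 < √(1 + r ^ 2) := Real.sqrt_pos.2 hn2
  have hnn : √(1 + r ^ 2) ^ 2 = 1 + r ^ 2 := Real.sq_sqrt hn2.le
  have hcs := Real.sin_sq_add_cos_sq x
  have hy : 1 - (Real.cos x / √(1 + r ^ 2)) ^ 2 =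
      (√(1 + r ^ 2 / Real.sin x ^ 2) * Real.sin x / √(1 + r ^ 2)) ^ 2 := by
    rw [div_pow, div_pow, mul_pow, hqq, hnn]
    field_simp
    linear_combination -hcs
  have hy1 : (Real.cos x / √(1 + r ^ 2)) ^ 2 < 1 := by
    have : 0 < (√(1 + r ^ 2 / Real.sin x ^ 2) * Real.sin x / √(1 + r ^ 2)) ^ 2 := by positivity
    linarith
  have hy2 := abs_lt.1 ((sq_lt_one_iff_abs_lt_one _).1 hy1)
  have h1 : HasDerivAt (fun x => 1 + r ^ 2 / Real.sin x ^ 2)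
      (-(2 * r ^ 2 * Real.cos x / Real.sin x ^ 3)) x := by
    refine (((hasDerivAt_const x (r ^ 2)).fun_div ((Real.hasDerivAt_sin x).fun_pow 2)
      (by positivity)).const_add 1).congr_deriv ?_
    field_simp
    push_cast
    ring
  have h2 := h1.sqrt hq2.ne'
  have h3 := ((hasDerivAt_id x).add_const N).mul h2
  have h4 := (Real.hasDerivAt_arccos (by linarith [hy2.1]) (by linarith [hy2.2])).comp x
    ((Real.hasDerivAt_cos x).div_const (√(1 + r ^ 2)))
  refine ((h3.sub_const N).sub h4).congr_deriv ?_
  rw [hy, Real.sqrt_sq (by positivity)]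
  simp only [id]
  set q := √(1 + r ^ 2 / Real.sin x ^ 2)
  field_simp at hqq ⊢
  linear_combination Real.sin x * hqq

theorem one_lt_sqrt_one_add {r s : ℝ} (hr : 0 < r) (hs : 0 < s) : 1 < √(1 + r ^ 2 / s ^ 2) := by
  rw [Real.lt_sqrt (by norm_num)]
  have : 0 < r ^ 2 / s ^ 2 := by positivity
  linarith

theorem turnHeight_lt_of_lt {N N' r x : ℝ} (hr : 0 < r) (hx : x ∈ Ioo 0 Real.pi) (h : N < N') :
    turnHeight N r x < turnHeight N' r x := by
  have h1 := one_lt_sqrt_one_add hr (Real.sin_pos_of_mem_Ioo hx)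
  rw [turnHeight, turnHeight]
  nlinarith

/-- The function whose sign is that of the derivative of `turnHeight`. -/
def turnSlope (N x : ℝ) : ℝ := Real.sin x - (x + N) * Real.cos x

/-- The derivative is `(x + N) sin x`, so the sign of the slope changes at most once. -/
theorem strictMonoOn_turnSlope {N : ℝ} (hN : 0 ≤ N) :
    StrictMonoOn (turnSlope N) (Icc 0 Real.pi) := by
  have hd : ∀ x, HasDerivAt (turnSlope N) ((x + N) * Real.sin x) x := fun x =>
    ((Real.hasDerivAt_sin x).sub (((hasDerivAt_id x).add_const N).mul
      (Real.hasDerivAt_cos x))).congr_deriv (by simp)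
  refine strictMonoOn_of_deriv_pos (convex_Icc _ _)
    (fun x _ => (hd x).continuousAt.continuousWithinAt) fun x hx => ?_
  rw [interior_Icc] at hx
  rw [(hd x).deriv]
  exact mul_pos (by linarith [hx.1]) (Real.sin_pos_of_mem_Ioo hx)

/-- The point `x₀ = 0` is admitted, for use with `N = 0`. The formula is singular there, hence the
intersection with the positive half-line. -/
theorem strictMonoOn_turnHeight {N r x₀ : ℝ} (hN : 0 ≤ N) (hr : 0 < r) (h0 : 0 ≤ x₀)
    (h : 0 ≤ turnSlope N x₀) : StrictMonoOn (turnHeight N r) (Ico x₀ Real.pi ∩ Ioi 0) := by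
  refine strictMonoOn_of_deriv_pos ((convex_Ico _ _).inter (convex_Ioi _))
    (fun x hx => (hasDerivAt_turnHeight hr
      ⟨hx.2, hx.1.2⟩).continuousAt.continuousWithinAt) fun x hx => ?_
  rw [interior_inter, interior_Ico, interior_Ioi] at hx
  have hx' : x ∈ Ioo 0 Real.pi := ⟨hx.2, hx.1.2⟩
  rw [(hasDerivAt_turnHeight hr hx').deriv]
  have h1 : turnSlope N x₀ < turnSlope N x := strictMonoOn_turnSlope hN
    ⟨h0, (hx.1.1.trans hx.1.2).le⟩ ⟨hx'.1.le, hx'.2.le⟩ hx.1.1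
  have h2 : 0 < turnSlope N x := h.trans_lt h1
  have h3 := Real.sin_pos_of_mem_Ioo hx'
  have h4 := one_lt_sqrt_one_add hr h3
  rw [turnSlope] at h2
  positivity

theorem strictAntiOn_turnHeight {N r x₀ : ℝ} (hN : 0 ≤ N) (hr : 0 < r) (h0 : x₀ < Real.pi)
    (h : turnSlope N x₀ ≤ 0) : StrictAntiOn (turnHeight N r) (Ioc 0 x₀) := by
  refine strictAntiOn_of_deriv_neg (convex_Ioc _ _)
    (fun x hx => (hasDerivAt_turnHeight hr
      ⟨hx.1, hx.2.trans_lt h0⟩).continuousAt.continuousWithinAt) fun x hx => ?_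
  rw [interior_Ioc] at hx
  have hx' : x ∈ Ioo 0 Real.pi := ⟨hx.1, hx.2.trans h0⟩
  rw [(hasDerivAt_turnHeight hr hx').deriv]
  have h1 : turnSlope N x < turnSlope N x₀ := strictMonoOn_turnSlope hN
    ⟨hx'.1.le, hx'.2.le⟩ ⟨(hx.1.trans hx.2).le, h0.le⟩ hx.2
  have h2 : turnSlope N x < 0 := h1.trans_le h
  have h3 := Real.sin_pos_of_mem_Ioo hx'
  have h4 := one_lt_sqrt_one_add hr h3
  rw [turnSlope] at h2
  refine div_neg_of_neg_of_pos (mul_neg_of_pos_of_neg (by positivity) h2) (by positivity)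

/-- The height blows up as `sin x` tends to zero, because the square root is at least `r / sin x`
and its factor `x + N` stays above `π / 2`. -/
theorem lt_turnHeight {N r x δ v : ℝ} (hr : 0 < r) (hx : x ∈ Ioo 0 Real.pi)
    (hω : Real.pi / 2 ≤ x + N) (hδ : 0 < δ) (hs : Real.sin x ≤ δ)
    (h : δ * (v + N + Real.pi) < Real.pi / 2 * r) : v < turnHeight N r x := by
  have h1 := Real.sin_pos_of_mem_Ioo hx
  have h2 : r / Real.sin x ≤ √(1 + r ^ 2 / Real.sin x ^ 2) := by
    refine Real.le_sqrt_of_sq_le ?_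
    rw [div_pow]; linarith
  have h3 := Real.arccos_le_pi (Real.cos x / √(1 + r ^ 2))
  have hpi := Real.pi_pos
  have h4 : Real.pi / 2 * (r / δ) ≤ (x + N) * √(1 + r ^ 2 / Real.sin x ^ 2) := by
    have : r / δ ≤ r / Real.sin x := by gcongr
    exact mul_le_mul hω (this.trans h2) (by positivity) (by linarith)
  rw [← mul_div_assoc, div_le_iff₀ hδ] at h4
  rw [turnHeight]
  have h5 : (v + N + Real.pi) < (x + N) * √(1 + r ^ 2 / Real.sin x ^ 2) := by
    refine lt_of_mul_lt_mul_right ?_ hδ.le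
    linarith
  linarith

theorem exists_small {N r v : ℝ} (hr : 0 < r) {ε : ℝ} (hε : 0 < ε) :
    ∃ δ, 0 < δ ∧ δ ≤ ε ∧ δ * (v + N + Real.pi) < Real.pi / 2 * r := by
  have hpi := Real.pi_pos
  have h1 : ∀ᶠ d in 𝓝 (0 : ℝ), d * (v + N + Real.pi) < Real.pi / 2 * r :=
    (by fun_prop : Continuous fun d : ℝ => d * (v + N + Real.pi)).continuousAt.eventually_lt_const
      (by simp; positivity)
  obtain ⟨d, hd1, hd2, hd3⟩ := ((h1.filter_mono nhdsWithin_le_nhds).and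
    (((eventually_lt_nhds hε).filter_mono nhdsWithin_le_nhds).and
      (self_mem_nhdsWithin : Ioi (0 : ℝ) ∈ 𝓝[>] (0 : ℝ)))).exists
  exact ⟨d, hd3, hd2.le, hd1⟩

theorem continuousOn_turnHeight {N r : ℝ} (hr : 0 < r) :
    ContinuousOn (turnHeight N r) (Ioo 0 Real.pi) := fun _ hx =>
  (hasDerivAt_turnHeight hr hx).continuousAt.continuousWithinAt

/-- The solutions of `turnHeight N r x = v`, by comparison of `v` with the minimum. -/
theorem ncard_turnHeight {N r v x₀ : ℝ} (hN : Real.pi / 2 ≤ N) (hr : 0 < r)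
    (hx₀ : x₀ ∈ Ioo 0 Real.pi) (h : turnSlope N x₀ = 0) :
    (v < turnHeight N r x₀ → {x ∈ Ioo 0 Real.pi | turnHeight N r x = v}.ncard = 0) ∧
    (v = turnHeight N r x₀ → {x ∈ Ioo 0 Real.pi | turnHeight N r x = v}.ncard = 1) ∧
    (turnHeight N r x₀ < v → {x ∈ Ioo 0 Real.pi | turnHeight N r x = v}.ncard = 2) ∧
    {x ∈ Ioo 0 Real.pi | turnHeight N r x = v}.Finite := by
  have hpi := Real.pi_pos
  have hN0 : 0 ≤ N := by linarith
  have hanti := strictAntiOn_turnHeight hN0 hr hx₀.2 h.le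
  have hmono := strictMonoOn_turnHeight hN0 hr hx₀.1.le h.ge
  have hl : ∀ x ∈ Ioo 0 Real.pi, x ≠ x₀ → turnHeight N r x₀ < turnHeight N r x := by
    intro x hx hne
    rcases lt_or_gt_of_ne hne with h1 | h1
    · exact hanti ⟨hx.1, h1.le⟩ ⟨hx₀.1, le_rfl⟩ h1
    · exact hmono ⟨⟨le_rfl, hx₀.2⟩, hx₀.1⟩ ⟨⟨h1.le, hx.2⟩, hx.1⟩ h1
  have e0 : v < turnHeight N r x₀ → {x ∈ Ioo 0 Real.pi | turnHeight N r x = v} = ∅ := by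
    intro hv
    refine eq_empty_of_forall_notMem fun x hx => ?_
    rcases eq_or_ne x x₀ with rfl | hne
    · linarith [hx.2]
    · linarith [hl x hx.1 hne, hx.2]
  have e1 : v = turnHeight N r x₀ → {x ∈ Ioo 0 Real.pi | turnHeight N r x = v} = {x₀} := by
    intro hv
    refine eq_singleton_iff_unique_mem.2 ⟨⟨hx₀, hv.symm⟩, fun x hx => ?_⟩
    by_contra hne
    linarith [hl x hx.1 hne, hx.2]
  have e2 : turnHeight N r x₀ < v →
      ∃ x₁ x₂, x₁ ≠ x₂ ∧ {x ∈ Ioo 0 Real.pi | turnHeight N r x = v} = {x₁, x₂} := by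
    intro hv
    obtain ⟨δ, hδ0, hδ1, hδ⟩ := exists_small (N := N) (v := v) hr hx₀.1
    obtain ⟨δ', hδ0', hδ1', hδ'⟩ := exists_small (N := N) (v := v) hr (sub_pos.2 hx₀.2)
    have hδx : δ ∈ Ioo 0 Real.pi := ⟨hδ0, hδ1.trans_lt hx₀.2⟩
    have hδx' : Real.pi - δ' ∈ Ioo 0 Real.pi := ⟨by linarith [hx₀.1], by linarith⟩
    have a1 := lt_turnHeight hr hδx (by linarith) hδ0 (Real.sin_le hδ0.le) hδ
    have a2 := lt_turnHeight hr hδx' (by linarith [hδx'.1]) hδ0'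
      (by rw [Real.sin_pi_sub]; exact Real.sin_le hδ0'.le) hδ'
    obtain ⟨x₁, hx₁, hv₁⟩ := intermediate_value_Icc' hδ1
      ((continuousOn_turnHeight (N := N) hr).mono fun x hx =>
        ⟨hδ0.trans_le hx.1, hx.2.trans_lt hx₀.2⟩) ⟨hv.le, a1.le⟩
    obtain ⟨x₂, hx₂, hv₂⟩ := intermediate_value_Icc (by linarith : x₀ ≤ Real.pi - δ')
      ((continuousOn_turnHeight (N := N) hr).mono fun x hx =>
        ⟨hx₀.1.trans_le hx.1, hx.2.trans_lt hδx'.2⟩) ⟨hv.le, a2.le⟩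
    have hne₁ : x₁ ≠ x₀ := by rintro rfl; linarith
    have hne₂ : x₂ ≠ x₀ := by rintro rfl; linarith
    have m₁ : x₁ ∈ Ioc 0 x₀ := ⟨hδ0.trans_le hx₁.1, hx₁.2⟩
    have m₂ : x₂ ∈ Ico x₀ Real.pi ∩ Ioi 0 := ⟨⟨hx₂.1, hx₂.2.trans_lt hδx'.2⟩, hx₀.1.trans_le hx₂.1⟩
    refine ⟨x₁, x₂, ?_, ?_⟩
    · rintro rfl
      exact hne₁ (le_antisymm hx₁.2 hx₂.1)
    · ext x
      simp only [mem_ofPred_eq, mem_insert_iff, mem_singleton_iff]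
      constructor
      · rintro ⟨hx, hxv⟩
        rcases le_total x x₀ with h1 | h1
        · exact Or.inl (hanti.injOn ⟨hx.1, h1⟩ m₁ (hxv.trans hv₁.symm))
        · exact Or.inr (hmono.injOn ⟨⟨h1, hx.2⟩, hx.1⟩ m₂ (hxv.trans hv₂.symm))
      · rintro (rfl | rfl)
        · exact ⟨⟨m₁.1, m₁.2.trans_lt hx₀.2⟩, hv₁⟩
        · exact ⟨⟨m₂.2, m₂.1.2⟩, hv₂⟩
  refine ⟨fun hv => by rw [e0 hv, ncard_empty], fun hv => by rw [e1 hv, ncard_singleton],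
    fun hv => ?_, ?_⟩
  · obtain ⟨x₁, x₂, hne, e⟩ := e2 hv
    rw [e, ncard_pair hne]
  · rcases lt_trichotomy v (turnHeight N r x₀) with hv | hv | hv
    · rw [e0 hv]; exact finite_empty
    · rw [e1 hv]; exact finite_singleton _
    · obtain ⟨x₁, x₂, hne, e⟩ := e2 hv
      rw [e]; exact toFinite _

/-! ### The thresholds -/

/-- The position of the minimum of `turnHeight (π k) r`. -/
def turnMin (k : ℕ) : ℝ := chi k - Real.pi * k

theorem turnMin_mem {k : ℕ} (hk : 1 ≤ k) : turnMin k ∈ Ioo 0 (Real.pi / 2) := by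
  have h := (chi_spec hk).1
  exact ⟨by rw [turnMin]; linarith [h.1], by rw [turnMin]; linarith [h.2]⟩

theorem turnMin_mem' {k : ℕ} (hk : 1 ≤ k) : turnMin k ∈ Ioo 0 Real.pi :=
  ⟨(turnMin_mem hk).1, (turnMin_mem hk).2.trans (by linarith [Real.pi_pos])⟩

theorem tan_turnMin {k : ℕ} (hk : 1 ≤ k) : Real.tan (turnMin k) = chi k := by
  rw [turnMin, mul_comm, Real.tan_sub_nat_mul_pi, (chi_spec hk).2]

theorem chi_pos {k : ℕ} (hk : 1 ≤ k) : 0 < chi k := by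
  have := (chi_spec hk).1.1
  have := Real.pi_pos
  have : 0 ≤ Real.pi * k := by positivity
  linarith

theorem turnSlope_turnMin {k : ℕ} (hk : 1 ≤ k) : turnSlope (Real.pi * k) (turnMin k) = 0 := by
  have h := turnMin_mem hk
  have hc : 0 < Real.cos (turnMin k) :=
    Real.cos_pos_of_mem_Ioo ⟨by linarith [h.1, Real.pi_pos], h.2⟩
  have h1 := tan_turnMin hk
  rw [Real.tan_eq_sin_div_cos, div_eq_iff hc.ne'] at h1
  rw [turnSlope, h1]
  simp only [turnMin]
  ring

/-- At the minimum `tan x = χ_k`, so `cos² x = 1 / (1 + χ_k²)`. The two terms of the height become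
`M` and `arctan M`, with `M` the square root in `threshold`. The subtraction formula for `arctan`
gives the stated form, as `x = arctan χ_k`. -/
theorem turnHeight_turnMin {k : ℕ} (hk : 1 ≤ k) (w : ℂ) :
    turnHeight (Real.pi * k) ‖w‖ (turnMin k) = threshold k w := by
  have h := turnMin_mem hk
  have hc : 0 < Real.cos (turnMin k) :=
    Real.cos_pos_of_mem_Ioo ⟨by linarith [h.1, Real.pi_pos], h.2⟩
  have hχ := chi_pos hk
  have h1 := tan_turnMin hk
  have h2 : Real.arctan (chi k) = turnMin k := by
    rw [← h1, Real.arctan_tan (by linarith [h.1, Real.pi_pos]) h.2]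
  rw [Real.tan_eq_sin_div_cos, div_eq_iff hc.ne'] at h1
  have hcs := Real.sin_sq_add_cos_sq (turnMin k)
  rw [h1] at hcs
  have hc2 : Real.cos (turnMin k) ^ 2 = 1 / (1 + chi k ^ 2) := by
    rw [eq_div_iff (by positivity)]; linarith
  set r := ‖w‖ with hr
  have hr0 : 0 ≤ r := norm_nonneg w
  have hMpos : 0 < r ^ 2 + chi k ^ 2 + r ^ 2 * chi k ^ 2 := by positivity
  set M := √(r ^ 2 + chi k ^ 2 + r ^ 2 * chi k ^ 2) with hM
  have hM0 : 0 < M := Real.sqrt_pos.2 hMpos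
  have hM2 : M ^ 2 = r ^ 2 + chi k ^ 2 + r ^ 2 * chi k ^ 2 := Real.sq_sqrt hMpos.le
  have e1 : (turnMin k + Real.pi * k) * √(1 + r ^ 2 / Real.sin (turnMin k) ^ 2) = M := by
    have : turnMin k + Real.pi * k = chi k := by simp [turnMin]
    rw [this, ← Real.sqrt_sq hχ.le, ← Real.sqrt_mul (sq_nonneg _), hM]
    congr 1
    rw [h1, mul_pow, hc2]
    field_simp
    ring
  have e2 : Real.arccos (Real.cos (turnMin k) / √(1 + r ^ 2)) = Real.arctan M := by
    have hn0 : 0 < √(1 + r ^ 2) := Real.sqrt_pos.2 (by positivity)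
    have hnn : √(1 + r ^ 2) ^ 2 = 1 + r ^ 2 := Real.sq_sqrt (by positivity)
    rw [Real.arccos_eq_arctan (by positivity)]
    congr 1
    rw [div_eq_iff (by positivity), ← Real.sqrt_sq (by positivity :
      0 ≤ M * (Real.cos (turnMin k) / √(1 + r ^ 2)))]
    congr 1
    rw [mul_pow, div_pow, hM2, hc2, hnn]
    field_simp
    ring
  have e3 : Real.arctan ((M - chi k) / (1 + chi k * M)) = Real.arctan M - Real.arctan (chi k) := by
    have := Real.arctan_add (x := M) (y := -chi k) (by nlinarith [mul_pos hM0 hχ])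
    rw [Real.arctan_neg] at this
    rw [sub_eq_add_neg (Real.arctan M), this]
    congr 1
    ring
  rw [turnHeight, e1, e2, threshold, ← hM, e3, h2, turnMin]
  ring

theorem turnHeight_le_turnHeight {k : ℕ} (hk : 1 ≤ k) {r x : ℝ} (hr : 0 < r)
    (hx : x ∈ Ioo 0 Real.pi) :
    turnHeight (Real.pi * k) r (turnMin k) ≤ turnHeight (Real.pi * k) r x := by
  have hN : 0 ≤ Real.pi * k := by positivity [Real.pi_pos]
  have h0 := turnMin_mem' hk
  have h := turnSlope_turnMin hk
  rcases le_total x (turnMin k) with h1 | h1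
  · exact (strictAntiOn_turnHeight hN hr h0.2 h.le).antitoneOn ⟨hx.1, h1⟩ ⟨h0.1, le_rfl⟩ h1
  · exact (strictMonoOn_turnHeight hN hr h0.1.le h.ge).monotoneOn ⟨⟨le_rfl, h0.2⟩, h0.1⟩
      ⟨⟨h1, hx.2⟩, hx.1⟩ h1

/-- At the minimum point of the `k`-th height, the `j`-th height is already smaller, and its minimum
is smaller still. -/
theorem threshold_lt {j k : ℕ} (hj : 1 ≤ j) (hjk : j < k) {w : ℂ} (hw : w ≠ 0) :
    threshold j w < threshold k w := by
  have hr := norm_pos_iff.2 hw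
  have hk : 1 ≤ k := by omega
  have hx := turnMin_mem' hk
  rw [← turnHeight_turnMin hj, ← turnHeight_turnMin hk]
  refine (turnHeight_le_turnHeight hj hr hx).trans_lt (turnHeight_lt_of_lt hr hx ?_)
  have : (j : ℝ) < k := by exact_mod_cast hjk
  have := Real.pi_pos
  gcongr

/-- The minimum is at least `π k (q₁ - 1) - π` with `q₁ = √(1 + ‖w‖²) > 1`. This makes the set of
admissible `k` finite. -/
theorem exists_lt_threshold {w : ℂ} (hw : w ≠ 0) (v : ℝ) :
    ∃ n : ℕ, ∀ k, n ≤ k → v < threshold k w := by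
  have hr := norm_pos_iff.2 hw
  have hpi := Real.pi_pos
  have h1 := one_lt_sqrt_one_add hr one_pos
  obtain ⟨n, hn⟩ := exists_nat_gt ((v + Real.pi) / (√(1 + ‖w‖ ^ 2 / 1 ^ 2) - 1))
  refine ⟨n + 1, fun k hk => ?_⟩
  have hk1 : 1 ≤ k := by omega
  have hx := turnMin_mem' hk1
  have hs := Real.sin_pos_of_mem_Ioo hx
  rw [← turnHeight_turnMin hk1, turnHeight]
  have h2 : √(1 + ‖w‖ ^ 2 / 1 ^ 2) ≤ √(1 + ‖w‖ ^ 2 / Real.sin (turnMin k) ^ 2) := by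
    have := Real.sin_le_one (turnMin k)
    gcongr
  have h3 := Real.arccos_le_pi (Real.cos (turnMin k) / √(1 + ‖w‖ ^ 2))
  rw [div_lt_iff₀ (by linarith)] at hn
  have hnk : (n : ℝ) ≤ Real.pi * k := by
    have : (n : ℝ) ≤ k := by exact_mod_cast (by omega : n ≤ k)
    nlinarith [Real.pi_gt_three]
  set q := √(1 + ‖w‖ ^ 2 / Real.sin (turnMin k) ^ 2)
  set q₁ := √(1 + ‖w‖ ^ 2 / 1 ^ 2)
  have h4 : n * (q₁ - 1) ≤ Real.pi * k * (q - 1) :=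
    mul_le_mul hnk (by linarith) (by linarith) (by positivity)
  have h5 : 0 ≤ turnMin k * q := mul_nonneg hx.1.le (by linarith)
  linarith

/-! ### Arcs of less than a full turn -/

theorem height_neg_sq {r x : ℝ} (hx : x ∈ Ioo 0 Real.pi) :
    height r (-x ^ 2) = turnHeight 0 r x := by
  have hs := Real.sin_pos_of_mem_Ioo hx
  have hx0 := hx.1
  rw [height, turnHeight, S_neg_sq hx.1, C_neg_sq hx.1, add_zero, sub_zero]
  congr 1
  rw [← Real.sqrt_sq hx.1.le, ← Real.sqrt_mul (sq_nonneg _), Real.sqrt_sq hx.1.le]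
  congr 1
  field_simp
  ring

/-- The hyperbolic counterpart of `hasDerivAt_turnHeight`, with `σ = x²`. The derivative has the
sign of `sinh x - x cosh x`, which is negative for `x > 0`. -/
theorem hasDerivAt_height_sq {r x : ℝ} (hx : x ∈ Ioo 0 (Real.arsinh r)) :
    ∃ d < 0, HasDerivAt (fun x => height r (x ^ 2)) d x := by
  have hx0 := hx.1
  have hsh : 0 < Real.sinh x := Real.sinh_pos_iff.2 hx.1
  have hshr : Real.sinh x < r := by
    have := Real.sinh_lt_sinh.2 hx.2
    rwa [Real.sinh_arsinh] at this
  have hr : 0 < r := hsh.trans hshr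
  have hch := Real.cosh_sq x
  have hn2 : 0 < 1 + r ^ 2 := by positivity
  have hn0 : 0 < √(1 + r ^ 2) := Real.sqrt_pos.2 hn2
  have hnn : √(1 + r ^ 2) ^ 2 = 1 + r ^ 2 := Real.sq_sqrt hn2.le
  have hD : 0 < r ^ 2 - Real.sinh x ^ 2 := by nlinarith
  have hDD := Real.sq_sqrt hD.le
  have hD0 := Real.sqrt_pos.2 hD
  set D := √(r ^ 2 - Real.sinh x ^ 2) with hDdef
  have hy : 1 - (Real.cosh x / √(1 + r ^ 2)) ^ 2 = (D / √(1 + r ^ 2)) ^ 2 := by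
    rw [div_pow, div_pow, hDD, hnn, hch]
    field_simp
    ring
  have hy1 : (Real.cosh x / √(1 + r ^ 2)) ^ 2 < 1 := by
    have : 0 < (D / √(1 + r ^ 2)) ^ 2 := by positivity
    linarith
  have hy2 := abs_lt.1 ((sq_lt_one_iff_abs_lt_one _).1 hy1)
  have hm : r ^ 2 * x ^ 2 / Real.sinh x ^ 2 - x ^ 2 = (x * D / Real.sinh x) ^ 2 := by
    rw [div_pow, mul_pow, hDD]; field_simp
  have h1 : HasDerivAt (fun x => r ^ 2 * x ^ 2 / Real.sinh x ^ 2 - x ^ 2)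
      (2 * r ^ 2 * x / Real.sinh x ^ 2 - 2 * r ^ 2 * x ^ 2 * Real.cosh x / Real.sinh x ^ 3 - 2 * x)
      x := by
    refine ((((hasDerivAt_pow 2 x).const_mul (r ^ 2)).fun_div
      ((Real.hasDerivAt_sinh x).fun_pow 2) (by positivity)).fun_sub
      (hasDerivAt_pow 2 x)).congr_deriv ?_
    field_simp
    push_cast
    ring
  have h2 := h1.sqrt (by rw [hm]; positivity)
  have h4 := (Real.hasDerivAt_arccos (by linarith [hy2.1]) (by linarith [hy2.2])).comp x
    ((Real.hasDerivAt_cosh x).div_const (√(1 + r ^ 2)))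
  have h5 := h2.sub h4
  refine ⟨r ^ 2 * (Real.sinh x - x * Real.cosh x) / (D * Real.sinh x ^ 2), ?_, ?_⟩
  · refine div_neg_of_neg_of_pos (mul_neg_of_pos_of_neg (by positivity) ?_) (by positivity)
    have hd : ∀ y, HasDerivAt (fun y => Real.sinh y - y * Real.cosh y) (-(y * Real.sinh y)) y :=
      fun y => ((Real.hasDerivAt_sinh y).sub ((hasDerivAt_id y).mul
        (Real.hasDerivAt_cosh y))).congr_deriv (by simp)
    have hanti : StrictAntiOn (fun y => Real.sinh y - y * Real.cosh y) (Ici 0) := by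
      refine strictAntiOn_of_deriv_neg (convex_Ici _)
        (fun y _ => (hd y).continuousAt.continuousWithinAt) fun y hy => ?_
      rw [interior_Ici, mem_Ioi] at hy
      rw [(hd y).deriv, neg_lt_zero]
      exact mul_pos hy (Real.sinh_pos_iff.2 hy)
    simpa using hanti self_mem_Ici (mem_Ici.2 hx.1.le) hx.1
  · have h6 : (fun x => height r (x ^ 2)) =ᶠ[𝓝 x] fun x =>
        √(r ^ 2 * x ^ 2 / Real.sinh x ^ 2 - x ^ 2) - Real.arccos (Real.cosh x / √(1 + r ^ 2)) := by
      filter_upwards [lt_mem_nhds hx.1] with y hy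
      have hys := Real.sinh_pos_iff.2 hy
      rw [height, S_of_pos (by positivity), C_of_pos (by positivity), Real.sqrt_sq hy.le, mul_one]
      congr 2
      field_simp
    refine (h5.congr_of_eventuallyEq h6).congr_deriv ?_
    rw [hm, hy, Real.sqrt_sq (by positivity), Real.sqrt_sq (by positivity)]
    field_simp
    ring

/-- For `σ < 0` use `turnHeight 0`, for `σ > 0` the hyperbolic derivative; continuity at `σ = 0`
joins the two ranges. -/
theorem strictAntiOn_height {r : ℝ} (hr : 0 < r) :
    StrictAntiOn (height r) (Ioc (-Real.pi ^ 2) (Real.arsinh r ^ 2)) := by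
  have hpi := Real.pi_pos
  have ha := Real.arsinh_pos_iff.2 hr
  have h1 : StrictAntiOn (height r) (Ioc (-Real.pi ^ 2) 0) := by
    have h0 : StrictAntiOn (height r) (Ioo (-Real.pi ^ 2) 0) := by
      intro s hs t ht hst
      have hsx : √(-s) ∈ Ioo 0 Real.pi :=
        ⟨Real.sqrt_pos.2 (by linarith [hs.2]), (Real.sqrt_lt' hpi).2 (by linarith [hs.1])⟩
      have htx : √(-t) ∈ Ioo 0 Real.pi :=
        ⟨Real.sqrt_pos.2 (by linarith [ht.2]), (Real.sqrt_lt' hpi).2 (by linarith [ht.1])⟩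
      have es : s = -√(-s) ^ 2 := by rw [Real.sq_sqrt (by linarith [hs.2])]; ring
      have et : t = -√(-t) ^ 2 := by rw [Real.sq_sqrt (by linarith [ht.2])]; ring
      rw [es, et, height_neg_sq hsx, height_neg_sq htx]
      refine strictMonoOn_turnHeight le_rfl hr le_rfl (by simp [turnSlope])
        ⟨⟨htx.1.le, htx.2⟩, htx.1⟩ ⟨⟨hsx.1.le, hsx.2⟩, hsx.1⟩ ?_
      exact Real.sqrt_lt_sqrt (by linarith [ht.2]) (by linarith)
    intro s hs t ht hst
    -- At the end point `0` the inequality passes to the limit. The intermediate point `u` keeps it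
    -- strict.
    rcases ht.2.eq_or_lt with rfl | ht0
    · obtain ⟨u, hu1, hu2⟩ := exists_between hst
      have hsu := h0 ⟨hs.1, hst⟩ ⟨hs.1.trans hu1, hu2⟩ hu1
      refine lt_of_le_of_lt ?_ hsu
      have hcont : ContinuousOn (height r) (Icc u 0) :=
        (continuousOn_height r).mono fun y hy => (hs.1.trans hu1).trans_le hy.1
      have hanti : AntitoneOn (height r) (Ico u 0) :=
        (h0.mono fun y hy => ⟨(hs.1.trans hu1).trans_le hy.1, hy.2⟩).antitoneOn
      have hlim : Tendsto (height r) (𝓝[Ico u 0] 0) (𝓝 (height r 0)) :=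
        (hcont 0 ⟨hu2.le, le_rfl⟩).mono Ico_subset_Icc_self
      have : (𝓝[Ico u 0] (0 : ℝ)).NeBot := by
        rw [← mem_closure_iff_nhdsWithin_neBot, closure_Ico hu2.ne]
        exact ⟨hu2.le, le_rfl⟩
      exact le_of_tendsto hlim (eventually_mem_nhdsWithin.mono fun y hy =>
        hanti ⟨le_rfl, hu2⟩ hy hy.1)
    · exact h0 ⟨hs.1, hst.trans ht0⟩ ⟨ht.1, ht0⟩ hst
  have h2 : StrictAntiOn (height r) (Icc 0 (Real.arsinh r ^ 2)) := by
    have h3 : StrictAntiOn (fun x => height r (x ^ 2)) (Icc 0 (Real.arsinh r)) := by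
      refine strictAntiOn_of_deriv_neg (convex_Icc _ _) ?_ fun x hx => ?_
      · exact (continuousOn_height r).comp (by fun_prop) fun x _ => by
          have : 0 < Real.pi ^ 2 := by positivity
          exact mem_Ioi.2 (by nlinarith [sq_nonneg x])
      · rw [interior_Icc] at hx
        obtain ⟨d, hd, h⟩ := hasDerivAt_height_sq hx
        rwa [h.deriv]
    intro s hs t ht hst
    have h4 := h3 (a := √s) (b := √t)
      ⟨Real.sqrt_nonneg s, Real.sqrt_le_iff.2 ⟨ha.le, hs.2⟩⟩
      ⟨Real.sqrt_nonneg t, Real.sqrt_le_iff.2 ⟨ha.le, ht.2⟩⟩ (Real.sqrt_lt_sqrt hs.1 hst)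
    simpa only [Real.sq_sqrt hs.1, Real.sq_sqrt ht.1] using h4
  have hg : IsGreatest (Ioc (-Real.pi ^ 2) (0 : ℝ)) 0 :=
    ⟨⟨by linarith [sq_pos_of_pos hpi], le_rfl⟩, fun x hx => hx.2⟩
  have hl : IsLeast (Icc (0 : ℝ) (Real.arsinh r ^ 2)) 0 :=
    ⟨⟨le_rfl, sq_nonneg _⟩, fun x hx => hx.1⟩
  have h5 := h1.union h2 hg hl
  rwa [Ioc_union_Icc_eq_Ioc (by linarith [sq_pos_of_pos hpi]) (sq_nonneg _)] at h5

/-- The height decreases strictly from infinity, at `σ = -π²`, to zero at the straight segment. -/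
theorem existsUnique_height {r v : ℝ} (hr : 0 < r) (hv : 0 < v) :
    ∃! σ, σ ∈ Ioo (-Real.pi ^ 2) (Real.arsinh r ^ 2) ∧ height r σ = v := by
  have hpi := Real.pi_pos
  obtain ⟨δ, hδ0, hδ1, hδ⟩ := exists_small (N := 0) (v := v) hr (half_pos hpi)
  have hx : Real.pi - δ ∈ Ioo 0 Real.pi := ⟨by linarith, by linarith⟩
  have h1 := lt_turnHeight hr hx (by linarith) hδ0
    (by rw [Real.sin_pi_sub]; exact Real.sin_le hδ0.le) hδ
  rw [← height_neg_sq hx] at h1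
  have hlow : -Real.pi ^ 2 < -(Real.pi - δ) ^ 2 := by nlinarith [hx.1]
  have hle : -(Real.pi - δ) ^ 2 ≤ Real.arsinh r ^ 2 := by
    nlinarith [sq_nonneg (Real.arsinh r), sq_nonneg (Real.pi - δ)]
  obtain ⟨σ, hσ, hσv⟩ := intermediate_value_Icc' hle
    ((continuousOn_height r).mono fun x hx => hlow.trans_le hx.1)
    (show v ∈ Icc (height r (Real.arsinh r ^ 2)) (height r (-(Real.pi - δ) ^ 2)) by
      rw [height_arsinh_sq hr]; exact ⟨hv.le, h1.le⟩)
  have hne : σ ≠ Real.arsinh r ^ 2 := by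
    rintro rfl
    rw [height_arsinh_sq hr] at hσv
    exact hv.ne hσv
  refine ⟨σ, ⟨⟨hlow.trans_le hσ.1, lt_of_le_of_ne hσ.2 hne⟩, hσv⟩, ?_⟩
  rintro σ' ⟨h2, h3⟩
  exact (strictAntiOn_height hr).injOn ⟨h2.1, h2.2.le⟩ ⟨hlow.trans_le hσ.1, hσ.2⟩
    (h3.trans hσv.symm)

end CSU

namespace CSU

/-! ### The parameters of the arcs with given end point -/

/-- The parameters of the extremal arcs from the identity to `g`. -/
def params (g : CSU) : Set (ℂ × ℝ) := {p | arc p.1 p.2 1 = g}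

theorem mem_params {g : CSU} {b : ℂ} {m : ℝ} : (b, m) ∈ params g ↔ arc b m 1 = g := Iff.rfl

/-- The identity is excluded because all pairs `(0, m)` give the same constant path. For any other
end point `b ≠ 0`, and the path determines its parameters. -/
theorem encard_geodesics {g : CSU} (hg : g ≠ one) : (geodesics g).encard = (params g).encard := by
  let f : params g → Path one g := fun p => arcPath p.1.1 p.1.2 g p.2
  have hf : Function.Injective f := by
    intro p q h
    have hb : p.1.1 ≠ 0 := by
      intro h0
      have h1 : arc p.1.1 p.1.2 1 = g := p.2
      rw [h0, arc_zero_left] at h1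
      exact hg h1.symm
    obtain ⟨h1, h2⟩ := arcPath_injective hb h
    exact Subtype.ext (Prod.ext h1 h2)
  have h : geodesics g = range f := by
    ext p
    rw [mem_geodesics_iff]
    constructor
    · rintro ⟨b, m, h, rfl⟩
      exact ⟨⟨(b, m), h⟩, rfl⟩
    · rintro ⟨p, rfl⟩
      exact ⟨p.1.1, p.1.2, p.2, rfl⟩
  rw [h, ← image_univ, hf.encard_image, encard_univ, encard]

theorem encard_params_star (c : ℝ) (w : ℂ) :
    (params (-c, star w)).encard = (params (c, w)).encard := by
  have hinj : Function.Injective fun p : ℂ × ℝ => (star p.1, -p.2) := by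
    rintro ⟨b, m⟩ ⟨b', m'⟩ h
    simp only [Prod.mk.injEq, star_inj, neg_inj] at h
    exact Prod.ext h.1 h.2
  rw [← hinj.encard_image]
  congr 1
  ext ⟨b, m⟩
  constructor
  · rintro ⟨⟨b', m'⟩, h, e⟩
    simp only [Prod.mk.injEq] at e
    rw [mem_params] at h ⊢
    rw [← e.1, ← e.2, arc_conj, h]
    simp
  · intro h
    refine ⟨(star b, -m), ?_, by simp⟩
    rw [mem_params] at h ⊢
    rw [arc_conj, h]

/-- The integrand is nonnegative, and positive at small positive times, where `S > 0`. Hence `c` has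
the sign of `-m`. -/
theorem exists_arc_fst_eq {b : ℂ} (hb : b ≠ 0) (m : ℝ) : ∃ I > 0, (arc b m 1).1 = -m * I := by
  refine ⟨_, ?_, rfl⟩
  set σ := ‖b‖ ^ 2 - m ^ 2
  have hR : 0 < ‖b‖ := norm_pos_iff.2 hb
  have hS := continuous_S σ
  obtain ⟨x, hx0, hx1, hx⟩ : ∃ x : ℝ, 0 < x ∧ x ≤ 1 ∧ -σ * x ^ 2 < Real.pi ^ 2 := by
    have h1 : ∀ᶠ d in 𝓝 (0 : ℝ), -σ * d ^ 2 < Real.pi ^ 2 :=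
      (by fun_prop : Continuous fun d : ℝ => -σ * d ^ 2).continuousAt.eventually_lt_const
        (by simpa using sq_pos_of_pos Real.pi_pos)
    obtain ⟨d, h1, h2, h3⟩ := ((h1.filter_mono nhdsWithin_le_nhds).and
      (((eventually_lt_nhds one_pos).filter_mono nhdsWithin_le_nhds).and
        (self_mem_nhdsWithin : Ioi (0 : ℝ) ∈ 𝓝[>] (0 : ℝ)))).exists
    exact ⟨d, h3, h2.le, h1⟩
  refine intervalIntegral.integral_pos one_pos
    ((by fun_prop : Continuous _).div (by fun_prop) fun s => by positivity).continuousOn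
    (fun s _ => by positivity) ⟨x, ⟨hx0.le, hx1⟩, ?_⟩
  have := S_pos hx0 hx
  positivity

theorem pos_of_arc_fst_neg {b : ℂ} {m : ℝ} (h : (arc b m 1).1 < 0) : 0 < m := by
  have hb : b ≠ 0 := by
    rintro rfl
    simp [arc_zero_left, one] at h
  obtain ⟨I, hI, e⟩ := exists_arc_fst_eq hb m
  rw [e] at h
  by_contra! hm
  nlinarith

/-- The argument along an arc stays close to the rotation angle. -/
theorem abs_arcArg_sub_lt {b : ℂ} {m ν : ℝ} (hν : 0 < ν) (hm : 0 < m)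
    (h : ‖b‖ ^ 2 - m ^ 2 = -ν ^ 2) {t : ℝ} (ht : 0 ≤ t) : |arcArg b m t - ν * t| < Real.pi / 2 := by
  have hneg : -ν ^ 2 < 0 := by nlinarith
  -- Up to a positive factor this cosine is `cos² (ν s) + (m / ν) sin² (ν s)`. Since it never
  -- vanishes and the difference starts at zero, the difference cannot reach `±π / 2`.
  have hcos : ∀ s, 0 < Real.cos (arcArg b m s - ν * s) := by
    intro s
    have h1 := cos_arcArg b m s
    have h2 := sin_arcArg b m s
    rw [h, C_of_neg hneg, neg_neg, Real.sqrt_sq hν.le] at h1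
    rw [h, S_of_neg hneg, neg_neg, Real.sqrt_sq hν.le] at h2
    have h3 := sqrt_one_add_pos (arc b m s).2
    refine pos_of_mul_pos_right (a := √(1 + ‖(arc b m s).2‖ ^ 2)) ?_ h3.le
    have h4 : √(1 + ‖(arc b m s).2‖ ^ 2) * Real.cos (arcArg b m s - ν * s) =
        Real.cos (ν * s) ^ 2 + m / ν * Real.sin (ν * s) ^ 2 := by
      rw [Real.cos_sub]
      linear_combination Real.cos (ν * s) * h1 + Real.sin (ν * s) * h2
    rw [h4]
    have h5 := Real.sin_sq_add_cos_sq (ν * s)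
    rcases eq_or_ne (Real.cos (ν * s)) 0 with h6 | h6
    · rw [h6] at h5 ⊢
      have : Real.sin (ν * s) ^ 2 = 1 := by linarith
      rw [this]; positivity
    · positivity
  by_contra! hge
  have hcont : Continuous fun s => |arcArg b m s - ν * s| :=
    ((continuous_arcArg b m).sub (by fun_prop)).abs
  obtain ⟨s, -, hs⟩ := intermediate_value_Icc ht hcont.continuousOn
    (show Real.pi / 2 ∈ Icc _ _ from ⟨by simp [arcArg_zero]; positivity, hge⟩)
  have h1 := hcos s
  rw [← Real.cos_abs] at h1
  simp only at hs
  rw [hs, Real.cos_pi_div_two] at h1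
  exact lt_irrefl _ h1

/-- Since the argument is within `π / 2` of `x + π n`, subtracting `π n` leaves `A` between `-π / 2`
and `3π / 2`. As `sin A ≥ 0`, it lies in `[0, π]`, where `arccos` recovers it. The case `x = 0`
serves the points with `w = 0`. -/
theorem arc_fst_eq_of_turn {b : ℂ} {m x : ℝ} {n : ℕ} (hm : 0 < m) (hx : x ∈ Ico 0 Real.pi)
    (hpos : 0 < x + Real.pi * n) (h : ‖b‖ ^ 2 - m ^ 2 = -(x + Real.pi * n) ^ 2) :
    (arc b m 1).1 =
      Real.pi * n + Real.arccos (Real.cos x / √(1 + ‖(arc b m 1).2‖ ^ 2)) - m := by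
  have h0 := abs_lt.1 (abs_arcArg_sub_lt hpos hm h zero_le_one)
  have h1 := cos_arcArg b m 1
  have h2 := sin_arcArg b m 1
  have h3 := sqrt_one_add_pos (arc b m 1).2
  rw [h, C_neg_sq hpos] at h1
  rw [h, S_neg_sq hpos] at h2
  set q := √(1 + ‖(arc b m 1).2‖ ^ 2)
  obtain ⟨A, hA⟩ : ∃ A, A = arcArg b m 1 - Real.pi * n := ⟨_, rfl⟩
  have hA' : arcArg b m 1 = A + n * Real.pi := by rw [hA]; ring
  have hpi : x + Real.pi * n = x + n * Real.pi := by ring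
  have hsq : ((-1 : ℝ) ^ n) * (-1) ^ n = 1 := by rw [← mul_pow]; simp
  rw [hA', hpi, Real.cos_add_nat_mul_pi, Real.cos_add_nat_mul_pi] at h1
  rw [hA', hpi, Real.sin_add_nat_mul_pi, Real.sin_add_nat_mul_pi] at h2
  have hc : q * Real.cos A = Real.cos x := by
    linear_combination (-1 : ℝ) ^ n * h1 + (Real.cos x - q * Real.cos A) * hsq
  have hs : q * Real.sin A = m / (x + n * Real.pi) * Real.sin x := by
    linear_combination (-1 : ℝ) ^ n * h2 +
      (m / (x + n * Real.pi) * Real.sin x - q * Real.sin A) * hsq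
  have hs0 : 0 ≤ q * Real.sin A := by
    rw [hs, ← hpi]
    exact mul_nonneg (by positivity) (Real.sin_nonneg_of_nonneg_of_le_pi hx.1 hx.2.le)
  have hs1 : 0 ≤ Real.sin A := nonneg_of_mul_nonneg_right hs0 h3
  have hA1 : A ∈ Ioo (-(Real.pi / 2)) (3 * Real.pi / 2) :=
    ⟨by linarith [h0.1, hx.1], by linarith [h0.2, hx.2]⟩
  have hA2 : 0 ≤ A := by
    by_contra! hlt
    linarith [Real.sin_neg_of_neg_of_neg_pi_lt hlt (by linarith [hA1.1, Real.pi_pos])]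
  have hA3 : A ≤ Real.pi := by
    by_contra! hlt
    have := Real.sin_pos_of_pos_of_lt_pi (x := A - Real.pi) (by linarith)
      (by linarith [hA1.2, Real.pi_pos])
    rw [Real.sin_sub_pi] at this
    linarith
  rw [← hc, mul_div_cancel_left₀ _ h3.ne', Real.arccos_cos hA2 hA3, hA, arcArg]
  ring

theorem arc_snd_ne_zero_iff {b : ℂ} {m : ℝ} :
    (arc b m 1).2 ≠ 0 ↔ b ≠ 0 ∧ S (‖b‖ ^ 2 - m ^ 2) 1 ≠ 0 := by
  rw [← norm_ne_zero_iff, norm_arc_snd, mul_ne_zero_iff, norm_ne_zero_iff, abs_ne_zero]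

/-- The control of an arc is determined by `σ`, `m` and the end point. -/
theorem eq_control {b : ℂ} {m : ℝ} (h : (arc b m 1).2 ≠ 0) :
    b = control (‖b‖ ^ 2 - m ^ 2) m (arc b m 1).2 := by
  have hS : (S (‖b‖ ^ 2 - m ^ 2) 1 : ℂ) ≠ 0 := by exact_mod_cast (arc_snd_ne_zero_iff.1 h).2
  have := Complex.exp_ne_zero (Complex.I * m)
  rw [control, arc, mul_one]
  field_simp

theorem sq_eq_of_arc {b : ℂ} {m : ℝ} (h : (arc b m 1).2 ≠ 0) :
    m ^ 2 = ‖(arc b m 1).2‖ ^ 2 / S (‖b‖ ^ 2 - m ^ 2) 1 ^ 2 - (‖b‖ ^ 2 - m ^ 2) := by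
  have hS := (arc_snd_ne_zero_iff.1 h).2
  rw [norm_arc_snd_sq]
  field_simp
  ring

/-! ### The number of arcs to a point off the vertical line -/

/-- The values of `σ = ‖b‖ ^ 2 - m ^ 2` on the parameters of arcs to `g`. -/
def sigmas (g : CSU) : Set ℝ := (fun p : ℂ × ℝ => ‖p.1‖ ^ 2 - p.2 ^ 2) '' params g

/-- The end point and `σ` determine `m²`, then `m`, because `c < 0` forces `m > 0`, and finally `b`,
by `eq_control`. -/
theorem encard_sigmas {c : ℝ} {w : ℂ} (hc : c < 0) (hw : w ≠ 0) :
    (sigmas (c, w)).encard = (params (c, w)).encard := by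
  refine InjOn.encard_image ?_
  rintro ⟨b, m⟩ hp ⟨b', m'⟩ hp' h
  rw [mem_params] at hp hp'
  simp only at h
  have hm := pos_of_arc_fst_neg (b := b) (m := m) (by rw [hp]; exact hc)
  have hm' := pos_of_arc_fst_neg (b := b') (m := m') (by rw [hp']; exact hc)
  have h2 : (arc b m 1).2 ≠ 0 := by rw [hp]; exact hw
  have h2' : (arc b' m' 1).2 ≠ 0 := by rw [hp']; exact hw
  have h3 : m ^ 2 = m' ^ 2 := by
    rw [sq_eq_of_arc h2, sq_eq_of_arc h2', h, hp, hp']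
  have h4 : m = m' := (pow_left_inj₀ hm.le hm'.le two_ne_zero).1 h3
  have h5 := eq_control h2
  rw [h, hp, h4, ← hp', ← eq_control h2'] at h5
  rw [h4, h5]

theorem mem_sigmas {σ m c : ℝ} {w : ℂ} (hS : S σ 1 ≠ 0) (hm : m ^ 2 = ‖w‖ ^ 2 / S σ 1 ^ 2 - σ)
    (h : (arc (control σ m w) m 1).1 = c) : σ ∈ sigmas (c, w) := by
  obtain ⟨h1, h2⟩ := arc_control_snd hS hm
  exact ⟨(control σ m w, m), Prod.ext h h2, h1⟩

theorem exists_of_mem_sigmas {σ c : ℝ} {w : ℂ} (hc : c < 0) (hw : w ≠ 0) (h : σ ∈ sigmas (c, w)) :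
    ∃ (b : ℂ) (m : ℝ), 0 < m ∧ ‖b‖ ^ 2 - m ^ 2 = σ ∧ arc b m 1 = (c, w) ∧ S σ 1 ≠ 0 ∧
      m ^ 2 = ‖w‖ ^ 2 / S σ 1 ^ 2 - σ := by
  obtain ⟨⟨b, m⟩, hp, rfl⟩ := h
  rw [mem_params] at hp
  simp only
  have h2 : (arc b m 1).2 ≠ 0 := by rw [hp]; exact hw
  have h3 := sq_eq_of_arc h2
  rw [hp] at h3
  exact ⟨b, m, pos_of_arc_fst_neg (by rw [hp]; exact hc), rfl, hp, (arc_snd_ne_zero_iff.1 h2).2, h3⟩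

/-- The upper bound on `σ` expresses `m² > 0`: for positive `σ` it reads `sinh √σ < ‖w‖`. -/
theorem sigmas_inter_Ioi {c : ℝ} {w : ℂ} (hc : c < 0) (hw : w ≠ 0) :
    sigmas (c, w) ∩ Ioi (-Real.pi ^ 2) =
      {σ | σ ∈ Ioo (-Real.pi ^ 2) (Real.arsinh ‖w‖ ^ 2) ∧ height ‖w‖ σ = -c} := by
  have hr : 0 < ‖w‖ := norm_pos_iff.2 hw
  ext σ
  constructor
  · rintro ⟨h, hσ⟩
    rw [mem_Ioi] at hσ
    obtain ⟨b, m, hm, e, h, hS, hm2⟩ := exists_of_mem_sigmas hc hw h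
    refine ⟨⟨hσ, ?_⟩, ?_⟩
    · have ha := Real.arsinh_pos_iff.2 hr
      rcases le_or_gt σ 0 with h0 | h0
      · exact h0.trans_lt (by positivity)
      · have h1 := Real.sqrt_pos.2 h0
        have h2 := Real.sinh_pos_iff.2 h1
        rw [S_of_pos h0, mul_one, div_pow, Real.sq_sqrt h0.le] at hm2
        have h3 : 0 < ‖w‖ ^ 2 / (Real.sinh √σ ^ 2 / σ) - σ := hm2 ▸ sq_pos_of_pos hm
        rw [sub_pos, div_div_eq_mul_div, lt_div_iff₀ (by positivity), mul_comm,
          mul_lt_mul_iff_left₀ h0] at h3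
        have h4 := lt_of_pow_lt_pow_left₀ 2 hr.le h3
        rw [← Real.sqrt_lt' ha, ← Real.sinh_lt_sinh, Real.sinh_arsinh]
        exact h4
    · have h1 := arc_fst_eq_arccos (b := b) hm.le (by rw [e]; linarith)
      rw [h, e] at h1
      rw [height, ← hm2, Real.sqrt_sq hm.le]
      simp only at h1
      linarith
  · rintro ⟨hσ, h⟩
    refine ⟨?_, hσ.1⟩
    have h0 := (sq_div_sub_pos hr hσ.1 hσ.2).le
    refine mem_sigmas (S_one_pos hσ.1).ne' (Real.sq_sqrt h0) ?_
    rw [arc_control_eq hσ.1 h0, h, neg_neg]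

theorem encard_sigmas_inter_Ioi {c : ℝ} {w : ℂ} (hc : c < 0) (hw : w ≠ 0) :
    (sigmas (c, w) ∩ Ioi (-Real.pi ^ 2)).encard = 1 := by
  rw [sigmas_inter_Ioi hc hw, encard_eq_one]
  obtain ⟨σ, h, hu⟩ := existsUnique_height (norm_pos_iff.2 hw) (neg_pos.2 hc)
  exact ⟨σ, eq_singleton_iff_unique_mem.2 ⟨h, hu⟩⟩

theorem sin_sq_add_pi_mul (x : ℝ) (n : ℕ) : Real.sin (x + Real.pi * n) ^ 2 = Real.sin x ^ 2 := by
  rw [mul_comm, Real.sin_add_nat_mul_pi, mul_pow, ← pow_mul, mul_comm n 2, pow_mul]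
  simp

theorem sq_turn {x r : ℝ} {n : ℕ} (hx : x ∈ Ioo 0 Real.pi) (hpos : 0 < x + Real.pi * n) :
    ((x + Real.pi * n) * √(1 + r ^ 2 / Real.sin x ^ 2)) ^ 2 =
      r ^ 2 / S (-(x + Real.pi * n) ^ 2) 1 ^ 2 - -(x + Real.pi * n) ^ 2 := by
  have hs := Real.sin_pos_of_mem_Ioo hx
  rw [S_neg_sq hpos, div_pow, sin_sq_add_pi_mul, mul_pow, Real.sq_sqrt (by positivity)]
  field_simp
  ring

/-- Write `√(-σ) = x + π n`. The end `x = 0` drops out because `S` vanishes there while `w ≠ 0`.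
Otherwise `m = (x + π n) √(1 + ‖w‖² / sin² x)`, and `arc_fst_eq_of_turn` turns the condition on `c`
into an equation for `turnHeight`. -/
theorem sigmas_inter_Ioc {c : ℝ} {w : ℂ} (hc : c < 0) (hw : w ≠ 0) {n : ℕ} (hn : 1 ≤ n) :
    sigmas (c, w) ∩ Ioc (-(Real.pi * (n + 1)) ^ 2) (-(Real.pi * n) ^ 2) =
      (fun x => -(x + Real.pi * n) ^ 2) ''
        {x ∈ Ioo 0 Real.pi | turnHeight (Real.pi * n) ‖w‖ x = -c} := by
  have hr : 0 < ‖w‖ := norm_pos_iff.2 hw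
  have hpi := Real.pi_pos
  have hn : 0 < Real.pi * n := by
    have : (1 : ℝ) ≤ n := by exact_mod_cast hn
    positivity
  ext σ
  constructor
  · rintro ⟨h, hσ⟩
    obtain ⟨b, m, hm, e, h, hS, hm2⟩ := exists_of_mem_sigmas hc hw h
    have h0 : 0 ≤ -σ := by nlinarith [hσ.2, sq_nonneg (Real.pi * n)]
    obtain ⟨x, hx⟩ : ∃ x, x = √(-σ) - Real.pi * n := ⟨_, rfl⟩
    have hσx : -(x + Real.pi * n) ^ 2 = σ := by
      rw [hx, sub_add_cancel, Real.sq_sqrt h0, neg_neg]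
    have hx0 : 0 ≤ x := by
      rw [hx, sub_nonneg]
      exact Real.le_sqrt_of_sq_le (by linarith [hσ.2])
    have hx1 : x < Real.pi := by
      rw [hx, sub_lt_iff_lt_add, Real.sqrt_lt' (by positivity)]
      linarith [hσ.1, (by ring : (Real.pi + Real.pi * n) ^ 2 = (Real.pi * (n + 1)) ^ 2)]
    have hx0' : 0 < x := by
      refine lt_of_le_of_ne hx0 fun h1 => hS ?_
      rw [← hσx, ← h1, zero_add]
      rw [S_neg_sq hn, mul_comm, Real.sin_nat_mul_pi, zero_div]
    have hpos : 0 < x + Real.pi * n := by linarith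
    have h1 := arc_fst_eq_of_turn hm ⟨hx0, hx1⟩ hpos (e.trans hσx.symm)
    have hm3 : m = (x + Real.pi * n) * √(1 + ‖w‖ ^ 2 / Real.sin x ^ 2) := by
      refine (pow_left_inj₀ hm.le (by positivity) two_ne_zero).1 ?_
      rw [sq_turn ⟨hx0', hx1⟩ hpos, hσx, hm2]
    rw [h] at h1
    simp only at h1
    refine ⟨x, ⟨⟨hx0', hx1⟩, ?_⟩, hσx⟩
    rw [turnHeight, ← hm3]
    linarith
  · rintro ⟨x, ⟨hx, h⟩, rfl⟩
    have hs := Real.sin_pos_of_mem_Ioo hx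
    have hpos : 0 < x + Real.pi * n := by linarith [hx.1]
    have hS : S (-(x + Real.pi * n) ^ 2) 1 ≠ 0 := by
      rw [← sq_pos_iff, S_neg_sq hpos, div_pow, sin_sq_add_pi_mul]
      positivity
    have hm2 := sq_turn (r := ‖w‖) hx hpos
    obtain ⟨h1, h2⟩ := arc_control_snd hS hm2
    refine ⟨mem_sigmas hS hm2 ?_, ?_, ?_⟩
    · rw [arc_fst_eq_of_turn (by positivity) ⟨hx.1.le, hx.2⟩ hpos h1, h2]
      rw [turnHeight] at h
      linarith
    · rw [neg_lt_neg_iff]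
      exact pow_lt_pow_left₀ (by linarith [hx.2]) hpos.le two_ne_zero
    · rw [neg_le_neg_iff]
      exact pow_le_pow_left₀ hn.le (by linarith [hx.1]) 2

theorem sigmas_inter_Ioi_succ (c : ℝ) (w : ℂ) (n : ℕ) :
    (sigmas (c, w) ∩ Ioi (-(Real.pi * (n + 1)) ^ 2)).encard =
      (sigmas (c, w) ∩ Ioi (-(Real.pi * n) ^ 2)).encard +
      (sigmas (c, w) ∩ Ioc (-(Real.pi * (n + 1)) ^ 2) (-(Real.pi * n) ^ 2)).encard := by
  have hle : -(Real.pi * (n + 1)) ^ 2 ≤ -(Real.pi * n) ^ 2 := by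
    have := Real.pi_pos
    rw [neg_le_neg_iff]
    gcongr
    linarith
  rw [← encard_union_eq, ← inter_union_distrib_left, union_comm, Ioc_union_Ioi_eq_Ioi hle]
  refine disjoint_left.2 fun σ h1 h2 => ?_
  exact absurd h2.2.2 (not_le.2 h1.2)

theorem encard_sigmas_inter_Ioc {c : ℝ} {w : ℂ} (hc : c < 0) (hw : w ≠ 0) {n : ℕ} (hn : 1 ≤ n) :
    (-c < threshold n w →
      sigmas (c, w) ∩ Ioc (-(Real.pi * (n + 1)) ^ 2) (-(Real.pi * n) ^ 2) = ∅) ∧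
    (threshold n w = -c →
      (sigmas (c, w) ∩ Ioc (-(Real.pi * (n + 1)) ^ 2) (-(Real.pi * n) ^ 2)).encard = 1) ∧
    (threshold n w < -c →
      (sigmas (c, w) ∩ Ioc (-(Real.pi * (n + 1)) ^ 2) (-(Real.pi * n) ^ 2)).encard = 2) := by
  have hpi := Real.pi_pos
  have hnπ : Real.pi / 2 ≤ Real.pi * n := by
    have : (1 : ℝ) ≤ n := by exact_mod_cast hn
    nlinarith
  have hinj : InjOn (fun x => -(x + Real.pi * n) ^ 2)
      {x ∈ Ioo 0 Real.pi | turnHeight (Real.pi * n) ‖w‖ x = -c} := by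
    intro x hx y hy h
    have hx0 := hx.1.1
    have hy0 := hy.1.1
    have := (pow_left_inj₀ (by linarith) (by linarith) two_ne_zero).1 (neg_inj.1 h)
    linarith
  obtain ⟨h0, h1, h2, hfin⟩ := ncard_turnHeight (v := -c) hnπ (norm_pos_iff.2 hw)
    (turnMin_mem' hn) (turnSlope_turnMin hn)
  rw [turnHeight_turnMin hn] at h0 h1 h2
  rw [sigmas_inter_Ioc hc hw hn, hinj.encard_image, ← hfin.cast_ncard_eq]
  refine ⟨fun h => ?_, fun h => by rw [h1 h.symm]; rfl, fun h => by rw [h2 h]; rfl⟩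
  rw [image_eq_empty]
  exact (ncard_eq_zero hfin).1 (h0 h)

/-- One value from `σ > -π²`, and two from each of the next `k` bands. -/
theorem encard_sigmas_inter_Ioi_of_lt {c : ℝ} {w : ℂ} (hc : c < 0) (hw : w ≠ 0) (k : ℕ)
    (h : ∀ n, 1 ≤ n → n ≤ k → threshold n w < -c) :
    (sigmas (c, w) ∩ Ioi (-(Real.pi * (k + 1)) ^ 2)).encard = 2 * k + 1 := by
  induction k with
  | zero => simpa using encard_sigmas_inter_Ioi hc hw
  | succ k ih =>
    rw [sigmas_inter_Ioi_succ]
    push_cast at ih ⊢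
    rw [ih fun n h1 h2 => h n h1 (by omega)]
    have := (encard_sigmas_inter_Ioc hc hw (n := k + 1) (by omega)).2.2 (h _ (by omega) le_rfl)
    push_cast at this
    rw [this]
    ring

/-- Any lower `σ` would lie in the band with index `⌊√(-σ) / π⌋ > k`, which contains no solution
because its threshold exceeds `|c|`. -/
theorem sigmas_subset_Ioi {c : ℝ} {w : ℂ} (hc : c < 0) (hw : w ≠ 0) (k : ℕ)
    (h : ∀ n, k < n → -c < threshold n w) :
    sigmas (c, w) ∩ Ioi (-(Real.pi * (k + 1)) ^ 2) = sigmas (c, w) := by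
  have hpi := Real.pi_pos
  rw [inter_eq_left]
  intro σ hσ
  by_contra hle
  rw [mem_Ioi, not_lt] at hle
  have h0 : 0 ≤ -σ := by nlinarith [sq_nonneg (Real.pi * (k + 1))]
  have h1 : (k : ℝ) + 1 ≤ √(-σ) / Real.pi := by
    rw [le_div_iff₀ hpi, mul_comm]
    exact Real.le_sqrt_of_sq_le (by linarith)
  have h2 : k < ⌊√(-σ) / Real.pi⌋₊ := Nat.le_floor (by exact_mod_cast h1)
  have h3 := Nat.floor_le (a := √(-σ) / Real.pi) (by positivity)
  have h4 := Nat.lt_floor_add_one (√(-σ) / Real.pi)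
  rw [le_div_iff₀ hpi, mul_comm] at h3
  rw [div_lt_iff₀ hpi, mul_comm] at h4
  have h5 := (encard_sigmas_inter_Ioc hc hw (by omega)).1 (h _ h2)
  refine (eq_empty_iff_forall_notMem.1 h5 σ) ⟨hσ, ?_, ?_⟩
  · rw [Real.sqrt_lt' (by positivity)] at h4
    linarith
  · have := pow_le_pow_left₀ (by positivity) h3 2
    rw [Real.sq_sqrt h0] at this
    linarith

/-- The number of geodesics to a point that lies strictly between two thresholds. -/
theorem encard_params_of_lt {c : ℝ} {w : ℂ} (hc : c < 0) (hw : w ≠ 0) (k : ℕ)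
    (h : ∀ n, 1 ≤ n → n ≤ k → threshold n w < -c) (h' : ∀ n, k < n → -c < threshold n w) :
    (params (c, w)).encard = 2 * k + 1 := by
  rw [← encard_sigmas hc hw, ← sigmas_subset_Ioi hc hw k h',
    encard_sigmas_inter_Ioi_of_lt hc hw k h]

/-- The number of geodesics to a point on a threshold. -/
theorem encard_params_of_eq {c : ℝ} {w : ℂ} (hc : c < 0) (hw : w ≠ 0) {k : ℕ} (hk : 1 ≤ k)
    (h : threshold k w = -c) : (params (c, w)).encard = 2 * k := by
  rw [← encard_sigmas hc hw, ← sigmas_subset_Ioi hc hw k fun n hn => h ▸ threshold_lt hk hn hw]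
  -- The bands before the last give `2j + 1` and the last, at its minimum, gives one: together `2(j
  -- + 1)`.
  obtain ⟨k, rfl⟩ : ∃ j, k = j + 1 := ⟨k - 1, by omega⟩
  rw [sigmas_inter_Ioi_succ, (encard_sigmas_inter_Ioc hc hw hk).2.1 h]
  push_cast
  rw [encard_sigmas_inter_Ioi_of_lt hc hw k fun n h1 h2 => h ▸ threshold_lt h1 (by omega) hw]
  ring

/-! ### The arcs to the points of the vertical line -/

/-- The rotation parameter of the arc that turns `n` times by `π` before it reaches `(c, 0)`. -/
def axisRate (c : ℝ) (n : ℕ) : ℝ := -(c / |c|) * (Real.pi * n + |c|)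

/-- The speed of the arc that turns `n` times by `π` before it reaches `(c, 0)`. -/
def axisSpeed (c : ℝ) (n : ℕ) : ℝ := √(c ^ 2 + 2 * Real.pi * n * |c|)

/-- Since `b ≠ 0`, the arc returns to `w = 0` only if `S σ 1 = 0`, that is `√(-σ) = π n`. The
argument is then exactly `π n`, so `c = π n - m`. -/
theorem arc_eq_axis_iff {c : ℝ} (hc : c < 0) {b : ℂ} {m : ℝ} :
    arc b m 1 = (c, 0) ↔ ∃ n : ℕ, 1 ≤ n ∧ m = Real.pi * n - c ∧
      ‖b‖ ^ 2 - m ^ 2 = -(Real.pi * n) ^ 2 := by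
  have hpi := Real.pi_pos
  constructor
  · intro h
    have hm := pos_of_arc_fst_neg (b := b) (m := m) (by rw [h]; exact hc)
    have hb : b ≠ 0 := by
      rintro rfl
      rw [arc_zero_left, one, Prod.mk.injEq] at h
      exact hc.ne h.1.symm
    have hS : S (‖b‖ ^ 2 - m ^ 2) 1 = 0 := by
      by_contra hS
      exact arc_snd_ne_zero_iff.2 ⟨hb, hS⟩ (by rw [h])
    have hσ : ‖b‖ ^ 2 - m ^ 2 < 0 := by
      by_contra! h0
      linarith [one_le_S_one h0]
    have hν : 0 < √(-(‖b‖ ^ 2 - m ^ 2)) := Real.sqrt_pos.2 (by linarith)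
    rw [S_of_neg hσ, mul_one, div_eq_zero_iff, or_iff_left hν.ne', Real.sin_eq_zero_iff] at hS
    obtain ⟨z, hz⟩ := hS
    have hz0 : 0 < z := by
      have : 0 < (z : ℝ) := by
        rw [← hz] at hν
        exact pos_of_mul_pos_left hν hpi.le
      exact_mod_cast this
    lift z to ℕ using hz0.le with n
    have hn : 1 ≤ n := by exact_mod_cast hz0
    have e : ‖b‖ ^ 2 - m ^ 2 = -(Real.pi * n) ^ 2 := by
      have : (Real.pi * n) = √(-(‖b‖ ^ 2 - m ^ 2)) := by rw [← hz]; push_cast; ring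
      rw [this, Real.sq_sqrt (by linarith)]; ring
    have h1 := arc_fst_eq_of_turn (x := 0) hm ⟨le_rfl, hpi⟩ (by positivity) (by rw [zero_add, e])
    rw [h] at h1
    simp at h1
    exact ⟨n, hn, by linarith, e⟩
  · rintro ⟨n, hn, hm, e⟩
    have hn' : 0 < Real.pi * n := by positivity
    have h2 : (arc b m 1).2 = 0 := by
      rw [arc, e, S_neg_sq hn', mul_comm Real.pi, Real.sin_nat_mul_pi]
      simp
    have h1 := arc_fst_eq_of_turn (x := 0) (b := b) (m := m) (n := n) (by linarith) ⟨le_rfl, hpi⟩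
      (by positivity) (by rw [zero_add, e])
    rw [h2] at h1
    refine Prod.ext ?_ h2
    rw [h1, hm]
    simp

/-- Reflection covers both signs of `c`. The speed comes from `‖b‖² = (π n + |c|)² - (π n)²`. -/
theorem arc_eq_axis_iff' {c : ℝ} (hc : c ≠ 0) {b : ℂ} {m : ℝ} :
    arc b m 1 = (c, 0) ↔ ∃ n : ℕ, 1 ≤ n ∧ m = axisRate c n ∧ ‖b‖ = axisSpeed c n := by
  have hpi := Real.pi_pos
  have key : ∀ (n : ℕ) (m : ℝ), m ^ 2 = (Real.pi * n + |c|) ^ 2 →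
      (‖b‖ ^ 2 - m ^ 2 = -(Real.pi * n) ^ 2 ↔ ‖b‖ = axisSpeed c n) := by
    intro n m hm
    rw [axisSpeed, eq_comm (a := ‖b‖), Real.sqrt_eq_iff_eq_sq (by positivity) (norm_nonneg b), hm,
      ← sq_abs c]
    constructor <;> intro h <;> linarith
  rcases lt_or_gt_of_ne hc with h | h
  · rw [arc_eq_axis_iff h]
    have h0 : c / |c| = -1 := by rw [abs_of_neg h, div_neg, div_self hc]
    refine exists_congr fun n => and_congr_right fun _ => ?_
    rw [axisRate, h0, neg_neg, one_mul, abs_of_neg h, ← sub_eq_add_neg]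
    refine and_congr_right fun hm => key n m ?_
    rw [hm, abs_of_neg h, sub_eq_add_neg]
  · have h1 : arc b m 1 = (c, 0) ↔ arc (star b) (-m) 1 = (-c, 0) := by
      rw [arc_conj, Prod.ext_iff, Prod.ext_iff]
      simp
    have h0 : c / |c| = 1 := by rw [abs_of_pos h, div_self hc]
    rw [h1, arc_eq_axis_iff (neg_neg_iff_pos.2 h)]
    refine exists_congr fun n => and_congr_right fun _ => ?_
    rw [axisRate, h0, abs_of_pos h, sub_neg_eq_add, neg_one_mul, neg_eq_iff_eq_neg, norm_star,
      neg_sq]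
    refine and_congr_right fun hm => key n m ?_
    rw [hm, abs_of_pos h, neg_sq]

end CSU

namespace CSU

/-! ### Rotations -/

/-- The rotation of the plane by a unit complex number, as a continuous linear map. -/
def rotation (u : ℂ) : CSU →L[ℝ] CSU :=
  (ContinuousLinearMap.id ℝ ℝ).prodMap (ContinuousLinearMap.mul ℝ ℂ u)

theorem rotation_apply (u : ℂ) (g : CSU) : rotation u g = (g.1, u * g.2) := rfl

theorem rotation_rotation {u v : ℂ} (h : u * v = 1) (g : CSU) : rotation u (rotation v g) = g := by
  simp [rotation_apply, ← mul_assoc, h]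

theorem mul_star_of_norm_eq_one {u : ℂ} (hu : ‖u‖ = 1) : u * star u = 1 := by
  rw [Complex.star_def, Complex.mul_conj, Complex.normSq_eq_norm_sq, hu]; simp

/-- The rotation as an equivalence. -/
def rotationEquiv (u : ℂ) (hu : ‖u‖ = 1) : CSU ≃ CSU where
  toFun := rotation u
  invFun := rotation (star u)
  left_inv := rotation_rotation (by rw [mul_comm, mul_star_of_norm_eq_one hu])
  right_inv := rotation_rotation (mul_star_of_norm_eq_one hu)

/-- The distribution and the metric involve `w` and `w'` only through `‖w‖`, `‖w'‖` and `conj w *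
w'`, which rotations preserve. -/
theorem isIsometry_rotationEquiv (u : ℂ) (hu : ‖u‖ = 1) : IsIsometry (rotationEquiv u hu) := by
  have hd : ∀ g, fderiv ℝ (rotationEquiv u hu) g = rotation u := fun g =>
    (rotation u).hasFDerivAt.fderiv
  have hm : ∀ g v : CSU, star (rotation u g).2 * (rotation u v).2 = star g.2 * v.2 := by
    intro g v
    rw [rotation_apply, rotation_apply, star_mul']
    linear_combination star g.2 * v.2 * mul_star_of_norm_eq_one hu
  have hn : ∀ g : CSU, ‖(rotation u g).2‖ = ‖g.2‖ := fun g => by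
    rw [rotation_apply, norm_mul, hu, one_mul]
  refine ⟨(rotation u).contDiff, (rotation (star u)).contDiff, fun g v => ?_, fun g v _ => ?_⟩
  · rw [hd, mem_distribution_iff, mem_distribution_iff]
    change (1 + ‖(rotation u g).2‖ ^ 2) * v.1 = -(star (rotation u g).2 * (rotation u v).2).im ↔ _
    rw [hm, hn]
  · rw [hd]
    change metric (rotation u g) _ = _
    rw [metric, metric, hm, hn, hn]
    rfl

/-! ### Geometric similarity -/

/-- Isometries preserve the speed of horizontal curves. It is compared at an interior time, where
agreement on `[0, 1]` gives agreement of derivatives. -/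
theorem norm_eq_of_similar {Φ : CSU ≃ CSU} (hΦ : IsIsometry Φ) {b b' : ℂ} {m m' : ℝ}
    (h : ∀ t ∈ Icc (0 : ℝ) 1, arc b' m' t = Φ (arc b m t)) : ‖b'‖ = ‖b‖ := by
  have h1 := (hΦ.contDiff.differentiable (by simp) (arc b m (1 / 2))).hasFDerivAt.comp_hasDerivAt
    (1 / 2 : ℝ) (hasDerivAt_arc b m (1 / 2))
  have h2 := h1.congr_of_eventuallyEq (f₁ := arc b' m') (by
    filter_upwards [Icc_mem_nhds (a := (0 : ℝ)) (b := 1) (x := 1 / 2) (by norm_num) (by norm_num)]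
      with t ht using h t ht)
  have h3 := arcVel_mem b m (1 / 2)
  rw [← speed_arc b' m' (1 / 2), ← speed_arc b m (1 / 2), speed, speed, h2.deriv,
    (hasDerivAt_arc b m (1 / 2)).deriv, h _ (by norm_num), hΦ.metric_eq _ _ h3]

theorem similar_of_norm_eq {b b' : ℂ} (m : ℝ) (h : ‖b'‖ = ‖b‖) :
    ∃ Φ : CSU ≃ CSU, IsIsometry Φ ∧ ∀ t, arc b' m t = Φ (arc b m t) := by
  rcases eq_or_ne b 0 with rfl | hb
  · rw [norm_zero, norm_eq_zero] at h
    exact ⟨Equiv.refl CSU, IsIsometry.refl, fun t => by rw [h]; rfl⟩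
  have hu : ‖b' / b‖ = 1 := by rw [norm_div, h, div_self (norm_ne_zero_iff.2 hb)]
  refine ⟨rotationEquiv (b' / b) hu, isIsometry_rotationEquiv _ hu, fun t => ?_⟩
  conv_lhs => rw [← div_mul_cancel₀ b' hb, arc_rotate hu]
  rfl

/-! ### The points of the vertical line -/

section axis

variable {c : ℝ}

theorem axisSpeed_pos (hc : c ≠ 0) (n : ℕ) : 0 < axisSpeed c n := by
  have := Real.pi_pos
  exact Real.sqrt_pos.2 (by positivity)

theorem axisSpeed_injective (hc : c ≠ 0) : Function.Injective (axisSpeed c) := by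
  intro n n' h
  have hpi := Real.pi_pos
  have hc' := abs_pos.2 hc
  rw [axisSpeed, axisSpeed, Real.sqrt_inj (by positivity) (by positivity)] at h
  have h1 : 2 * Real.pi * |c| * (n : ℝ) = 2 * Real.pi * |c| * n' := by linarith
  exact_mod_cast mul_left_cancel₀ (by positivity : 2 * Real.pi * |c| ≠ 0) h1

theorem arc_axis (hc : c ≠ 0) {n : ℕ} (hn : 1 ≤ n) {b : ℂ} (hb : ‖b‖ = axisSpeed c n) :
    arc b (axisRate c n) 1 = (c, 0) :=
  (arc_eq_axis_iff' hc).2 ⟨n, hn, rfl, hb⟩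

theorem exists_of_mem_geodesics_axis (hc : c ≠ 0) (p : geodesics (c, 0)) : ∃ n : ℕ, ∃ b : ℂ,
    1 ≤ n ∧ ‖b‖ = axisSpeed c n ∧ ∀ t : unitInterval, p.1 t = arc b (axisRate c n) t := by
  obtain ⟨b, m, h, e⟩ := mem_geodesics_iff.1 p.2
  obtain ⟨n, hn, rfl, hb⟩ := (arc_eq_axis_iff' hc).1 h
  exact ⟨n, b, hn, hb, fun t => by rw [e]; rfl⟩

/-- The phase of the control is free. Phases in `(0, 1)` give distinct arcs, since the cosine is
injective on `[0, π]`. -/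
theorem not_countable_geodesics_axis (hc : c ≠ 0) : ¬ (geodesics (c, 0)).Countable := by
  intro h
  have hnorm : ∀ θ : ℝ, ‖(axisSpeed c 1 : ℂ) * Complex.exp (Complex.I * θ)‖ = axisSpeed c 1 := by
    intro θ
    rw [norm_mul, norm_exp_I_mul, mul_one, Complex.norm_real,
      Real.norm_of_nonneg (axisSpeed_pos hc 1).le]
  have harc := fun θ => arc_axis hc le_rfl (hnorm θ)
  have h1 : MapsTo (fun θ : ℝ => arcPath _ _ _ (harc θ)) (Ioo 0 1) (geodesics (c, 0)) :=
    fun θ _ => mem_geodesics_iff.2 ⟨_, _, harc θ, rfl⟩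
  have h2 : InjOn (fun θ : ℝ => arcPath _ _ _ (harc θ)) (Ioo 0 1) := by
    intro θ hθ θ' hθ' e
    have hR : (axisSpeed c 1 : ℂ) ≠ 0 := by exact_mod_cast (axisSpeed_pos hc 1).ne'
    have h3 := (arcPath_injective (mul_ne_zero hR (Complex.exp_ne_zero _)) e).1
    have h4 := congrArg Complex.re (mul_left_cancel₀ hR h3)
    rw [mul_comm, Complex.exp_ofReal_mul_I_re, mul_comm, Complex.exp_ofReal_mul_I_re] at h4
    have hpi := Real.pi_gt_three
    exact Real.injOn_cos ⟨hθ.1.le, by linarith [hθ.2]⟩ ⟨hθ'.1.le, by linarith [hθ'.2]⟩ h4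
  have h3 := h1.countable_of_injOn h2 h
  rw [Cardinal.Real.Ioo_countable_iff] at h3
  linarith

/-- The number `n` separates classes: arcs with the same `n` share `m` and `‖b‖`, so a rotation
carries one to the other. -/
theorem countable_quotient_axis (hc : c ≠ 0) :
    Countable (Quotient (geometricallySimilar (c, 0))) := by
  choose n b _ hb hp using exists_of_mem_geodesics_axis hc
  refine Function.Injective.countable (f := fun q => n q.out) fun q q' h => ?_
  rw [← q.out_eq, ← q'.out_eq]
  refine Quotient.sound ?_
  obtain ⟨Φ, hΦ, e⟩ := similar_of_norm_eq (axisRate c (n q.out)) (b := b q.out) (b' := b q'.out)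
    (by rw [hb, hb]; exact congrArg _ h.symm)
  refine ⟨Φ, hΦ, fun t => ?_⟩
  have h' : n q.out = n q'.out := h
  rw [hp, hp, ← e, h']

/-- Different `n` give different speeds, which isometries cannot change. -/
theorem infinite_quotient_axis (hc : c ≠ 0) :
    Infinite (Quotient (geometricallySimilar (c, 0))) := by
  have hb : ∀ n : ℕ, ‖(axisSpeed c (n + 1) : ℂ)‖ = axisSpeed c (n + 1) := fun n => by
    rw [Complex.norm_real, Real.norm_of_nonneg (axisSpeed_pos hc _).le]
  have harc := fun n : ℕ => arc_axis hc (Nat.le_add_left 1 n) (hb n)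
  refine Infinite.of_injective (fun n : ℕ => Quotient.mk _
    (⟨arcPath _ _ _ (harc n), mem_geodesics_iff.2 ⟨_, _, harc n, rfl⟩⟩ : geodesics (c, 0)))
    fun n n' h => ?_
  obtain ⟨Φ, hΦ, e⟩ := Quotient.exact h
  have h1 := norm_eq_of_similar hΦ fun t ht => e ⟨t, ht⟩
  rw [hb, hb] at h1
  have := axisSpeed_injective hc h1
  omega

end axis

/-! ### The points of the horizontal space -/

theorem eq_zero_or_eq_zero_of_arc_fst {b : ℂ} {m : ℝ} (h : (arc b m 1).1 = 0) : b = 0 ∨ m = 0 := by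
  by_contra! h0
  obtain ⟨I, hI, e⟩ := exists_arc_fst_eq h0.1 m
  rw [e] at h
  exact mul_ne_zero (neg_ne_zero.2 h0.2) hI.ne' h

theorem fst_eq_zero_of_mem_geodesics {w : ℂ} {p : Path one (0, w)} (hp : p ∈ geodesics (0, w))
    (t : unitInterval) : (p t).1 = 0 := by
  obtain ⟨b, m, h, rfl⟩ := mem_geodesics_iff.1 hp
  change (arc b m t).1 = 0
  rcases eq_zero_or_eq_zero_of_arc_fst (b := b) (m := m) (by rw [h]) with rfl | rfl
  · rw [arc_zero_left]; rfl
  · simp [arc]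

theorem norm_eq_arsinh {b : ℂ} (hb : b ≠ 0) : ‖b‖ = Real.arsinh ‖(arc b 0 1).2‖ := by
  have hR : 0 < ‖b‖ := norm_pos_iff.2 hb
  have h := Real.sinh_pos_iff.2 hR
  rw [norm_arc_snd, zero_pow two_ne_zero, sub_zero, S_of_pos (by positivity),
    Real.sqrt_sq hR.le, mul_one, abs_of_pos (by positivity), mul_div_cancel₀ _ hR.ne',
    Real.arsinh_sinh]

/-- A nonconstant arc with `c = 0` at the end has `m = 0`, is a segment with `‖b‖ = arsinh ‖w‖`, and
has its direction fixed by `w`. The identity is treated apart, since there every pair `(0, m)` gives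
the constant path. -/
theorem encard_geodesics_horizontal (w : ℂ) : (geodesics (0, w)).encard = 1 := by
  rcases eq_or_ne w 0 with rfl | hw
  · rw [encard_eq_one]
    refine ⟨arcPath 0 0 (0, 0) (arc_zero_left 0 1), eq_singleton_iff_unique_mem.2
      ⟨mem_geodesics_iff.2 ⟨_, _, _, rfl⟩, fun p hp => ?_⟩⟩
    obtain ⟨b, m, h, rfl⟩ := mem_geodesics_iff.1 hp
    have hb : b = 0 := by
      by_contra hb
      obtain rfl : m = 0 := (eq_zero_or_eq_zero_of_arc_fst (by rw [h])).resolve_left hb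
      have h1 := norm_eq_arsinh hb
      rw [h] at h1
      exact hb (by simpa using h1)
    subst hb
    exact Path.ext (funext fun t => (arc_zero_left m t).trans (arc_zero_left 0 t).symm)
  · have hne : ((0, w) : CSU) ≠ one := fun h => hw (congrArg Prod.snd h)
    have hr := norm_pos_iff.2 hw
    have hpi : -Real.pi ^ 2 < Real.arsinh ‖w‖ ^ 2 := by
      have := Real.pi_pos
      have : 0 < Real.pi ^ 2 := by positivity
      linarith [sq_nonneg (Real.arsinh ‖w‖)]
    have h0 := sq_div_S_arsinh_sq hr
    have h1 := arc_control_eq hpi h0.ge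
    rw [h0, Real.sqrt_zero, height_arsinh_sq hr, neg_zero] at h1
    rw [encard_geodesics hne, encard_eq_one]
    refine ⟨(control (Real.arsinh ‖w‖ ^ 2) 0 w, 0), eq_singleton_iff_unique_mem.2 ⟨h1, ?_⟩⟩
    rintro ⟨b, m⟩ h
    rw [mem_params] at h
    have hb : b ≠ 0 := by
      rintro rfl
      exact hne (h.symm.trans (arc_zero_left m 1))
    obtain rfl : m = 0 := (eq_zero_or_eq_zero_of_arc_fst (by rw [h])).resolve_left hb
    have h2 := norm_eq_arsinh hb
    have h3 := eq_control (b := b) (m := 0) (by rw [h]; exact hw)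
    rw [h, h2, h, zero_pow two_ne_zero, sub_zero] at h3
    rw [h3]

/-! ### All other points -/

theorem threshold_star (k : ℕ) (w : ℂ) : threshold k (star w) = threshold k w := by
  rw [threshold, threshold, norm_star]

/-- Normalization to negative first coordinate: reflect if `c > 0`. The thresholds depend only on
`‖w‖` and do not change. -/
theorem encard_geodesics_eq_neg_abs {c : ℝ} (hc : c ≠ 0) (w : ℂ) : ∃ w' : ℂ, ‖w'‖ = ‖w‖ ∧
    (∀ k, threshold k w' = threshold k w) ∧
    (geodesics (c, w)).encard = (params (-|c|, w')).encard := by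
  rw [encard_geodesics fun h => hc (congrArg Prod.fst h)]
  rcases lt_or_gt_of_ne hc with h | h
  · exact ⟨w, rfl, fun _ => rfl, by rw [abs_of_neg h, neg_neg]⟩
  · exact ⟨star w, norm_star w, fun k => threshold_star k w, by
      rw [abs_of_pos h, encard_params_star]⟩

theorem encard_geodesics_of_lt {c : ℝ} {w : ℂ} (hc : c ≠ 0) (hw : w ≠ 0) (k : ℕ)
    (h : ∀ n, 1 ≤ n → n ≤ k → threshold n w < |c|) (h' : ∀ n, k < n → |c| < threshold n w) :
    (geodesics (c, w)).encard = 2 * k + 1 := by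
  obtain ⟨w', h1, h2, h3⟩ := encard_geodesics_eq_neg_abs hc w
  have hw' : w' ≠ 0 := by rwa [← norm_ne_zero_iff, h1, norm_ne_zero_iff]
  rw [h3]
  exact encard_params_of_lt (neg_neg_iff_pos.2 (abs_pos.2 hc)) hw' k
    (by simpa only [neg_neg, h2] using h) (by simpa only [neg_neg, h2] using h')

theorem encard_geodesics_of_eq {c : ℝ} {w : ℂ} (hc : c ≠ 0) (hw : w ≠ 0) {k : ℕ} (hk : 1 ≤ k)
    (h : threshold k w = |c|) : (geodesics (c, w)).encard = 2 * k := by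
  obtain ⟨w', h1, h2, h3⟩ := encard_geodesics_eq_neg_abs hc w
  have hw' : w' ≠ 0 := by rwa [← norm_ne_zero_iff, h1, norm_ne_zero_iff]
  rw [h3]
  exact encard_params_of_eq (neg_neg_iff_pos.2 (abs_pos.2 hc)) hw' hk (by rw [neg_neg, h2, h])

theorem exists_isGreatest_threshold {w : ℂ} (hw : w ≠ 0) {v : ℝ}
    (h : {k : ℕ | 1 ≤ k ∧ threshold k w ≤ v}.Nonempty) :
    ∃ k, IsGreatest {k : ℕ | 1 ≤ k ∧ threshold k w ≤ v} k := by
  obtain ⟨n, hn⟩ := exists_lt_threshold hw v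
  refine (BddAbove.finite ⟨n, fun k hk => ?_⟩ : Set.Finite _).exists_maximal h |>.imp
    fun k hk => ⟨hk.1, fun j hj => ?_⟩
  · by_contra! hlt
    exact absurd (hn k hlt.le) (not_lt.2 hk.2)
  · by_contra! hlt
    exact absurd (hk.2 hj hlt.le) (not_le.2 hlt)

end CSU

end

theorem mainTheorem1 :
    -- points of the vertical line, other than the identity
    (∀ c : ℝ, c ≠ 0 →
      ¬ (CSU.geodesics (c, 0)).Countable ∧
      Countable (Quotient (CSU.geometricallySimilar (c, 0))) ∧
      Infinite (Quotient (CSU.geometricallySimilar (c, 0)))) ∧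
    -- points of the horizontal space
    (∀ w : ℂ, (CSU.geodesics (0, w)).encard = 1 ∧
      ∀ p ∈ CSU.geodesics (0, w), ∀ t, (p t).1 = 0) ∧
    -- all other points
    (∀ (c : ℝ) (w : ℂ), c ≠ 0 → w ≠ 0 →
      ({k : ℕ | 1 ≤ k ∧ CSU.threshold k w ≤ |c|} = ∅ → (CSU.geodesics (c, w)).encard = 1) ∧
      ({k : ℕ | 1 ≤ k ∧ CSU.threshold k w ≤ |c|}.Nonempty →
        ∃ k : ℕ, IsGreatest {k : ℕ | 1 ≤ k ∧ CSU.threshold k w ≤ |c|} k ∧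
          (CSU.threshold k w < |c| → (CSU.geodesics (c, w)).encard = 2 * k + 1) ∧
          (CSU.threshold k w = |c| → (CSU.geodesics (c, w)).encard = 2 * k))) := by
  refine ⟨fun c hc => ⟨CSU.not_countable_geodesics_axis hc, CSU.countable_quotient_axis hc,
    CSU.infinite_quotient_axis hc⟩, fun w => ⟨CSU.encard_geodesics_horizontal w,
    fun p hp => CSU.fst_eq_zero_of_mem_geodesics hp⟩, fun c w hc hw => ⟨fun h => ?_, fun h => ?_⟩⟩
  -- With no admissible `k` the general count applies with `0`, where the condition on lower
  -- thresholds is void.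
  · have h1 := CSU.encard_geodesics_of_lt hc hw 0 (fun n h1 h2 => by omega) fun n hn => by
      by_contra! hle
      exact (eq_empty_iff_forall_notMem.1 h) n ⟨hn, hle⟩
    simpa using h1
  · obtain ⟨k, hk⟩ := CSU.exists_isGreatest_threshold hw h
    refine ⟨k, hk, fun hlt => CSU.encard_geodesics_of_lt hc hw k (fun n h1 h2 => ?_) fun n hn => ?_,
      CSU.encard_geodesics_of_eq hc hw hk.1.1⟩
    · rcases h2.eq_or_lt with rfl | h2
      · exact hlt
      · exact (CSU.threshold_lt h1 h2 hw).trans hlt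
    · by_contra! hle
      exact absurd (hk.2 ⟨by omega, hle⟩) (not_le.2 hn)
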